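/- For a positive integer $n$ and $A,B\in[0,1]$, let $(X,G)\sim\mathrm{SSBM}(n,2,A,B)$ mean: the labels $X_1,\dots,X_n$ are i.i.d. uniform on $\{1,2\}$ and, given $X$, $G$ is the random simple graph on $[n]$ in which each pair $u<v$ is joined independently, with probability $A$ if $X_u=X_v$ and $B$ if $X_u\neq X_v$. For a graph $G$ on $[n]$ let $C_m$ be the number of $m$-cycles in $G$ (subgraphs isomorphic to the cycle on $m$ vertices), let $m_n=\lfloor(\log n)^{1/4}\rfloor$ with the natural logarithm, and put $$\hat d_n=\frac{2|E(G)|}{n},\qquad \hat f_n=\bigl(2m_nC_{m_n}-\hat d_n^{\,m_n}\bigr)^{1/m_n}$$ (with an arbitrary conventional value of $\hat f_n$ where the radicand is negative or $m_n=0$). Let $a\ge b\ge 0$ be real numbers with $(a-b)^2>2(a+b)$, and let $G\sim\mathrm{SSBM}(n,2,a/n,b/n)$ for $n\ge a$. Then: 1. $\hat d_n+\hat f_n$ and $\hat d_n-\hat f_n$ are consistent estimators of $a$ and $b$ respectively: for every $\varepsilon>0$, $\mathbb P\{|\hat d_n+\hat f_n-a|\ge\varepsilon\}\to0$ and $\mathbb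 P\{|\hat d_n-\hat f_n-b|\ge\varepsilon\}\to0$ as $n\to\infty$. 2. $\hat d_n$ and $\hat f_n$ can be calculated in polynomial time, with high probability over $G$: there is a single deterministic algorithm, not depending on $a$ and $b$, which takes as input a graph $G$ on $n$ vertices and a precision $k\in\mathbb N$, always halts in time polynomial in $n+k$ (on a random access machine with logarithmic cost), and is such that for all $a,b$ as above, with probability $1-o(1)$ as $n\to\infty$, for every $k$ it outputs $\hat d_n$ exactly, as a fraction, and a fraction within $2^{-k}$ of $\hat f_n$. -/

import Mathlib

open Filter Topology

noncomputable section

/-! ### The stochastic block model -/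

/-- The pairs `u < v` of vertices. -/
def vertexPairs (n : ℕ) : Finset (Fin n × Fin n) :=
  Finset.univ.filter fun e => e.1 < e.2

/-- The probability that `SBM(n, p, W)` gives to the labelling `x` and the graph `G`: the labels are
i.i.d. with law `p`, and given the labels each pair `u < v` is joined independently with
probability `W (x u) (x v)`. -/
def sbmMass {n k : ℕ} (p : Fin k → ℝ) (W : Matrix (Fin k) (Fin k) ℝ)
    (x : Fin n → Fin k) (G : SimpleGraph (Fin n)) : ℝ :=
  open Classical in
  (∏ u, p (x u)) *
    ∏ e ∈ vertexPairs n, if G.Adj e.1 e.2 then W (x e.1) (x e.2) else 1 - W (x e.1) (x e.2)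

/-- The probability of an event `S` about `(X, G)` when `(X, G)` is drawn under `SBM(n, p, W)`. -/
def sbmProb {n k : ℕ} (p : Fin k → ℝ) (W : Matrix (Fin k) (Fin k) ℝ)
    (S : Set ((Fin n → Fin k) × SimpleGraph (Fin n))) : ℝ :=
  open Classical in
  ∑ x : Fin n → Fin k, ∑ G : SimpleGraph (Fin n), if (x, G) ∈ S then sbmMass p W x G else 0

/-- The probability of an event `S` about `(X, G)` when `(X, G)` is drawn under
`SSBM(n, k, A, B)`: uniform labels, and `W` equal to `A` on the diagonal and to `B` off it. -/
def ssbmProb (n k : ℕ) (A B : ℝ) (S : Set ((Fin n → Fin k) × SimpleGraph (Fin n))) : ℝ :=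
  sbmProb (fun _ => 1 / (k : ℝ)) (Matrix.of fun i j => if i = j then A else B) S

/-! ### The estimators -/

/-- The number `C_m` of `m`-cycles of `G`: the number of subgraphs of `G` isomorphic to the cycle
graph on `m` vertices. -/
def cycleCount {n : ℕ} (G : SimpleGraph (Fin n)) (m : ℕ) : ℕ :=
  G.copyCount (SimpleGraph.cycleGraph m)

/-- `m_n = ⌊(log n) ^ (1/4)⌋`. -/
def cycleLength (n : ℕ) : ℕ := ⌊Real.log n ^ (1 / 4 : ℝ)⌋₊

/-- The average degree `2 |E(G)| / n`. -/
def dHat {n : ℕ} (G : SimpleGraph (Fin n)) : ℝ := 2 * (G.edgeSet.ncard : ℝ) / n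

/-- The number `2 m_n C_{m_n} - d̂_n ^ m_n`. -/
def radicand {n : ℕ} (G : SimpleGraph (Fin n)) : ℝ :=
  2 * (cycleLength n : ℝ) * (cycleCount G (cycleLength n) : ℝ) - dHat G ^ cycleLength n

/-- The `m_n`-th root of `radicand G`. Where the radicand is negative there is no such real root in
general and the value is a junk value of the real power. -/
def fHat {n : ℕ} (G : SimpleGraph (Fin n)) : ℝ :=
  radicand G ^ (1 / (cycleLength n : ℝ))

/-- `est` is a (weakly) consistent estimator of `θ` under `SSBM(n, 2, a/n, b/n)`: it converges in
probability to `θ` as `n → ∞`. -/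
def IsConsistent (a b : ℝ) (est : ∀ n : ℕ, SimpleGraph (Fin n) → ℝ) (θ : ℝ) : Prop :=
  ∀ ε : ℝ, 0 < ε →
    Tendsto (fun n : ℕ => ssbmProb n 2 (a / n) (b / n) {z | ε ≤ |est n z.2 - θ|}) atTop (𝓝 0)

end

/-! ### Random access machines with logarithmic cost -/

namespace RAM

/-- Arithmetic operations on natural numbers (subtraction is truncated, division is rounded
down). -/
inductive Op where
  | add | sub | mul | div

/-- The value of an operation. -/
def Op.eval : Op → ℕ → ℕ → ℕ
  | .add, x, y => x + y
  | .sub, x, y => x - y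
  | .mul, x, y => x * y
  | .div, x, y => x / y

/-- A state: registers (of which a program can only name finitely many) and an array that is
addressed indirectly. -/
@[ext]
structure State where
  reg : ℕ → ℕ
  mem : ℕ → ℕ

/-- Overwrite a register. -/
def State.setReg (s : State) (i v : ℕ) : State := { s with reg := Function.update s.reg i v }

/-- Overwrite an array cell. -/
def State.setMem (s : State) (i v : ℕ) : State := { s with mem := Function.update s.mem i v }

/-- Programs. -/
inductive Prog where
  | skip
  /-- `reg i := c` -/
  | const (i c : ℕ)
  /-- `reg i := reg j op reg l` -/
  | op (o : Op) (i j l : ℕ)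
  /-- `reg i := mem (reg j)` -/
  | load (i j : ℕ)
  /-- `mem (reg i) := reg j` -/
  | store (i j : ℕ)
  | seq (P Q : Prog)
  /-- `if reg i < reg j then P else Q` -/
  | ifLt (i j : ℕ) (P Q : Prog)
  /-- `while reg i < reg j do P` -/
  | whileLt (i j : ℕ) (P : Prog)

/-- `Exec P s s' t`: started in the state `s`, the program `P` halts in the state `s'` after time
`t`. Every elementary step is charged one plus the number of bits of all numbers (operands,
addresses and results) that it handles. -/
inductive Exec : Prog → State → State → ℕ → Prop where
  | skip (s : State) : Exec .skip s s 1
  | const (s : State) (i c : ℕ) : Exec (.const i c) s (s.setReg i c) (1 + Nat.size c)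
  | op (s : State) (o : Op) (i j l : ℕ) :
      Exec (.op o i j l) s (s.setReg i (o.eval (s.reg j) (s.reg l)))
        (1 + Nat.size (s.reg j) + Nat.size (s.reg l) + Nat.size (o.eval (s.reg j) (s.reg l)))
  | load (s : State) (i j : ℕ) :
      Exec (.load i j) s (s.setReg i (s.mem (s.reg j)))
        (1 + Nat.size (s.reg j) + Nat.size (s.mem (s.reg j)))
  | store (s : State) (i j : ℕ) :
      Exec (.store i j) s (s.setMem (s.reg i) (s.reg j))
        (1 + Nat.size (s.reg i) + Nat.size (s.reg j))
  | seq {P Q : Prog} {s₁ s₂ s₃ : State} {t₁ t₂ : ℕ}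
      (h₁ : Exec P s₁ s₂ t₁) (h₂ : Exec Q s₂ s₃ t₂) : Exec (.seq P Q) s₁ s₃ (t₁ + t₂)
  | ifTrue {i j : ℕ} {P Q : Prog} {s s' : State} {t : ℕ}
      (hlt : s.reg i < s.reg j) (h : Exec P s s' t) :
      Exec (.ifLt i j P Q) s s' (1 + Nat.size (s.reg i) + Nat.size (s.reg j) + t)
  | ifFalse {i j : ℕ} {P Q : Prog} {s s' : State} {t : ℕ}
      (hlt : ¬ s.reg i < s.reg j) (h : Exec Q s s' t) :
      Exec (.ifLt i j P Q) s s' (1 + Nat.size (s.reg i) + Nat.size (s.reg j) + t)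
  | whileTrue {i j : ℕ} {P : Prog} {s₁ s₂ s₃ : State} {t₁ t₂ : ℕ}
      (hlt : s₁.reg i < s₁.reg j) (h₁ : Exec P s₁ s₂ t₁) (h₂ : Exec (.whileLt i j P) s₂ s₃ t₂) :
      Exec (.whileLt i j P) s₁ s₃ (1 + Nat.size (s₁.reg i) + Nat.size (s₁.reg j) + t₁ + t₂)
  | whileFalse {i j : ℕ} {P : Prog} {s : State} (hlt : ¬ s.reg i < s.reg j) :
      Exec (.whileLt i j P) s s (1 + Nat.size (s.reg i) + Nat.size (s.reg j))

open Classical in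
/-- The initial state on input a graph `G` on `n` vertices and a precision `k`: register `0` holds
`n`, register `1` holds `k`, the array holds the adjacency matrix of `G` row by row, and everything
else is zero. -/
noncomputable def input {n : ℕ} (G : SimpleGraph (Fin n)) (k : ℕ) : State where
  reg i := if i = 0 then n else if i = 1 then k else 0
  mem i := if ∃ u v : Fin n, i = u * n + v ∧ G.Adj u v then 1 else 0

/-- On every graph `G` and every precision `k`, the program halts within a time that is polynomial
in the number of vertices and `k`. -/
def PolyTime (P : Prog) : Prop :=
  ∃ c : ℕ, ∀ (n : ℕ) (G : SimpleGraph (Fin n)) (k : ℕ),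
    ∃ (s : State) (t : ℕ), Exec P (input G k) s t ∧ t ≤ (n + k + 2) ^ c

/-- On input `G` and any precision `k`, the program outputs `d` exactly, as the quotient of
registers `0` and `1`, and `f` up to an error of at most `2 ^ (-k)`, as the quotient of registers
`2` and `3`. -/
def Calculates (P : Prog) {n : ℕ} (G : SimpleGraph (Fin n)) (d f : ℝ) : Prop :=
  ∀ k : ℕ, ∃ (s : State) (t : ℕ), Exec P (input G k) s t ∧
    0 < s.reg 1 ∧ d = (s.reg 0 : ℝ) / (s.reg 1 : ℝ) ∧
    0 < s.reg 3 ∧ |f - (s.reg 2 : ℝ) / (s.reg 3 : ℝ)| ≤ (1 / 2 : ℝ) ^ k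

end RAM

/-! Put d = (a+b)/2 and f = (a-b)/2, so that the hypothesis reads d < f^2.

Consistency rests on a second moment computation. Averaged over the labels, a given placement of the
m-cycle is present with probability (d^m + f^m)/n^m, because the 2 × 2 label matrix has eigenvalues
A+B and A-B (`templateProb_cycleEdges`). Hence 2m C_m, the number of labelled cycles, has mean close
to d^m + f^m. In its variance (`variance_copies_le`) vertex-disjoint placements are independent and
cancel against the squared mean. Placements of the same cycle contribute at most 2m(d^m + f^m). Two
different cycles that meet share fewer edges than vertices (`card_cycleImage_union`), so all such
pairs together contribute only O(1/n) up to a factor (a^2(m+1))^m. Divided by f^(2m), the second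
contribution vanishes because d < f^2, and the third because n ≥ exp(m^4). The average degree has
mean square error O(1/n) about d, so its m-th power is a sharp enough substitute for d^m. The
radicand therefore lies between f^m/2 and 2f^m with high probability (`whp_radicand`), and the m-th
root sends both constants to 1.

The algorithm has three difficulties. The first is to find m_n exactly, that is, to decide whether
exp(j^4) ≤ n. A partial sum of the exponential series with n+1 terms never exceeds the exponential,
so only a false positive at j = m_n + 1 is to be feared. It is excluded for large n by a
quantitative form of Hermite's argument: a power of e cannot be very close to an integer below it
(`exp_sub_natCast_ge`, `eventually_natCast_lt_taylorNum`).

The second is to count the cycles. A depth first search over self-avoiding walks visits, on average,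
at most n m a^m nodes, so a budget of n^2 nodes suffices with high probability (`whp_walkSize`) and
keeps the time polynomial on every input (`wp_dfs`).

The third is the root, which is found by integer bisection on the scale 2^(-k) (`wp_root`). The
logarithmic cost is controlled by one bound on the bit length of all numbers in a run (`bitBound`),
carried along by the program logic of `wp` and `vc`. -/

/-! ### Expectations over the graph -/

/-- The expectation of a function of the graph under `SSBM(n, 2, A, B)`. -/
noncomputable def graphExp (n : ℕ) (A B : ℝ) (F : SimpleGraph (Fin n) → ℝ) : ℝ :=
  open Classical in
  ∑ x : Fin n → Fin 2, ∑ G : SimpleGraph (Fin n),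
    sbmMass (fun _ => 1 / ((2 : ℕ) : ℝ)) (Matrix.of fun i j => if i = j then A else B) x G * F G

/-- The probability with which the ends of `e` are joined when the labels are `x`. -/
noncomputable def edgeWeight {V : Type*} (A B : ℝ) (x : V → Fin 2) (e : Sym2 V) : ℝ :=
  Sym2.lift ⟨fun u v => if x u = x v then A else B, fun u v => by simp only [eq_comm]⟩ e

@[simp] theorem edgeWeight_mk {V : Type*} (A B : ℝ) (x : V → Fin 2) (u v : V) :
    edgeWeight A B x s(u, v) = if x u = x v then A else B := rfl

theorem edgeWeight_map {V W : Type*} (A B : ℝ) (x : W → Fin 2) (g : V → W) (e : Sym2 V) :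
    edgeWeight A B x (Sym2.map g e) = edgeWeight A B (x ∘ g) e := by
  induction e with | _ u v => simp

theorem edgeWeight_nonneg {V : Type*} {A B : ℝ} (hA : 0 ≤ A) (hB : 0 ≤ B) (x : V → Fin 2)
    (e : Sym2 V) : 0 ≤ edgeWeight A B x e := by
  induction e with | _ u v => simp only [edgeWeight_mk]; split_ifs <;> assumption

theorem edgeWeight_le {V : Type*} {A B : ℝ} (hBA : B ≤ A) (x : V → Fin 2)
    (e : Sym2 V) : edgeWeight A B x e ≤ A := by
  induction e with | _ u v => simp only [edgeWeight_mk]; split_ifs <;> [exact le_rfl; assumption]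

open Classical in
theorem sum_graph_eq_sum_powerset {n : ℕ} (f : Finset (Fin n × Fin n) → ℝ) :
    ∑ G : SimpleGraph (Fin n), f ((vertexPairs n).filter fun e => G.Adj e.1 e.2) =
      ∑ T ∈ (vertexPairs n).powerset, f T := by
  refine Finset.sum_bij' (fun G _ => (vertexPairs n).filter fun e => G.Adj e.1 e.2)
    (fun T _ => SimpleGraph.fromEdgeSet {e | ∃ p ∈ T, e = s(p.1, p.2)}) ?_ ?_ ?_ ?_ ?_
  · intro G _
    simp
  · intro T _
    exact Finset.mem_univ _
  · intro G _
    ext u v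
    simp only [SimpleGraph.fromEdgeSet_adj, Set.mem_ofPred_eq, Finset.mem_filter, vertexPairs,
      Finset.mem_univ, true_and, Prod.exists]
    constructor
    · rintro ⟨⟨p, q, ⟨-, h⟩, he⟩, -⟩
      rcases Sym2.eq_iff.1 he with ⟨rfl, rfl⟩ | ⟨rfl, rfl⟩
      · exact h
      · exact h.symm
    · intro h
      refine ⟨?_, h.ne⟩
      rcases lt_or_gt_of_ne h.ne with hlt | hlt
      · exact ⟨u, v, ⟨hlt, h⟩, rfl⟩
      · exact ⟨v, u, ⟨hlt, h.symm⟩, Sym2.eq_swap⟩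
  · intro T hT
    ext ⟨u, v⟩
    simp only [SimpleGraph.fromEdgeSet_adj, Set.mem_ofPred_eq, Finset.mem_filter, Prod.exists]
    have hT' := Finset.mem_powerset.1 hT
    constructor
    · rintro ⟨huv, ⟨p, q, h, he⟩, -⟩
      have h1 := hT' h
      simp only [vertexPairs, Finset.mem_filter, Finset.mem_univ, true_and] at h1 huv
      rcases Sym2.eq_iff.1 he with ⟨rfl, rfl⟩ | ⟨rfl, rfl⟩
      · exact h
      · exact absurd h1 (not_lt.2 huv.le)
    · intro h
      refine ⟨hT' h, ⟨u, v, h, rfl⟩, ?_⟩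
      have h1 := hT' h
      simp only [vertexPairs, Finset.mem_filter, Finset.mem_univ, true_and] at h1
      exact h1.ne
  · intro G _
    rfl

-- The requirement that S be present is absorbed into the factors of the absent pairs by replacing 1
-- - w with 0 on S. The sum over all sets of present pairs is then the expansion of a product of
-- sums, whose factor is w on S and 1 elsewhere.
open Classical in
theorem sum_graph_prod_mul_indicator {n : ℕ} (w : Fin n → Fin n → ℝ) (S : Finset (Fin n × Fin n))
    (hS : S ⊆ vertexPairs n) :
    ∑ G : SimpleGraph (Fin n),
      (∏ e ∈ vertexPairs n, if G.Adj e.1 e.2 then w e.1 e.2 else 1 - w e.1 e.2) *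
        (if ∀ e ∈ S, G.Adj e.1 e.2 then 1 else 0) = ∏ e ∈ S, w e.1 e.2 := by
  have key : ∀ G : SimpleGraph (Fin n),
      (∏ e ∈ vertexPairs n, if G.Adj e.1 e.2 then w e.1 e.2 else 1 - w e.1 e.2) *
        (if ∀ e ∈ S, G.Adj e.1 e.2 then 1 else 0) =
      (fun T => (∏ e ∈ T, w e.1 e.2) *
        ∏ e ∈ vertexPairs n \ T, (if e ∈ S then 0 else 1 - w e.1 e.2))
        ((vertexPairs n).filter fun e => G.Adj e.1 e.2) := by
    intro G
    have hsd : vertexPairs n \ ((vertexPairs n).filter fun e => G.Adj e.1 e.2) =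
        (vertexPairs n).filter fun e => ¬ G.Adj e.1 e.2 := by
      ext e; simp only [Finset.mem_sdiff, Finset.mem_filter]; tauto
    simp only [hsd, Finset.prod_ite]
    rw [mul_assoc]
    congr 1
    by_cases h : ∀ e ∈ S, G.Adj e.1 e.2
    · rw [if_pos h, mul_one]
      have h1 : ((vertexPairs n).filter fun e => ¬ G.Adj e.1 e.2).filter (fun e => e ∈ S) = ∅ := by
        ext e
        simp only [Finset.mem_filter, Finset.notMem_empty, iff_false]
        rintro ⟨⟨-, h2⟩, h3⟩
        exact h2 (h e h3)
      have h2 : ((vertexPairs n).filter fun e => ¬ G.Adj e.1 e.2).filter (fun e => e ∉ S) =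
          (vertexPairs n).filter fun e => ¬ G.Adj e.1 e.2 := by
        rw [Finset.filter_eq_self]
        intro e he h3
        exact (Finset.mem_filter.1 he).2 (h e h3)
      rw [h1, h2, Finset.prod_empty, one_mul]
    · rw [if_neg h, mul_zero]
      push Not at h
      obtain ⟨e, he, hne⟩ := h
      symm
      apply mul_eq_zero_of_left
      apply Finset.prod_eq_zero (i := e)
      · simp only [Finset.mem_filter]
        exact ⟨⟨hS he, hne⟩, he⟩
      · rfl
  rw [Finset.sum_congr rfl fun G _ => key G, sum_graph_eq_sum_powerset fun T =>
    (∏ e ∈ T, w e.1 e.2) * ∏ e ∈ vertexPairs n \ T, (if e ∈ S then 0 else 1 - w e.1 e.2),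
    ← Finset.prod_add]
  have : ∀ e ∈ vertexPairs n, (w e.1 e.2 + if e ∈ S then 0 else 1 - w e.1 e.2) =
      if e ∈ S then w e.1 e.2 else 1 := by
    intro e _
    split_ifs <;> ring
  rw [Finset.prod_congr rfl this, Finset.prod_ite_mem, Finset.inter_eq_right.2 hS]

/-- The probability that all edges in `S` are present. -/
noncomputable def edgeProb (n : ℕ) (A B : ℝ) (S : Finset (Sym2 (Fin n))) : ℝ :=
  open Classical in graphExp n A B fun G => if ∀ e ∈ S, e ∈ G.edgeSet then 1 else 0

theorem edgeProb_eq {n : ℕ} (A B : ℝ) (S : Finset (Sym2 (Fin n))) (hS : ∀ e ∈ S, ¬ e.IsDiag) :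
    edgeProb n A B S = (1 / 2) ^ n * ∑ x : Fin n → Fin 2, ∏ e ∈ S, edgeWeight A B x e := by
  classical
  set S' := (vertexPairs n).filter fun e => s(e.1, e.2) ∈ S with hS'
  have hprod : ∀ f : Sym2 (Fin n) → ℝ, ∏ e ∈ S', f s(e.1, e.2) = ∏ e ∈ S, f e := by
    intro f
    refine Finset.prod_bij (fun e _ => s(e.1, e.2)) ?_ ?_ ?_ ?_
    · intro e he
      exact (Finset.mem_filter.1 he).2
    · rintro ⟨u, v⟩ h1 ⟨u', v'⟩ h2 he
      simp only [hS', vertexPairs, Finset.mem_filter, Finset.mem_univ, true_and] at h1 h2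
      rcases Sym2.eq_iff.1 he with ⟨h3, h4⟩ | ⟨h3, h4⟩
      · exact Prod.ext h3 h4
      · simp only at h3 h4
        subst h3 h4
        exact absurd h1.1 (not_lt.2 h2.1.le)
    · intro e he
      induction e with | _ u v =>
      have hne : u ≠ v := fun h => hS _ he (by simpa using h)
      rcases lt_or_gt_of_ne hne with hlt | hlt
      · exact ⟨(u, v), by simp [hS', vertexPairs, hlt, he], rfl⟩
      · exact ⟨(v, u), by simp [hS', vertexPairs, hlt, Sym2.eq_swap, he], Sym2.eq_swap⟩
    · intro e _
      rfl
  have hind : ∀ G : SimpleGraph (Fin n), (∀ e ∈ S, e ∈ G.edgeSet) ↔ ∀ e ∈ S', G.Adj e.1 e.2 := by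
    intro G
    constructor
    · intro h e he
      exact h _ (Finset.mem_filter.1 he).2
    · intro h e he
      induction e with | _ u v =>
      have hne : u ≠ v := fun h => hS _ he (by simpa using h)
      rcases lt_or_gt_of_ne hne with hlt | hlt
      · exact h (u, v) (by simp [hS', vertexPairs, hlt, he])
      · exact (h (v, u) (by simp [hS', vertexPairs, hlt, Sym2.eq_swap, he])).symm
  unfold edgeProb graphExp
  rw [Finset.mul_sum]
  refine Finset.sum_congr rfl fun x _ => ?_
  have := sum_graph_prod_mul_indicator
    (fun u v => (Matrix.of fun i j : Fin 2 => if i = j then A else B) (x u) (x v)) S'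
    (Finset.filter_subset _ _)
  simp only [sbmMass, mul_assoc, hind, ← Finset.mul_sum, this]
  rw [← hprod (edgeWeight A B x)]
  simp

/-! ### Labels seen through an injection -/

/-- The restriction of a uniform labelling along an injection is uniform. The involution on pairs
(x, y) that exchanges `x ∘ g` with y proves this without counting fibres. -/
theorem card_mul_sum_comp_injective {ι κ β : Type*} [Fintype ι] [Fintype κ] [Fintype β]
    [DecidableEq ι] [DecidableEq κ] {g : ι → κ} (hg : Function.Injective g)
    (F : (ι → β) → ℝ) :
    (Fintype.card (ι → β) : ℝ) * ∑ x : κ → β, F (x ∘ g) =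
      (Fintype.card (κ → β) : ℝ) * ∑ y, F y := by
  have hinv : ∀ z : (κ → β) × (ι → β),
      (Function.extend g (z.1 ∘ g) (Function.extend g z.2 z.1), Function.extend g z.2 z.1 ∘ g)
        = z := by
    rintro ⟨x, y⟩
    refine Prod.ext ?_ ?_
    · funext v
      by_cases h : ∃ i, g i = v
      · obtain ⟨i, rfl⟩ := h
        simp [hg.extend_apply]
      · simp [Function.extend_apply' _ _ _ h]
    · simp [Function.extend_comp hg]
  let e : (κ → β) × (ι → β) ≃ (κ → β) × (ι → β) :=
    { toFun := fun z => (Function.extend g z.2 z.1, z.1 ∘ g)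
      invFun := fun z => (Function.extend g z.2 z.1, z.1 ∘ g)
      left_inv := hinv
      right_inv := hinv }
  have h := e.sum_comp fun z => F z.2
  rw [Fintype.sum_prod_type, Fintype.sum_prod_type] at h
  simp only [e, Equiv.coe_fn_mk, Finset.sum_const, Finset.card_univ, nsmul_eq_mul] at h
  rw [Finset.mul_sum]
  exact h

/-- The probability that a graph with edge set `T` occurs at a given place. -/
noncomputable def templateProb {ι : Type*} [Fintype ι] [DecidableEq ι] (A B : ℝ)
    (T : Finset (Sym2 ι)) : ℝ :=
  (1 / 2) ^ Fintype.card ι * ∑ y : ι → Fin 2, ∏ e ∈ T, edgeWeight A B y e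

theorem not_isDiag_map {V W : Type*} {g : V → W} (hg : Function.Injective g) {e : Sym2 V}
    (he : ¬ e.IsDiag) : ¬ (Sym2.map g e).IsDiag := by
  induction e with | _ u v => simpa [hg.eq_iff] using he

theorem edgeProb_image {n : ℕ} {ι : Type*} [Fintype ι] [DecidableEq ι] (A B : ℝ)
    (T : Finset (Sym2 ι)) (hT : ∀ e ∈ T, ¬ e.IsDiag) {g : ι → Fin n}
    (hg : Function.Injective g) :
    edgeProb n A B (T.image (Sym2.map g)) = templateProb A B T := by
  rw [edgeProb_eq, templateProb]
  · have h := card_mul_sum_comp_injective hg fun y : ι → Fin 2 => ∏ e ∈ T, edgeWeight A B y e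
    simp only [Finset.prod_image (Sym2.map.injective hg).injOn, edgeWeight_map]
    simp only [Fintype.card_fun, Fintype.card_fin, Nat.cast_pow, Nat.cast_ofNat] at h
    simp only [one_div, inv_pow]
    field_simp
    linarith
  · intro e he
    obtain ⟨e, he', rfl⟩ := Finset.mem_image.1 he
    exact not_isDiag_map hg (hT e he')

/-- Disjoint placements are independent even after averaging over the labels: together they form one
injection of `ι ⊕ ι`, and the sum over its labels factorises. -/
theorem edgeProb_image_union {n : ℕ} {ι : Type*} [Fintype ι] [DecidableEq ι] (A B : ℝ)
    (T : Finset (Sym2 ι)) (hT : ∀ e ∈ T, ¬ e.IsDiag) {g h : ι → Fin n}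
    (hg : Function.Injective g) (hh : Function.Injective h) (hgh : ∀ i j, g i ≠ h j) :
    edgeProb n A B (T.image (Sym2.map g) ∪ T.image (Sym2.map h)) = templateProb A B T ^ 2 := by
  have hinj : Function.Injective (Sum.elim g h) := hg.sumElim hh hgh
  set T' : Finset (Sym2 (ι ⊕ ι)) := T.image (Sym2.map Sum.inl) ∪ T.image (Sym2.map Sum.inr) with hT'
  have himage : T'.image (Sym2.map (Sum.elim g h)) =
      T.image (Sym2.map g) ∪ T.image (Sym2.map h) := by
    rw [hT', Finset.image_union, Finset.image_image, Finset.image_image]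
    congr 2 <;> · funext e; simp [Sym2.map_map]
  have hdisj : Disjoint (T.image (Sym2.map (Sum.inl : ι → ι ⊕ ι)))
      (T.image (Sym2.map (Sum.inr : ι → ι ⊕ ι))) := by
    rw [Finset.disjoint_left]
    intro e he he'
    obtain ⟨e₁, -, rfl⟩ := Finset.mem_image.1 he
    obtain ⟨e₂, -, h2⟩ := Finset.mem_image.1 he'
    induction e₁ with | _ u v =>
    induction e₂ with | _ u' v' =>
    simp at h2
  rw [← himage, edgeProb_image A B T' _ hinj, templateProb, templateProb]
  · have : ∀ y : ι ⊕ ι → Fin 2, ∏ e ∈ T', edgeWeight A B y e =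
        (∏ e ∈ T, edgeWeight A B (y ∘ Sum.inl) e) * ∏ e ∈ T, edgeWeight A B (y ∘ Sum.inr) e := by
      intro y
      rw [hT', Finset.prod_union hdisj,
        Finset.prod_image (Sym2.map.injective Sum.inl_injective).injOn,
        Finset.prod_image (Sym2.map.injective Sum.inr_injective).injOn]
      simp only [edgeWeight_map]
    simp only [this]
    have h2 := (Equiv.sumArrowEquivProdArrow ι ι (Fin 2)).sum_comp
      fun z => (∏ e ∈ T, edgeWeight A B z.1 e) * ∏ e ∈ T, edgeWeight A B z.2 e
    have h3 : ∑ y : ι ⊕ ι → Fin 2, (∏ e ∈ T, edgeWeight A B (y ∘ Sum.inl) e) *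
        ∏ e ∈ T, edgeWeight A B (y ∘ Sum.inr) e =
        (∑ y : ι → Fin 2, ∏ e ∈ T, edgeWeight A B y e) *
          ∑ y : ι → Fin 2, ∏ e ∈ T, edgeWeight A B y e := by
      rw [Finset.sum_mul_sum, ← Fintype.sum_prod_type', ← h2]
      rfl
    rw [h3, Fintype.card_sum, pow_add]
    ring
  · intro e he
    rw [hT', Finset.mem_union] at he
    rcases he with he | he <;> obtain ⟨e, he', rfl⟩ := Finset.mem_image.1 he
    · exact not_isDiag_map Sum.inl_injective (hT e he')
    · exact not_isDiag_map Sum.inr_injective (hT e he')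

/-- For overlapping placements the labels are discarded and every edge is charged A. As A ≤ 1, a
lower bound on the number of edges is enough. -/
theorem edgeProb_le {n : ℕ} {A B : ℝ} (hB : 0 ≤ B) (hBA : B ≤ A) (hA : A ≤ 1)
    (S : Finset (Sym2 (Fin n))) (hS : ∀ e ∈ S, ¬ e.IsDiag) {j : ℕ} (hj : j ≤ S.card) :
    edgeProb n A B S ≤ A ^ j := by
  rw [edgeProb_eq A B S hS]
  have h : ∀ x ∈ (Finset.univ : Finset (Fin n → Fin 2)), ∏ e ∈ S, edgeWeight A B x e ≤ A ^ j := by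
    intro x _
    calc ∏ e ∈ S, edgeWeight A B x e ≤ ∏ _e ∈ S, A :=
          Finset.prod_le_prod (fun e _ => edgeWeight_nonneg (hB.trans hBA) hB x e)
            fun e _ => edgeWeight_le hBA x e
      _ = A ^ S.card := by simp
      _ ≤ A ^ j := pow_le_pow_of_le_one (hB.trans hBA) hA hj
  calc (1 / 2 : ℝ) ^ n * ∑ x : Fin n → Fin 2, ∏ e ∈ S, edgeWeight A B x e
      ≤ (1 / 2 : ℝ) ^ n * ∑ _x : Fin n → Fin 2, A ^ j := by gcongr with x hx; exact h x hx
    _ = A ^ j := by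
      simp only [Finset.sum_const, Finset.card_univ, Fintype.card_fun, Fintype.card_fin,
        nsmul_eq_mul, Nat.cast_pow, Nat.cast_ofNat]
      rw [← mul_assoc, ← mul_pow]
      norm_num

/-! ### Elementary properties of the expectation -/

section graphExp

variable {n : ℕ} {A B : ℝ}

theorem graphExp_add (F F' : SimpleGraph (Fin n) → ℝ) :
    graphExp n A B (fun G => F G + F' G) = graphExp n A B F + graphExp n A B F' := by
  simp only [graphExp, mul_add, Finset.sum_add_distrib]

theorem graphExp_const_mul (c : ℝ) (F : SimpleGraph (Fin n) → ℝ) :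
    graphExp n A B (fun G => c * F G) = c * graphExp n A B F := by
  simp only [graphExp, Finset.mul_sum]
  exact Finset.sum_congr rfl fun x _ => Finset.sum_congr rfl fun G _ => by ring

theorem graphExp_sum {ι : Type*} (s : Finset ι) (F : ι → SimpleGraph (Fin n) → ℝ) :
    graphExp n A B (fun G => ∑ i ∈ s, F i G) = ∑ i ∈ s, graphExp n A B (F i) := by
  simp only [graphExp, Finset.mul_sum]
  rw [Finset.sum_comm (s := s)]
  exact Finset.sum_congr rfl fun x _ => Finset.sum_comm

theorem graphExp_one : graphExp n A B (fun _ => 1) = 1 := by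
  have h := edgeProb_eq (n := n) A B ∅ (by simp)
  simp only [edgeProb, Finset.notMem_empty, false_imp_iff, implies_true, if_true,
    Finset.prod_empty, Finset.sum_const, Finset.card_univ, Fintype.card_fun, Fintype.card_fin,
    nsmul_eq_mul, mul_one, Nat.cast_pow, Nat.cast_ofNat, ← mul_pow] at h
  rw [h]
  norm_num

theorem sbmMass_nonneg (hA : 0 ≤ A) (hA' : A ≤ 1) (hB : 0 ≤ B) (hB' : B ≤ 1)
    (x : Fin n → Fin 2) (G : SimpleGraph (Fin n)) :
    0 ≤ sbmMass (fun _ => 1 / ((2 : ℕ) : ℝ)) (Matrix.of fun i j => if i = j then A else B) x G := by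
  unfold sbmMass
  refine mul_nonneg (Finset.prod_nonneg fun _ _ => by positivity)
    (Finset.prod_nonneg fun e _ => ?_)
  simp only [Matrix.of_apply]
  split_ifs <;> linarith

theorem graphExp_mono (hA : 0 ≤ A) (hA' : A ≤ 1) (hB : 0 ≤ B) (hB' : B ≤ 1)
    {F F' : SimpleGraph (Fin n) → ℝ} (h : ∀ G, F G ≤ F' G) :
    graphExp n A B F ≤ graphExp n A B F' := by
  unfold graphExp
  gcongr with x _ G _
  · exact sbmMass_nonneg hA hA' hB hB' x G
  · exact h G

theorem graphExp_nonneg (hA : 0 ≤ A) (hA' : A ≤ 1) (hB : 0 ≤ B) (hB' : B ≤ 1)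
    {F : SimpleGraph (Fin n) → ℝ} (h : ∀ G, 0 ≤ F G) : 0 ≤ graphExp n A B F := by
  unfold graphExp
  exact Finset.sum_nonneg fun x _ => Finset.sum_nonneg fun G _ =>
    mul_nonneg (sbmMass_nonneg hA hA' hB hB' x G) (h G)

open Classical in
theorem ssbmProb_eq_graphExp (Q : SimpleGraph (Fin n) → Prop) :
    ssbmProb n 2 A B {z | Q z.2} = graphExp n A B fun G => if Q G then 1 else 0 := by
  unfold ssbmProb sbmProb graphExp
  refine Finset.sum_congr rfl fun x _ => Finset.sum_congr rfl fun G _ => ?_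
  simp only [Set.mem_ofPred_eq]
  split_ifs <;> simp

end graphExp

/-! ### First and second moments of labelled copy counts -/

section copies

variable {n : ℕ} {ι : Type*} [Fintype ι] [DecidableEq ι]

open Classical in
/-- The number of injections of `ι` into the vertices of `G` that map every edge in `T` to an edge
of `G`. -/
noncomputable def copies (T : Finset (Sym2 ι)) (G : SimpleGraph (Fin n)) : ℕ :=
  (Finset.univ.filter fun g : ι ↪ Fin n => ∀ e ∈ T, Sym2.map g e ∈ G.edgeSet).card

open Classical in
theorem cast_copies (T : Finset (Sym2 ι)) (G : SimpleGraph (Fin n)) :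
    (copies T G : ℝ) =
      ∑ g : ι ↪ Fin n, if ∀ e ∈ T.image (Sym2.map g), e ∈ G.edgeSet then 1 else 0 := by
  rw [Finset.sum_boole, copies]
  simp only [Finset.forall_mem_image]

theorem graphExp_copies (A B : ℝ) (T : Finset (Sym2 ι)) (hT : ∀ e ∈ T, ¬ e.IsDiag) :
    graphExp n A B (fun G => (copies T G : ℝ)) =
      (n.descFactorial (Fintype.card ι) : ℝ) * templateProb A B T := by
  simp only [cast_copies]
  rw [graphExp_sum]
  have h : ∀ g : ι ↪ Fin n, edgeProb n A B (T.image (Sym2.map g)) = templateProb A B T :=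
    fun g => edgeProb_image A B T hT g.injective
  simp only [edgeProb] at h
  simp only [h, Finset.sum_const, Finset.card_univ, Fintype.card_embedding_eq, Fintype.card_fin,
    nsmul_eq_mul]

theorem graphExp_copies_le {A B : ℝ} (hB : 0 ≤ B) (hBA : B ≤ A) (hA : A ≤ 1) (T : Finset (Sym2 ι))
    (hT : ∀ e ∈ T, ¬ e.IsDiag) :
    graphExp n A B (fun G => (copies T G : ℝ)) ≤ (n : ℝ) ^ Fintype.card ι * A ^ T.card := by
  have h : ∀ g : ι ↪ Fin n, edgeProb n A B (T.image (Sym2.map g)) ≤ A ^ T.card := by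
    intro g
    refine edgeProb_le hB hBA hA _ ?_
      (Finset.card_image_of_injective _ (Sym2.map.injective g.injective)).ge
    intro e he
    obtain ⟨e, he', rfl⟩ := Finset.mem_image.1 he
    exact not_isDiag_map g.injective (hT e he')
  simp only [cast_copies]
  rw [graphExp_sum]
  simp only [edgeProb] at h
  refine (Finset.sum_le_sum fun g _ => h g).trans ?_
  simp only [Finset.sum_const, Finset.card_univ, Fintype.card_embedding_eq, Fintype.card_fin,
    nsmul_eq_mul]
  have : 0 ≤ A := hB.trans hBA
  gcongr
  exact_mod_cast Nat.descFactorial_le_pow n _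

theorem graphExp_copies_sq (A B : ℝ) (T : Finset (Sym2 ι)) :
    graphExp n A B (fun G => (copies T G : ℝ) ^ 2) =
      ∑ g : ι ↪ Fin n, ∑ h : ι ↪ Fin n,
        edgeProb n A B (T.image (Sym2.map g) ∪ T.image (Sym2.map h)) := by
  classical
  have h : ∀ G : SimpleGraph (Fin n), (copies T G : ℝ) ^ 2 = ∑ g : ι ↪ Fin n, ∑ h : ι ↪ Fin n,
      if ∀ e ∈ T.image (Sym2.map g) ∪ T.image (Sym2.map h), e ∈ G.edgeSet then (1 : ℝ) else 0 := by
    intro G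
    rw [cast_copies, sq, Finset.sum_mul_sum]
    refine Finset.sum_congr rfl fun g _ => Finset.sum_congr rfl fun h _ => ?_
    simp only [Finset.forall_mem_union]
    split_ifs <;> simp_all
  simp only [h, graphExp_sum, edgeProb]

/-- The number of places at which `h` takes a value of `g`. -/
def overlap (g h : ι → Fin n) : ℕ := (Finset.univ.filter fun i => ∃ j, g j = h i).card

theorem overlap_le {ι : Type*} [Fintype ι] (g h : ι → Fin n) : overlap g h ≤ Fintype.card ι :=
  Finset.card_filter_le _ _

theorem card_le_overlap {ι : Type*} [Fintype ι] {g h : ι → Fin n} {J : Finset ι}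
    (hJ : ∀ i ∈ J, ∃ j, g j = h i) : J.card ≤ overlap g h :=
  Finset.card_le_card fun i hi => Finset.mem_filter.2 ⟨Finset.mem_univ i, hJ i hi⟩

/-- After enlarging the sum from injections to all maps h, the summand is a product over the
coordinates of h. In each coordinate at most |ι| values weigh n and the others weigh 1, which gives
at most n(|ι| + 1). -/
theorem sum_pow_overlap_le (g : ι → Fin n) :
    ∑ h : ι ↪ Fin n, (n : ℝ) ^ overlap g h ≤
      (n : ℝ) ^ Fintype.card ι * (Fintype.card ι + 1 : ℝ) ^ Fintype.card ι := by
  have h1 : ∀ h : ι → Fin n, (n : ℝ) ^ overlap g h =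
      ∏ i, (if ∃ j, g j = h i then (n : ℝ) else 1) := by
    intro h
    rw [Finset.prod_ite, overlap]
    simp
  calc ∑ h : ι ↪ Fin n, (n : ℝ) ^ overlap g h
      = ∑ h ∈ (Finset.univ : Finset (ι ↪ Fin n)).map ⟨_, DFunLike.coe_injective⟩,
          (n : ℝ) ^ overlap g h := by simp [Finset.sum_map]
    _ ≤ ∑ h : ι → Fin n, (n : ℝ) ^ overlap g h :=
        Finset.sum_le_sum_of_subset_of_nonneg (Finset.subset_univ _) fun _ _ _ => by positivity
    _ = ∏ _i : ι, ∑ v : Fin n, (if ∃ j, g j = v then (n : ℝ) else 1) := by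
        simp only [h1]
        rw [Finset.prod_univ_sum]
        simp
    _ ≤ ∏ _i : ι, (n * (Fintype.card ι + 1) : ℝ) := by
        refine Finset.prod_le_prod (fun i _ => Finset.sum_nonneg fun v _ => by positivity)
          fun i _ => ?_
        have h2 : ∀ v : Fin n, (if ∃ j, g j = v then (n : ℝ) else 1) ≤
            (if ∃ j, g j = v then (n : ℝ) else 0) + 1 := by
          intro v; split_ifs <;> simp
        refine (Finset.sum_le_sum fun v _ => h2 v).trans ?_
        rw [Finset.sum_add_distrib, ← Finset.sum_filter, Finset.sum_const, nsmul_eq_mul]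
        have h3 : (Finset.univ.filter fun v : Fin n => ∃ j, g j = v).card ≤ Fintype.card ι := by
          have : (Finset.univ.filter fun v : Fin n => ∃ j, g j = v) = Finset.univ.image g := by
            ext; simp
          rw [this]
          exact Finset.card_image_le
        have h4 : ((Finset.univ.filter fun v : Fin n => ∃ j, g j = v).card : ℝ) * n ≤
            Fintype.card ι * n := by gcongr
        simp only [Finset.sum_const, Finset.card_univ, Fintype.card_fin, nsmul_eq_mul, mul_one]
        linarith
    _ = _ := by
        rw [Finset.prod_const, Finset.card_univ, mul_pow]

theorem templateProb_nonneg {A B : ℝ} (hA : 0 ≤ A) (hB : 0 ≤ B) (T : Finset (Sym2 ι)) :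
    0 ≤ templateProb A B T :=
  mul_nonneg (by positivity) (Finset.sum_nonneg fun y _ => Finset.prod_nonneg fun e _ =>
    edgeWeight_nonneg hA hB y e)

/-- Pairs of placements are of three kinds. Those related by `R` have the same image and cost one
probability p; disjoint ones cost p^2; the remaining ones cost c n^t, where t is the overlap. The
terms p^2, extended to all pairs, cancel exactly against the squared mean. -/
theorem variance_copies_le {A B : ℝ} (hA : 0 ≤ A) (hB : 0 ≤ B) (T : Finset (Sym2 ι))
    (hT : ∀ e ∈ T, ¬ e.IsDiag)
    (R : (ι ↪ Fin n) → (ι ↪ Fin n) → Prop) [∀ g h, Decidable (R g h)] {L : ℕ} {c : ℝ} (hc : 0 ≤ c)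
    (hL : ∀ g, (Finset.univ.filter fun h => R g h).card ≤ L)
    (hR : ∀ g h, R g h → T.image (Sym2.map g) = T.image (Sym2.map h))
    (hR' : ∀ g h, ¬ R g h → overlap g h ≠ 0 →
      edgeProb n A B (T.image (Sym2.map g) ∪ T.image (Sym2.map h)) ≤ c * (n : ℝ) ^ overlap g h) :
    graphExp n A B (fun G => ((copies T G : ℝ) - n.descFactorial (Fintype.card ι) *
        templateProb A B T) ^ 2) ≤
      L * ((n : ℝ) ^ Fintype.card ι * templateProb A B T) +
        c * ((n : ℝ) ^ (2 * Fintype.card ι) * (Fintype.card ι + 1 : ℝ) ^ Fintype.card ι) := by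
  set p := templateProb A B T with hp
  have hp0 : 0 ≤ p := templateProb_nonneg hA hB T
  set M : ℝ := ((n.descFactorial (Fintype.card ι) : ℕ) : ℝ) with hM
  have hM' : M ≤ (n : ℝ) ^ Fintype.card ι := by
    rw [hM]; exact_mod_cast Nat.descFactorial_le_pow n _
  have hcard : ((Finset.univ : Finset (ι ↪ Fin n)).card : ℝ) = M := by
    rw [Finset.card_univ, Fintype.card_embedding_eq, Fintype.card_fin]
  have hvar : graphExp n A B (fun G => ((copies T G : ℝ) - M * p) ^ 2) =
      graphExp n A B (fun G => (copies T G : ℝ) ^ 2) - (M * p) ^ 2 := by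
    have h1 : ∀ G : SimpleGraph (Fin n), ((copies T G : ℝ) - M * p) ^ 2 =
        (copies T G : ℝ) ^ 2 + ((-2 * (M * p)) * (copies T G : ℝ) + (M * p) ^ 2 * 1) := by
      intro G; ring
    simp only [h1]
    rw [graphExp_add, graphExp_add, graphExp_const_mul, graphExp_const_mul, graphExp_one,
      graphExp_copies A B T hT]
    ring
  have hpt : ∀ g h : ι ↪ Fin n,
      edgeProb n A B (T.image (Sym2.map g) ∪ T.image (Sym2.map h)) ≤
        p ^ 2 + (if R g h then p else 0) + c * (n : ℝ) ^ overlap g h := by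
    intro g h
    have h0 : 0 ≤ c * (n : ℝ) ^ overlap g h := by positivity
    by_cases hr : R g h
    · rw [if_pos hr, ← hR g h hr, Finset.union_self, edgeProb_image A B T hT g.injective]
      nlinarith
    · rw [if_neg hr, add_zero]
      by_cases ho : overlap g h = 0
      · rw [edgeProb_image_union A B T hT g.injective h.injective]
        · linarith
        · intro i j hij
          rw [overlap, Finset.card_eq_zero, Finset.filter_eq_empty_iff] at ho
          exact ho (Finset.mem_univ j) ⟨i, hij⟩
      · nlinarith [hR' g h hr ho]
  rw [hvar, graphExp_copies_sq]
  have h1 : ∀ g : ι ↪ Fin n, ∑ h : ι ↪ Fin n,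
      edgeProb n A B (T.image (Sym2.map g) ∪ T.image (Sym2.map h)) ≤
        M * p ^ 2 + L * p + c * ((n : ℝ) ^ Fintype.card ι *
          (Fintype.card ι + 1 : ℝ) ^ Fintype.card ι) := by
    intro g
    refine (Finset.sum_le_sum fun h _ => hpt g h).trans ?_
    rw [Finset.sum_add_distrib, Finset.sum_add_distrib, Finset.sum_const, nsmul_eq_mul, hcard,
      ← Finset.sum_filter, Finset.sum_const, nsmul_eq_mul, ← Finset.mul_sum]
    gcongr
    · exact hL g
    · exact sum_pow_overlap_le g
  have h2 := Finset.sum_le_sum fun (g : ι ↪ Fin n) (_ : g ∈ Finset.univ) => h1 g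
  rw [Finset.sum_const, nsmul_eq_mul, hcard] at h2
  have h3 : M * (L * p + c * ((n : ℝ) ^ Fintype.card ι *
      (Fintype.card ι + 1 : ℝ) ^ Fintype.card ι)) ≤
      (n : ℝ) ^ Fintype.card ι * (L * p + c * ((n : ℝ) ^ Fintype.card ι *
      (Fintype.card ι + 1 : ℝ) ^ Fintype.card ι)) := by
    gcongr
  have h4 : (n : ℝ) ^ (2 * Fintype.card ι) =
      (n : ℝ) ^ Fintype.card ι * (n : ℝ) ^ Fintype.card ι := by rw [two_mul, pow_add]
  rw [h4]
  nlinarith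

end copies

/-! ### Cycles -/

/-- The edges of the cycle on `Fin m`. -/
def cycleEdges (m : ℕ) [NeZero m] : Finset (Sym2 (Fin m)) :=
  Finset.univ.image fun i => s(i, i + 1)

/-- The number of closed label sequences, weighted by their probabilities, in closed form. -/
noncomputable def pathWeight (A B : ℝ) (k : ℕ) (s t : Fin 2) : ℝ :=
  if s = t then ((A + B) ^ k + (A - B) ^ k) / 2 else ((A + B) ^ k - (A - B) ^ k) / 2

/-- `pathWeight A B k` is the k-th power of the matrix with A on and B off the diagonal, written
through its eigenvalues A+B and A-B. -/
theorem sum_pathWeight_mul (A B : ℝ) (k : ℕ) (s t : Fin 2) :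
    ∑ u, pathWeight A B k s u * (if u = t then A else B) = pathWeight A B (k + 1) s t := by
  fin_cases s <;> fin_cases t <;> simp [pathWeight, Fin.sum_univ_two] <;> ring

/-- Transfer matrix method. The arbitrary weight h of the two ends lets the induction absorb the
last step of the path, and later takes in the edge that closes the cycle. -/
theorem sum_prod_path (A B : ℝ) (k : ℕ) (h : Fin 2 → Fin 2 → ℝ) :
    ∑ y : Fin (k + 1) → Fin 2, (∏ i : Fin k, if y i.castSucc = y i.succ then A else B) *
      h (y 0) (y (Fin.last k)) = ∑ s, ∑ t, pathWeight A B k s t * h s t := by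
  induction k generalizing h with
  | zero =>
    rw [← (Equiv.funUnique (Fin 1) (Fin 2)).symm.sum_comp]
    simp [pathWeight, Fin.sum_univ_two]
  | succ k ih =>
    rw [← (Fin.snocEquiv fun _ : Fin (k + 2) => Fin 2).sum_comp, Fintype.sum_prod_type,
      Finset.sum_comm]
    have h1 : ∀ (y : Fin (k + 1) → Fin 2) (t : Fin 2),
        (∏ i : Fin (k + 1), if Fin.snocEquiv (fun _ : Fin (k + 2) => Fin 2) (t, y) i.castSucc =
          Fin.snocEquiv (fun _ : Fin (k + 2) => Fin 2) (t, y) i.succ then A else B) *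
          h (Fin.snocEquiv (fun _ : Fin (k + 2) => Fin 2) (t, y) 0)
            (Fin.snocEquiv (fun _ : Fin (k + 2) => Fin 2) (t, y) (Fin.last (k + 1))) =
        (∏ i : Fin k, if y i.castSucc = y i.succ then A else B) *
          ((if y (Fin.last k) = t then A else B) * h (y 0) t) := by
      intro y t
      rw [Fin.prod_univ_castSucc]
      have e0 : ∀ i : Fin (k + 1), Fin.snocEquiv (fun _ : Fin (k + 2) => Fin 2) (t, y) i.castSucc =
          y i := fun i => by simp [Fin.snocEquiv]
      have e1 : Fin.snocEquiv (fun _ : Fin (k + 2) => Fin 2) (t, y) (Fin.last (k + 1)) = t := by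
        simp [Fin.snocEquiv]
      have e2 : Fin.snocEquiv (fun _ : Fin (k + 2) => Fin 2) (t, y) 0 = y 0 := e0 0
      simp only [← Fin.castSucc_succ, Fin.succ_last, e0, e1, e2, mul_assoc]
    simp only [h1, ← Finset.mul_sum]
    rw [ih fun s u => ∑ t, (if u = t then A else B) * h s t]
    refine Finset.sum_congr rfl fun s _ => ?_
    simp only [← sum_pathWeight_mul, Finset.mul_sum, Finset.sum_mul]
    rw [Finset.sum_comm]
    exact Finset.sum_congr rfl fun t _ => Finset.sum_congr rfl fun u _ => by ring

/-! ### Placed cycles: probability, overlaps and symmetries -/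

section cycleEdges

variable {m : ℕ} [NeZero m]

theorem fin_one_ne_zero (hm : 2 ≤ m) : (1 : Fin m) ≠ 0 := by
  obtain ⟨k, rfl⟩ := Nat.exists_eq_add_of_le' hm
  simp

theorem fin_one_add_one_ne_zero (hm : 3 ≤ m) : (1 + 1 : Fin m) ≠ 0 := by
  obtain ⟨k, rfl⟩ := Nat.exists_eq_add_of_le' hm
  rw [Ne, Fin.ext_iff]
  simp [Fin.val_add, Nat.mod_eq_of_lt (show 2 < k + 3 by omega)]

theorem cycleEdge_injective (hm : 3 ≤ m) :
    Function.Injective fun i : Fin m => s(i, i + 1) := by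
  intro i j h
  rcases Sym2.eq_iff.1 h with ⟨h1, -⟩ | ⟨h1, h2⟩
  · exact h1
  · exfalso
    rw [h1, add_assoc] at h2
    exact fin_one_add_one_ne_zero hm (by simpa using h2)

theorem card_cycleEdges (hm : 3 ≤ m) : (cycleEdges m).card = m := by
  rw [cycleEdges, Finset.card_image_of_injective _ (cycleEdge_injective hm)]
  simp

theorem not_isDiag_of_mem_cycleEdges (hm : 2 ≤ m) {e : Sym2 (Fin m)} (he : e ∈ cycleEdges m) :
    ¬ e.IsDiag := by
  obtain ⟨i, -, rfl⟩ := Finset.mem_image.1 he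
  simpa using fin_one_ne_zero hm

/-- This is the trace of the m-th power of the label matrix, divided by 2^m: a path with m-1 edges
whose ends are tied by one more edge. -/
theorem templateProb_cycleEdges (hm : 3 ≤ m) (A B : ℝ) :
    templateProb A B (cycleEdges m) = ((A + B) / 2) ^ m + ((A - B) / 2) ^ m := by
  rw [templateProb, cycleEdges]
  simp only [Finset.prod_image (cycleEdge_injective hm).injOn, edgeWeight_mk, Fintype.card_fin]
  obtain ⟨k, rfl⟩ := Nat.exists_eq_succ_of_ne_zero (NeZero.ne m)
  have h := sum_prod_path A B k fun s t => if t = s then A else B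
  have h1 : ∀ y : Fin (k + 1) → Fin 2, (∏ i : Fin (k + 1), if y i = y (i + 1) then A else B) =
      (∏ i : Fin k, if y i.castSucc = y i.succ then A else B) *
        (if y (Fin.last k) = y 0 then A else B) := by
    intro y
    rw [Fin.prod_univ_castSucc]
    simp
  simp only [Nat.succ_eq_add_one, h1]
  rw [h]
  simp only [pathWeight, Fin.sum_univ_two, div_pow]
  simp
  ring

variable {n : ℕ}

/-- The edges of the cycle that visits the vertices `g 0, …, g (m - 1)`. -/
def cycleImage (g : Fin m → Fin n) : Finset (Sym2 (Fin n)) := (cycleEdges m).image (Sym2.map g)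

theorem mem_cycleImage {g : Fin m → Fin n} {e : Sym2 (Fin n)} :
    e ∈ cycleImage g ↔ ∃ i, s(g i, g (i + 1)) = e := by
  simp [cycleImage, cycleEdges]

theorem card_cycleImage (hm : 3 ≤ m) {g : Fin m → Fin n} (hg : Function.Injective g) :
    (cycleImage g).card = m := by
  rw [cycleImage, Finset.card_image_of_injective _ (Sym2.map.injective hg), card_cycleEdges hm]

theorem exists_mem_cycleImage_iff {g : Fin m → Fin n} {v : Fin n} :
    (∃ u, s(v, u) ∈ cycleImage g) ↔ ∃ i, g i = v := by
  constructor
  · rintro ⟨u, hu⟩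
    obtain ⟨i, hi⟩ := mem_cycleImage.1 hu
    rcases Sym2.eq_iff.1 hi with ⟨h, -⟩ | ⟨-, h⟩
    · exact ⟨_, h⟩
    · exact ⟨_, h⟩
  · rintro ⟨i, rfl⟩
    exact ⟨_, mem_cycleImage.2 ⟨i, rfl⟩⟩

theorem eq_univ_of_add_one_mem {J : Finset (Fin m)} (hne : J.Nonempty)
    (h : ∀ i ∈ J, i + 1 ∈ J) : J = Finset.univ := by
  obtain ⟨i, hi⟩ := hne
  have h1 : ∀ k : ℕ, i + (Fin.ofNat m k) ∈ J := by
    intro k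
    induction k with
    | zero => simpa using hi
    | succ k ih =>
      have := h _ ih
      convert this using 1
      rw [add_assoc]
      congr 1
      ext
      simp [Fin.val_add]
  ext j
  simp only [Finset.mem_univ, iff_true]
  have := h1 (j - i).val
  simpa using this

/-- Different cycles that meet share fewer edges than vertices. Following h, every common edge
starts at a common vertex. If there is a common edge, some common edge is followed by one that is
not common, and its far end is an additional common vertex. This surplus vertex is the source of the
factor 1/n in the variance. -/
theorem card_cycleImage_union (hm : 3 ≤ m) {g h : Fin m → Fin n} (hg : Function.Injective g)
    (hh : Function.Injective h) (hne : cycleImage g ≠ cycleImage h) (ho : overlap g h ≠ 0) :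
    2 * m + 1 ≤ (cycleImage g ∪ cycleImage h).card + overlap g h := by
  have h1 := Finset.card_union_add_card_inter (cycleImage g) (cycleImage h)
  rw [card_cycleImage hm hg, card_cycleImage hm hh] at h1
  set J : Finset (Fin m) := Finset.univ.filter fun i => s(h i, h (i + 1)) ∈ cycleImage g with hJ
  have hJcard : (cycleImage g ∩ cycleImage h).card = J.card := by
    have : cycleImage g ∩ cycleImage h = J.image fun i => s(h i, h (i + 1)) := by
      ext e
      simp only [Finset.mem_inter, mem_cycleImage (g := h), Finset.mem_image, hJ,
        Finset.mem_filter, Finset.mem_univ, true_and]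
      constructor
      · rintro ⟨h2, i, rfl⟩
        exact ⟨i, h2, rfl⟩
      · rintro ⟨i, h2, rfl⟩
        exact ⟨h2, i, rfl⟩
    rw [this]
    apply Finset.card_image_of_injective
    intro i j hij
    apply cycleEdge_injective hm
    exact Sym2.map.injective hh (by simpa using hij)
  have hsub : ∀ i ∈ J, (∃ j, g j = h i) ∧ ∃ j, g j = h (i + 1) := by
    intro i hi
    have hi' := (Finset.mem_filter.1 hi).2
    exact ⟨exists_mem_cycleImage_iff.1 ⟨_, hi'⟩,
      exists_mem_cycleImage_iff.1 ⟨_, by rwa [Sym2.eq_swap]⟩⟩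
  suffices J.card + 1 ≤ overlap g h by omega
  rcases J.eq_empty_or_nonempty with hJe | hJne
  · rw [hJe, Finset.card_empty]
    omega
  -- If all edges of h were edges of g, the equal cardinalities would make the two cycles coincide.
  · have hJu : J ≠ Finset.univ := by
      intro hu
      apply hne
      symm
      apply Finset.eq_of_subset_of_card_le
      · intro e he
        obtain ⟨i, rfl⟩ := mem_cycleImage.1 he
        have : i ∈ J := hu ▸ Finset.mem_univ i
        exact (Finset.mem_filter.1 this).2
      · rw [card_cycleImage hm hg, card_cycleImage hm hh]
    have : ∃ i ∈ J, i + 1 ∉ J := by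
      by_contra hcon
      push Not at hcon
      exact hJu (eq_univ_of_add_one_mem hJne hcon)
    obtain ⟨i, hi, hi'⟩ := this
    rw [← Finset.card_insert_of_notMem hi']
    refine card_le_overlap fun j hj => ?_
    rcases Finset.mem_insert.1 hj with rfl | hj
    · exact (hsub i hi).2
    · exact (hsub j hj).1

/-- An injective self-map of the cycle that preserves adjacency is a rotation or a reflection. -/
theorem eq_add_or_eq_sub (hm : 3 ≤ m) {σ : Fin m → Fin m} (hσ : Function.Injective σ)
    (h : ∀ i, σ (i + 1) = σ i + 1 ∨ σ (i + 1) = σ i - 1) :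
    (∀ i, σ i = σ 0 + i) ∨ ∀ i, σ i = σ 0 - i := by
  have hne : ∀ i : Fin m, σ (i + 1 + 1) ≠ σ i := by
    intro i hi
    have := hσ hi
    rw [add_assoc] at this
    exact fin_one_add_one_ne_zero hm (by simpa using this)
  have hfin : ∀ k : ℕ, (Fin.ofNat m (k + 1)) = Fin.ofNat m k + 1 := by
    intro k
    ext
    simp [Fin.val_add]
  rcases h 0 with h0 | h0
  · left
    -- The direction of the step is carried along in the induction: a reversal would give σ(i+2) =
    -- σ(i), against injectivity since 2 ≠ 0 modulo m.
    have : ∀ k : ℕ, σ (Fin.ofNat m k) = σ 0 + Fin.ofNat m k ∧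
        σ (Fin.ofNat m k + 1) = σ (Fin.ofNat m k) + 1 := by
      intro k
      induction k with
      | zero => simpa using h0
      | succ k ih =>
        rw [hfin, ih.2, ih.1, add_assoc]
        refine ⟨rfl, ?_⟩
        rcases h (Fin.ofNat m k + 1) with h1 | h1
        · rw [h1, ih.2, ih.1, add_assoc (σ 0)]
        · exact absurd (by rw [h1, ih.2]; simp) (hne (Fin.ofNat m k))
    intro i
    simpa using (this i.val).1
  · right
    have : ∀ k : ℕ, σ (Fin.ofNat m k) = σ 0 - Fin.ofNat m k ∧
        σ (Fin.ofNat m k + 1) = σ (Fin.ofNat m k) - 1 := by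
      intro k
      induction k with
      | zero => simpa using h0
      | succ k ih =>
        rw [hfin, ih.2, ih.1, sub_sub]
        refine ⟨rfl, ?_⟩
        rcases h (Fin.ofNat m k + 1) with h1 | h1
        · exact absurd (by rw [h1, ih.2]; simp) (hne (Fin.ofNat m k))
        · rw [h1, ih.2, ih.1, sub_sub (σ 0)]
    intro i
    simpa using (this i.val).1

/-- The placements of one cycle form a free orbit of the dihedral group. The value at 0 determines
c, and the value at 1 tells c + i from c - i because 2 ≠ 0 modulo m. -/
theorem card_cycleImage_eq (hm : 3 ≤ m) (g : Fin m ↪ Fin n) :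
    (Finset.univ.filter fun h : Fin m ↪ Fin n => cycleImage g = cycleImage h).card = 2 * m := by
  let φ : Fin m × Bool → (Fin m ↪ Fin n) := fun z =>
    if z.2 then (Equiv.addLeft z.1).toEmbedding.trans g
    else (Equiv.subLeft z.1).toEmbedding.trans g
  have φt : ∀ c i, φ (c, true) i = g (c + i) := fun c i => by simp [φ]
  have φf : ∀ c i, φ (c, false) i = g (c - i) := fun c i => by simp [φ]
  have hφ : Function.Injective φ := by
    rintro ⟨c, ε⟩ ⟨c', ε'⟩ h
    have hc : c = c' := by
      have := DFunLike.congr_fun h 0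
      cases ε <;> cases ε' <;> simpa [φt, φf] using this
    subst hc
    have h1 := DFunLike.congr_fun h 1
    cases ε <;> cases ε'
    · rfl
    · exfalso
      rw [φt, φf] at h1
      have h2 := g.injective h1
      rw [sub_eq_iff_eq_add, add_assoc] at h2
      exact fin_one_add_one_ne_zero hm (by simpa using h2)
    · exfalso
      rw [φt, φf] at h1
      have h2 := g.injective h1.symm
      rw [sub_eq_iff_eq_add, add_assoc] at h2
      exact fin_one_add_one_ne_zero hm (by simpa using h2)
    · rfl
  have himage : (Finset.univ.filter fun h : Fin m ↪ Fin n => cycleImage g = cycleImage h) =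
      Finset.univ.image φ := by
    ext h
    simp only [Finset.mem_filter, Finset.mem_univ, true_and, Finset.mem_image, Prod.exists]
    constructor
    · intro heq
      have hex : ∀ i, ∃ j, g j = h i := by
        intro i
        rw [← exists_mem_cycleImage_iff, heq, exists_mem_cycleImage_iff]
        exact ⟨i, rfl⟩
      choose σ hσ using hex
      have hσinj : Function.Injective σ := by
        intro i j hij
        apply h.injective
        rw [← hσ, ← hσ, hij]
      have hstep : ∀ i, σ (i + 1) = σ i + 1 ∨ σ (i + 1) = σ i - 1 := by
        intro i
        have : s(h i, h (i + 1)) ∈ cycleImage g := heq ▸ mem_cycleImage.2 ⟨i, rfl⟩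
        obtain ⟨j, hj⟩ := mem_cycleImage.1 this
        rw [← hσ, ← hσ] at hj
        rcases Sym2.eq_iff.1 hj with ⟨h1, h2⟩ | ⟨h1, h2⟩
        · left
          rw [← g.injective h1, ← g.injective h2]
        · right
          rw [← g.injective h1, ← g.injective h2]
          simp
      rcases eq_add_or_eq_sub hm hσinj hstep with h1 | h1
      · exact ⟨σ 0, true, by ext i; rw [φt, ← h1, hσ]⟩
      · exact ⟨σ 0, false, by ext i; rw [φf, ← h1, hσ]⟩
    · rintro ⟨c, ε, rfl⟩
      ext e
      rw [mem_cycleImage, mem_cycleImage]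
      cases ε
      · simp only [φf]
        constructor
        · rintro ⟨i, rfl⟩
          refine ⟨c - i - 1, ?_⟩
          rw [show c - (c - i - 1) = i + 1 by abel, show c - (c - i - 1 + 1) = i by abel,
            Sym2.eq_swap]
        · rintro ⟨i, rfl⟩
          refine ⟨c - i - 1, ?_⟩
          rw [show c - i - 1 + 1 = c - i by abel, sub_sub, Sym2.eq_swap]
      · simp only [φt]
        constructor
        · rintro ⟨i, rfl⟩
          refine ⟨i - c, ?_⟩
          rw [show c + (i - c) = i by abel, show c + (i - c + 1) = i + 1 by abel]
        · rintro ⟨i, rfl⟩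
          exact ⟨c + i, by rw [add_assoc]⟩
  rw [himage, Finset.card_image_of_injective _ hφ]
  simp [mul_comm]

-- The fibres of the map from labelled copies to subgraphs have 2m elements by `card_cycleImage_eq`.
-- Thus the radicand involves the labelled count directly, which is what the moments and the search
-- compute.
open Classical in
theorem two_mul_mul_copyCount (hm : 3 ≤ m) (G : SimpleGraph (Fin n)) :
    2 * m * G.copyCount (SimpleGraph.cycleGraph m) = copies (cycleEdges m) G := by
  have hadj : ∀ i j : Fin m, (SimpleGraph.cycleGraph m).Adj i j ↔ s(i, j) ∈ cycleEdges m := by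
    intro i j
    obtain ⟨k, rfl⟩ := Nat.exists_eq_add_of_le' hm
    rw [SimpleGraph.cycleGraph_adj]
    simp only [cycleEdges, Finset.mem_image, Finset.mem_univ, true_and, Sym2.eq_iff]
    constructor
    · rintro (h | h)
      · exact ⟨j, Or.inr ⟨rfl, by rw [← h]; abel⟩⟩
      · exact ⟨i, Or.inl ⟨rfl, by rw [← h]; abel⟩⟩
    · rintro ⟨l, ⟨rfl, rfl⟩ | ⟨rfl, rfl⟩⟩
      · right; abel
      · left; abel
  have hedge : ∀ f : (SimpleGraph.cycleGraph m).Copy G, ∀ u v,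
      f.toSubgraph.Adj u v ↔ s(u, v) ∈ cycleImage f := by
    intro f u v
    simp only [SimpleGraph.Subgraph.map_adj, Relation.Map, SimpleGraph.Subgraph.top_adj, hadj,
      cycleImage, Finset.mem_image]
    constructor
    · rintro ⟨i, j, hij, rfl, rfl⟩
      exact ⟨_, hij, rfl⟩
    · rintro ⟨e, he, huv⟩
      induction e with | _ i j =>
      rcases Sym2.eq_iff.1 huv with ⟨rfl, rfl⟩ | ⟨rfl, rfl⟩
      · exact ⟨i, j, he, rfl, rfl⟩
      · exact ⟨j, i, Sym2.eq_swap ▸ he, rfl, rfl⟩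
  have hsub : ∀ f f' : (SimpleGraph.cycleGraph m).Copy G,
      f.toSubgraph = f'.toSubgraph ↔ cycleImage f = cycleImage f' := by
    intro f f'
    constructor
    · intro h
      ext e
      induction e with | _ u v =>
      rw [← hedge, ← hedge, h]
    · intro h
      -- Equal edge sets force equal vertex sets, since each vertex of a cycle lies on one of its
      -- edges.
      refine SimpleGraph.Subgraph.ext ?_ ?_
      · ext v
        have : ∀ f : (SimpleGraph.cycleGraph m).Copy G,
            v ∈ f.toSubgraph.verts ↔ ∃ i, f i = v := by
          intro f
          simp
        rw [this, this, ← exists_mem_cycleImage_iff, ← exists_mem_cycleImage_iff, h]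
      · ext u v
        rw [hedge, hedge, h]
  let e : (SimpleGraph.cycleGraph m).Copy G ≃
      {g : Fin m ↪ Fin n // ∀ e ∈ cycleEdges m, Sym2.map g e ∈ G.edgeSet} :=
    { toFun := fun f => ⟨⟨f, f.injective⟩, by
        intro e he
        induction e with | _ i j =>
        exact f.toHom.map_adj ((hadj i j).2 he)⟩
      invFun := fun g => ⟨⟨g.1, fun {i j} hij => g.2 _ ((hadj i j).1 hij)⟩, g.1.injective⟩
      left_inv := fun f => rfl
      right_inv := fun g => rfl }
  have hfib : ∀ S ∈ (Finset.univ : Finset ((SimpleGraph.cycleGraph m).Copy G)).image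
      SimpleGraph.Copy.toSubgraph,
      (Finset.univ.filter fun f : (SimpleGraph.cycleGraph m).Copy G => f.toSubgraph = S).card =
        2 * m := by
    intro S hS
    obtain ⟨f, -, rfl⟩ := Finset.mem_image.1 hS
    rw [← card_cycleImage_eq hm (e f).1]
    refine Finset.card_bij (fun f' _ => (e f').1) ?_ ?_ ?_
    · intro f' hf'
      have h := (hsub f' f).1 (Finset.mem_filter.1 hf').2
      exact Finset.mem_filter.2 ⟨Finset.mem_univ _, h.symm⟩
    · intro f₁ _ f₂ _ h
      exact e.injective (Subtype.ext h)
    · intro g hg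
      have hg' : cycleImage f = cycleImage g := (Finset.mem_filter.1 hg).2
      have hmem : ∀ e ∈ cycleEdges m, Sym2.map g e ∈ G.edgeSet := by
        intro e' he'
        have : Sym2.map g e' ∈ cycleImage f := by
          rw [hg']; exact Finset.mem_image_of_mem _ he'
        obtain ⟨e'', he'', h⟩ := Finset.mem_image.1 this
        rw [← h]
        exact (e f).2 e'' he''
      refine ⟨e.symm ⟨g, hmem⟩, Finset.mem_filter.2 ⟨Finset.mem_univ _, ?_⟩, ?_⟩
      · exact (hsub _ _).2 hg'.symm
      · simp
  rw [SimpleGraph.copyCount_eq_card_image_copyToSubgraph, copies, ← Fintype.card_subtype,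
    ← Fintype.card_congr e, ← Finset.card_univ]
  rw [Finset.card_eq_sum_card_image SimpleGraph.Copy.toSubgraph, Finset.sum_congr rfl hfib,
    Finset.sum_const, smul_eq_mul, mul_comm]

end cycleEdges

/-! ### Moments of the number of cycles and of the number of edges -/

theorem variance_cycle_le {m n : ℕ} [NeZero m] (hm : 3 ≤ m) {a b : ℝ} (hb : 0 ≤ b) (hba : b ≤ a)
    (ha : 1 ≤ a) (hn : a ≤ n) :
    graphExp n (a / n) (b / n) (fun G => ((copies (cycleEdges m) G : ℝ) - n.descFactorial m *
        templateProb (a / n) (b / n) (cycleEdges m)) ^ 2) ≤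
      2 * m * ((n : ℝ) ^ m * templateProb (a / n) (b / n) (cycleEdges m)) +
        a ^ (2 * m) * (m + 1) ^ m / n := by
  classical
  have hn0 : (0 : ℝ) < n := by linarith
  have hAn : 0 ≤ a / n := by positivity
  have hBn : 0 ≤ b / n := by positivity
  have h := variance_copies_le (n := n) (A := a / n) (B := b / n) hAn hBn (cycleEdges m)
    (fun e he => not_isDiag_of_mem_cycleEdges (by omega) he)
    -- An overlap t ≥ 1 between different cycles gives probability at most (a/n)^(2m+1-t), and
    -- a^(2m+1-t) ≤ a^(2m) because a ≥ 1. This is c n^t.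
    (fun g h => cycleImage g = cycleImage h) (L := 2 * m) (c := a ^ (2 * m) / n ^ (2 * m + 1))
    (by positivity) (fun g => ?_) (fun g h hgh => hgh) (fun g h hgh ho => ?_)
  · simp only [Fintype.card_fin] at h
    refine h.trans (le_of_eq ?_)
    push_cast
    rw [pow_succ (n : ℝ) (2 * m)]
    field_simp
  · exact (card_cycleImage_eq hm g).le
  · have h1 := card_cycleImage_union hm g.injective h.injective hgh ho
    have h2 : overlap g h ≤ m := by simpa using overlap_le g h
    have h3 : edgeProb n (a / n) (b / n) (cycleImage g ∪ cycleImage h) ≤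
        (a / n) ^ (2 * m + 1 - overlap g h) := by
      refine edgeProb_le hBn (by gcongr) (by rw [div_le_one hn0]; exact hn) _ ?_ (by omega)
      intro e he
      rcases Finset.mem_union.1 he with he | he <;> obtain ⟨e, he', rfl⟩ := Finset.mem_image.1 he
      · exact not_isDiag_map g.injective (not_isDiag_of_mem_cycleEdges (by omega) he')
      · exact not_isDiag_map h.injective (not_isDiag_of_mem_cycleEdges (by omega) he')
    refine h3.trans ?_
    obtain ⟨j, hj⟩ : ∃ j, 2 * m + 1 = j + overlap g h := ⟨2 * m + 1 - overlap g h, by omega⟩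
    rw [show 2 * m + 1 - overlap g h = j by omega, hj, pow_add, div_pow]
    rw [div_mul_eq_mul_div, mul_div_mul_right _ _ (by positivity)]
    gcongr
    omega

/-- The edge set of the complete graph on `Fin 2`. -/
def singleEdge : Finset (Sym2 (Fin 2)) := {s(0, 1)}

theorem not_isDiag_of_mem_singleEdge {e : Sym2 (Fin 2)} (he : e ∈ singleEdge) : ¬ e.IsDiag := by
  rw [singleEdge, Finset.mem_singleton] at he
  subst he
  simp

theorem templateProb_singleEdge (A B : ℝ) : templateProb A B singleEdge = (A + B) / 2 := by
  rw [templateProb, singleEdge, ← (finTwoArrowEquiv (Fin 2)).symm.sum_comp, Fintype.sum_prod_type]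
  simp [finTwoArrowEquiv, Fin.sum_univ_two]
  ring

open Classical in
theorem two_mul_ncard_edgeSet {n : ℕ} (G : SimpleGraph (Fin n)) :
    2 * G.edgeSet.ncard = (Finset.univ.filter fun z : Fin n × Fin n => G.Adj z.1 z.2).card := by
  rw [Set.ncard_eq_toFinset_card', ← SimpleGraph.edgeFinset]
  have h := G.dart_card_eq_twice_card_edges
  rw [← h, ← Finset.card_univ]
  refine Finset.card_bij (fun d _ => d.toProd) ?_ ?_ ?_
  · intro d _
    simp
  · intro d _ d' _ h
    exact SimpleGraph.Dart.ext _ _ h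
  · intro z hz
    exact ⟨⟨z, (Finset.mem_filter.1 hz).2⟩, Finset.mem_univ _, rfl⟩

theorem copies_singleEdge {n : ℕ} (G : SimpleGraph (Fin n)) :
    copies singleEdge G = 2 * G.edgeSet.ncard := by
  classical
  rw [two_mul_ncard_edgeSet, copies]
  refine Finset.card_bij (fun g _ => (g 0, g 1)) ?_ ?_ ?_
  · intro g hg
    simpa [singleEdge] using hg
  · intro g _ g' _ h
    ext i
    fin_cases i
    · exact congrArg Fin.val (congrArg Prod.fst h)
    · exact congrArg Fin.val (congrArg Prod.snd h)
  · rintro ⟨u, v⟩ hz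
    have hadj : G.Adj u v := (Finset.mem_filter.1 hz).2
    refine ⟨⟨![u, v], ?_⟩, ?_, rfl⟩
    · intro i j hij
      fin_cases i <;> fin_cases j <;> simp_all [hadj.ne, hadj.ne']
    · refine Finset.mem_filter.2 ⟨Finset.mem_univ _, fun e he => ?_⟩
      rw [singleEdge, Finset.mem_singleton] at he
      subst he
      exact hadj

theorem variance_edge_le {n : ℕ} {a b : ℝ} (hb : 0 ≤ b) (hba : b ≤ a)
    (ha : 1 ≤ a) (hn : a ≤ n) :
    graphExp n (a / n) (b / n) (fun G => (2 * (G.edgeSet.ncard : ℝ) - (n - 1) * ((a + b) / 2)) ^ 2)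
      ≤ 9 * a ^ 3 * n := by
  classical
  have hn0 : (0 : ℝ) < n := by linarith
  have hAn : 0 ≤ a / n := by positivity
  have hBn : 0 ≤ b / n := by positivity
  have h := variance_copies_le (n := n) (A := a / n) (B := b / n) hAn hBn singleEdge
    (fun e he => not_isDiag_of_mem_singleEdge he)
    -- No pair needs separate treatment here: placements of an edge with overlap t ∈ {1, 2} span at
    -- least 3 - t edges, even when they coincide.
    (fun g h => False) (L := 0) (c := a ^ 3 / n ^ 3)
    (by positivity) (fun g => by simp) (fun g h hgh => hgh.elim) (fun g h _ ho => ?_)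
  · simp only [Fintype.card_fin, templateProb_singleEdge, copies_singleEdge] at h
    have hd : ((n.descFactorial 2 : ℕ) : ℝ) = n * (n - 1) := by
      have : 1 ≤ n := by exact_mod_cast ha.trans hn
      simp [Nat.descFactorial, Nat.cast_sub this]
      ring
    have he : ∀ G : SimpleGraph (Fin n), ((2 * G.edgeSet.ncard : ℕ) : ℝ) -
        ((n.descFactorial 2 : ℕ) : ℝ) * ((a / n + b / n) / 2) =
          2 * (G.edgeSet.ncard : ℝ) - (n - 1) * ((a + b) / 2) := by
      intro G
      rw [hd]
      push_cast
      field_simp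
    simp only [he] at h
    refine h.trans (le_of_eq ?_)
    push_cast
    field_simp
    norm_num
  · have himage : ∀ g : Fin 2 → Fin n, singleEdge.image (Sym2.map g) = {s(g 0, g 1)} := by
      intro g; simp [singleEdge]
    have h2 : overlap g h ≤ 2 := by simpa using overlap_le g h
    have hj : 3 - overlap g h ≤
        (singleEdge.image (Sym2.map g) ∪ singleEdge.image (Sym2.map h)).card := by
      rw [himage, himage]
      by_cases heq : s(g 0, g 1) = s(h 0, h 1)
      · have : (Finset.univ : Finset (Fin 2)).card ≤ overlap g h := by
          refine card_le_overlap fun i _ => ?_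
          rcases Sym2.eq_iff.1 heq with ⟨h3, h4⟩ | ⟨h3, h4⟩
          · exact ⟨i, by fin_cases i <;> assumption⟩
          · fin_cases i
            · exact ⟨1, h4⟩
            · exact ⟨0, h3⟩
        rw [heq]
        simp at this ⊢
        omega
      · have : ({s(g 0, g 1)} ∪ {s(h 0, h 1)} : Finset (Sym2 (Fin n))).card = 2 := by
          rw [← Finset.insert_eq, Finset.card_pair heq]
        omega
    have h3 := edgeProb_le (n := n) (A := a / n) (B := b / n) hBn (by gcongr)
      (by rw [div_le_one hn0]; exact hn)
      (singleEdge.image (Sym2.map g) ∪ singleEdge.image (Sym2.map h)) (by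
        intro e he
        rcases Finset.mem_union.1 he with he | he <;> obtain ⟨e, he', rfl⟩ := Finset.mem_image.1 he
        · exact not_isDiag_map g.injective (not_isDiag_of_mem_singleEdge he')
        · exact not_isDiag_map h.injective (not_isDiag_of_mem_singleEdge he')) hj
    refine h3.trans ?_
    obtain ⟨j, hj⟩ : ∃ j, 3 = j + overlap g h := ⟨3 - overlap g h, by omega⟩
    rw [show 3 - overlap g h = j by omega, div_pow]
    have : (n : ℝ) ^ 3 = n ^ j * n ^ overlap g h := by rw [← pow_add, ← hj]
    rw [this, div_mul_eq_mul_div, mul_div_mul_right _ _ (by positivity)]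
    gcongr
    omega

theorem graphExp_dHat_sub_sq_le {n : ℕ} {a b : ℝ} (hb : 0 ≤ b) (hba : b ≤ a)
    (ha : 1 ≤ a) (hn : a ≤ n) :
    graphExp n (a / n) (b / n) (fun G => (dHat G - (a + b) / 2) ^ 2) ≤ 20 * a ^ 3 / n := by
  have hn0 : (0 : ℝ) < n := by linarith
  have hn1 : (1 : ℝ) ≤ n := by linarith
  have hA : a / n ≤ 1 := by rw [div_le_one hn0]; exact hn
  have hB : b / n ≤ 1 := by rw [div_le_one hn0]; linarith
  -- The mean of the average degree is d(n-1)/n. The second term pays for the bias d/n.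
  have hpt : ∀ G : SimpleGraph (Fin n), (dHat G - (a + b) / 2) ^ 2 ≤
      2 / n ^ 2 * (2 * (G.edgeSet.ncard : ℝ) - (n - 1) * ((a + b) / 2)) ^ 2 +
        2 * a ^ 2 / n ^ 2 * 1 := by
    intro G
    have h1 : dHat G - (a + b) / 2 =
        ((2 * (G.edgeSet.ncard : ℝ) - (n - 1) * ((a + b) / 2)) - (a + b) / 2) / n := by
      rw [dHat]; field_simp; ring
    rw [h1, div_pow, div_mul_eq_mul_div, mul_one, ← add_div]
    gcongr
    set X := 2 * (G.edgeSet.ncard : ℝ) - (n - 1) * ((a + b) / 2)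
    have h2 : ((a + b) / 2) ^ 2 ≤ a ^ 2 := by
      apply pow_le_pow_left₀ <;> linarith
    nlinarith [sq_nonneg (X + (a + b) / 2)]
  refine (graphExp_mono (by positivity) hA (by positivity) hB hpt).trans ?_
  rw [graphExp_add, graphExp_const_mul, graphExp_const_mul, graphExp_one]
  have h2 := variance_edge_le hb hba ha hn
  calc _ ≤ 2 / (n : ℝ) ^ 2 * (9 * a ^ 3 * n) + 2 * a ^ 2 / n ^ 2 * 1 := by gcongr
    _ = (18 * a ^ 3 * n + 2 * a ^ 2) / n ^ 2 := by ring
    _ ≤ (20 * a ^ 3 * n) / n ^ 2 := by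
      gcongr
      have : a ^ 2 * 1 ≤ a ^ 3 * n := by
        gcongr
        norm_num
      linarith
    _ = 20 * a ^ 3 / n := by field_simp

/-! ### Events of probability tending to one -/

/-- The graph property `Q` holds with probability tending to one under `SSBM(n, 2, a/n, b/n)`. -/
def WHP (a b : ℝ) (Q : ∀ n : ℕ, SimpleGraph (Fin n) → Prop) : Prop :=
  Tendsto (fun n : ℕ => ssbmProb n 2 (a / n) (b / n) {z | ¬ Q n z.2}) atTop (𝓝 0)

section WHP

variable {a b : ℝ}

theorem eventually_params (hb : 0 ≤ b) (hba : b ≤ a) : ∀ᶠ n : ℕ in atTop,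
    (0 ≤ a / n ∧ a / n ≤ 1 ∧ 0 ≤ b / n ∧ b / n ≤ 1) ∧ a ≤ n ∧ 0 < n := by
  filter_upwards [eventually_ge_atTop ⌈a⌉₊, eventually_gt_atTop 0] with n hn hn0
  have h1 : a ≤ n := (Nat.le_ceil a).trans (by exact_mod_cast hn)
  have h0 : (0 : ℝ) < n := by exact_mod_cast hn0
  have ha : 0 ≤ a := hb.trans hba
  refine ⟨⟨by positivity, ?_, by positivity, ?_⟩, h1, hn0⟩
  · rw [div_le_one h0]; exact h1
  · rw [div_le_one h0]; linarith

/-- Markov's inequality at the threshold 1; the normalisation is put into F. Chebyshev's inequality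
is the case of a rescaled square. -/
theorem whp_of_tendsto_graphExp (hb : 0 ≤ b) (hba : b ≤ a) {F : ∀ n : ℕ, SimpleGraph (Fin n) → ℝ}
    (hF : ∀ n G, 0 ≤ F n G)
    (h : Tendsto (fun n : ℕ => graphExp n (a / n) (b / n) (F n)) atTop (𝓝 0)) :
    WHP a b fun n G => F n G < 1 := by
  classical
  refine squeeze_zero' ?_ ?_ h
  · filter_upwards [eventually_params hb hba] with n ⟨⟨h1, h2, h3, h4⟩, _⟩
    rw [ssbmProb_eq_graphExp fun G => ¬ F n G < 1]
    exact graphExp_nonneg h1 h2 h3 h4 fun G => by split_ifs <;> simp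
  · filter_upwards [eventually_params hb hba] with n ⟨⟨h1, h2, h3, h4⟩, _⟩
    rw [ssbmProb_eq_graphExp fun G => ¬ F n G < 1]
    refine graphExp_mono h1 h2 h3 h4 fun G => ?_
    split_ifs with h5
    · exact hF n G
    · exact not_lt.1 h5

/-- Union bound for two events, with an implication needed only for large n. To weaken a single
event it is applied with that event twice. -/
theorem WHP.mono_of_le (hb : 0 ≤ b) (hba : b ≤ a) {Q Q' Q'' : ∀ n : ℕ, SimpleGraph (Fin n) → Prop}
    (h : WHP a b Q) (h' : WHP a b Q')
    (himp : ∀ᶠ n : ℕ in atTop, ∀ G, Q n G → Q' n G → Q'' n G) : WHP a b Q'' := by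
  classical
  have hadd := h.add h'
  rw [add_zero] at hadd
  refine squeeze_zero' ?_ ?_ hadd
  · filter_upwards [eventually_params hb hba] with n ⟨⟨h1, h2, h3, h4⟩, _⟩
    rw [ssbmProb_eq_graphExp fun G => ¬ Q'' n G]
    exact graphExp_nonneg h1 h2 h3 h4 fun G => by split_ifs <;> simp
  · filter_upwards [eventually_params hb hba, himp] with n ⟨⟨h1, h2, h3, h4⟩, _⟩ h6
    rw [ssbmProb_eq_graphExp fun G => ¬ Q'' n G, ssbmProb_eq_graphExp fun G => ¬ Q n G,
      ssbmProb_eq_graphExp fun G => ¬ Q' n G, ← graphExp_add]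
    refine graphExp_mono h1 h2 h3 h4 fun G => ?_
    have := h6 G
    split_ifs <;> simp_all

theorem WHP.tendsto_one {Q : ∀ n : ℕ, SimpleGraph (Fin n) → Prop} (h : WHP a b Q) :
    Tendsto (fun n : ℕ => ssbmProb n 2 (a / n) (b / n) {z | Q n z.2}) atTop (𝓝 1) := by
  classical
  have h1 : ∀ n : ℕ, ssbmProb n 2 (a / n) (b / n) {z | Q n z.2} =
      1 - ssbmProb n 2 (a / n) (b / n) {z | ¬ Q n z.2} := by
    intro n
    rw [ssbmProb_eq_graphExp fun G => Q n G, ssbmProb_eq_graphExp fun G => ¬ Q n G,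
      eq_sub_iff_add_eq, ← graphExp_add]
    refine Eq.trans ?_ (graphExp_one (n := n) (A := a / n) (B := b / n))
    congr 1
    funext G
    split_ifs <;> simp_all
  simp only [h1]
  simpa using tendsto_const_nhds.sub h

end WHP

/-! ### The cycle length -/

theorem tendsto_cycleLength : Tendsto cycleLength atTop atTop := by
  unfold cycleLength
  refine tendsto_nat_floor_atTop.comp ?_
  exact (tendsto_rpow_atTop (by norm_num)).comp (Real.tendsto_log_atTop.comp
    tendsto_natCast_atTop_atTop)

/-- Both uses of the cycle length go through this form: the growth bound exp(m^4) ≤ n, and a test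
that involves only powers of e with natural exponents. -/
theorem le_cycleLength_iff {n : ℕ} (hn : 1 ≤ n) (k : ℕ) :
    k ≤ cycleLength n ↔ Real.exp ((k : ℝ) ^ 4) ≤ n := by
  have hn' : (1 : ℝ) ≤ n := by exact_mod_cast hn
  have hlog : 0 ≤ Real.log n := Real.log_nonneg hn'
  rw [cycleLength, Nat.le_floor_iff (by positivity), ← Real.le_log_iff_exp_le (by linarith)]
  have h1 : Real.log n = (Real.log n ^ (1 / 4 : ℝ)) ^ 4 := by
    rw [← Real.rpow_natCast, ← Real.rpow_mul hlog]
    norm_num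
  have h0 : 0 ≤ Real.log n ^ (1 / 4 : ℝ) := by positivity
  conv_rhs => rw [h1]
  rw [pow_le_pow_iff_left₀ (by positivity) h0 (by norm_num)]

theorem exp_cycleLength_le {n : ℕ} (hn : 1 ≤ n) :
    Real.exp ((cycleLength n : ℝ) ^ 4) ≤ n := (le_cycleLength_iff hn _).1 le_rfl

theorem eventually_mul_pow_le_exp (K : ℝ) (c : ℕ) :
    ∀ᶠ m : ℕ in atTop, K * ((m : ℝ) + 1) ^ c ≤ Real.exp m := by
  have h2 : Tendsto (fun x : ℝ => K * (x ^ c * Real.exp (-x))) atTop (𝓝 (K * 0)) :=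
    (Real.tendsto_pow_mul_exp_neg_atTop_nhds_zero c).const_mul K
  rw [mul_zero] at h2
  have h3 : Tendsto (fun m : ℕ => (m : ℝ) + 1) atTop atTop :=
    tendsto_atTop_add_const_right _ _ tendsto_natCast_atTop_atTop
  have h4 := (h2.comp h3).eventually (gt_mem_nhds (Real.exp_pos (-1)))
  filter_upwards [h4] with m hm
  simp only [Function.comp] at hm
  have h5 : K * ((m : ℝ) + 1) ^ c =
      K * (((m : ℝ) + 1) ^ c * Real.exp (-((m : ℝ) + 1))) * Real.exp ((m : ℝ) + 1) := by
    rw [mul_assoc, mul_assoc, ← Real.exp_add]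
    simp
  rw [h5]
  calc _ ≤ Real.exp (-1) * Real.exp ((m : ℝ) + 1) := by gcongr
    _ = Real.exp m := by rw [← Real.exp_add]; ring_nf

/-- Eventually K(m+1)^c ≤ e^m, so the numerator is at most exp(m^2), while n ≥ exp(m^4). All error
terms of order 1/n are disposed of in this way. -/
theorem tendsto_pow_cycleLength_div (K : ℝ) (hK : 0 ≤ K) (c : ℕ) :
    Tendsto (fun n : ℕ => (K * (cycleLength n + 1) ^ c) ^ cycleLength n / n) atTop (𝓝 0) := by
  have h1 := eventually_mul_pow_le_exp K c
  have h2 : Tendsto (fun n : ℕ => Real.exp (-(cycleLength n : ℝ))) atTop (𝓝 0) :=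
    Real.tendsto_exp_neg_atTop_nhds_zero.comp
      (tendsto_natCast_atTop_atTop.comp tendsto_cycleLength)
  refine squeeze_zero' (Eventually.of_forall fun n => by positivity) ?_ h2
  filter_upwards [tendsto_cycleLength.eventually h1, eventually_ge_atTop 1,
    tendsto_cycleLength.eventually (eventually_ge_atTop 2)] with n hn hn1 hm
  set m := cycleLength n with hm'
  have hexp := exp_cycleLength_le hn1
  have hm2 : (2 : ℝ) ≤ m := by exact_mod_cast hm
  calc (K * ((m : ℝ) + 1) ^ c) ^ m / n ≤ Real.exp m ^ m / Real.exp ((m : ℝ) ^ 4) := by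
        gcongr
    _ = Real.exp ((m : ℝ) * m - (m : ℝ) ^ 4) := by rw [← Real.exp_nat_mul, ← Real.exp_sub]
    _ ≤ Real.exp (-(m : ℝ)) := by
        apply Real.exp_le_exp.2
        nlinarith [mul_nonneg (sq_nonneg (m : ℝ)) (show (0 : ℝ) ≤ (m : ℝ) ^ 2 - 4 by nlinarith)]

/-! ### Consistency -/

section consistency

variable {a b : ℝ}

/-- The hypothesis is d < f^2. It forces f > 1, since f ≤ 1 would give (a-b)^2 ≤ 2(a-b) ≤ 2(a+b). -/
theorem params_bounds (hb : 0 ≤ b) (hba : b ≤ a) (hab : (a - b) ^ 2 > 2 * (a + b)) :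
    1 < (a - b) / 2 ∧ (a - b) / 2 ≤ (a + b) / 2 ∧ (a + b) / 2 < ((a - b) / 2) ^ 2 ∧
      1 < (a + b) / 2 ∧ 1 ≤ a := by
  have h1 : 1 < (a - b) / 2 := by
    by_contra hcon
    push Not at hcon
    nlinarith
  refine ⟨h1, by linarith, by nlinarith, by linarith, by linarith⟩

/-- The precision to which the average degree has to be known. -/
noncomputable def degreeTolerance (d : ℝ) (m : ℕ) : ℝ := 1 / (8 * (m + 1) * (2 * d) ^ m)

/-- Chebyshev's inequality. The inverse square of the tolerance is 64(m+1)^2 (2d)^(2m), which is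
still negligible against n. -/
theorem whp_dHat (hb : 0 ≤ b) (hba : b ≤ a) (hab : (a - b) ^ 2 > 2 * (a + b)) :
    WHP a b fun n G => |dHat G - (a + b) / 2| < degreeTolerance ((a + b) / 2) (cycleLength n) := by
  obtain ⟨hf, hfd, hdf, hd, ha⟩ := params_bounds hb hba hab
  set d := (a + b) / 2 with hd'
  have hpos : ∀ m, 0 < degreeTolerance d m := fun m => by unfold degreeTolerance; positivity
  have h := whp_of_tendsto_graphExp hb hba
    (F := fun n G => 1 / degreeTolerance d (cycleLength n) ^ 2 * (dHat G - d) ^ 2)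
    (fun n G => by positivity) ?_
  · refine h.mono_of_le hb hba h (Eventually.of_forall fun n G hG _ => ?_)
    rw [one_div_mul_eq_div, div_lt_one (pow_pos (hpos _) 2)] at hG
    exact lt_of_pow_lt_pow_left₀ 2 (hpos _).le (by rwa [sq_abs])
  · have hlim := (tendsto_pow_cycleLength_div ((2 * d) ^ 2) (by positivity) 2).const_mul
      (20 * a ^ 3 * 64)
    rw [mul_zero] at hlim
    refine squeeze_zero' ?_ ?_ hlim
    · filter_upwards [eventually_params hb hba] with n ⟨⟨h1, h2, h3, h4⟩, _⟩
      exact graphExp_nonneg h1 h2 h3 h4 fun G => by positivity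
    · filter_upwards [eventually_params hb hba,
        tendsto_cycleLength.eventually (eventually_ge_atTop 1)] with n ⟨_, h5, h6⟩ hm
      rw [graphExp_const_mul]
      set m := cycleLength n
      have hn0 : (0 : ℝ) < n := by exact_mod_cast h6
      calc 1 / degreeTolerance d m ^ 2 * _ ≤ 1 / degreeTolerance d m ^ 2 * (20 * a ^ 3 / n) := by
            gcongr
            exact graphExp_dHat_sub_sq_le hb hba ha h5
        _ = 20 * a ^ 3 * 64 * (((2 * d) ^ 2) ^ m * ((m : ℝ) + 1) ^ 2 / n) := by
            unfold degreeTolerance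
            rw [← pow_mul, mul_comm 2 m, pow_mul]
            field_simp
            ring
        _ ≤ 20 * a ^ 3 * 64 * (((2 * d) ^ 2 * ((m : ℝ) + 1) ^ 2) ^ m / n) := by
            rw [mul_pow ((2 * d) ^ 2)]
            gcongr
            rw [← pow_mul]
            apply pow_le_pow_right₀
            · have : (0 : ℝ) ≤ m := by positivity
              linarith
            · omega

/-- Chebyshev's inequality at the scale f^m. After division by f^(2m) the same-cycle pairs leave a
multiple of m(d/f^2)^m, and this is where d < f^2 is indispensable: the fluctuation of order d^(m/2)
must be smaller than the signal f^m. -/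
theorem whp_cycle (hb : 0 ≤ b) (hba : b ≤ a) (hab : (a - b) ^ 2 > 2 * (a + b)) :
    WHP a b fun n G => |2 * (cycleLength n : ℝ) * (cycleCount G (cycleLength n) : ℝ) -
      n.descFactorial (cycleLength n) / (n : ℝ) ^ cycleLength n *
        (((a + b) / 2) ^ cycleLength n + ((a - b) / 2) ^ cycleLength n)| <
        ((a - b) / 2) ^ cycleLength n / 8 := by
  obtain ⟨hf, hfd, hdf, hd, ha⟩ := params_bounds hb hba hab
  set d := (a + b) / 2 with hd'
  set f := (a - b) / 2 with hf'
  have hf0 : 0 < f := by linarith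
  have h := whp_of_tendsto_graphExp hb hba
    (F := fun n G => 64 / (f ^ 2) ^ cycleLength n *
      (2 * (cycleLength n : ℝ) * (cycleCount G (cycleLength n) : ℝ) -
      n.descFactorial (cycleLength n) / (n : ℝ) ^ cycleLength n *
        (d ^ cycleLength n + f ^ cycleLength n)) ^ 2)
    (fun n G => by positivity) ?_
  · refine h.mono_of_le hb hba h (Eventually.of_forall fun n G hG _ => ?_)
    rw [div_mul_eq_mul_div, div_lt_one (by positivity)] at hG
    refine lt_of_pow_lt_pow_left₀ 2 (by positivity) ?_
    rw [sq_abs, div_pow (f ^ cycleLength n), ← pow_mul, mul_comm (cycleLength n) 2, pow_mul]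
    linarith
  · have hlim1 : Tendsto (fun n : ℕ => 256 * ((cycleLength n : ℝ) *
        (d / f ^ 2) ^ cycleLength n)) atTop (𝓝 (256 * 0)) := by
      have h1 : Tendsto (fun m : ℕ => (m : ℝ) * (d / f ^ 2) ^ m) atTop (𝓝 0) :=
        tendsto_self_mul_const_pow_of_lt_one (by positivity)
          (by rw [div_lt_one (by positivity)]; exact hdf)
      exact (h1.comp tendsto_cycleLength).const_mul 256
    have hlim2 := (tendsto_pow_cycleLength_div (a ^ 2) (by positivity) 1).const_mul 64
    have hlim := hlim1.add hlim2
    simp only [mul_zero, add_zero] at hlim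
    refine squeeze_zero' ?_ ?_ hlim
    · filter_upwards [eventually_params hb hba] with n ⟨⟨h1, h2, h3, h4⟩, _⟩
      exact graphExp_nonneg h1 h2 h3 h4 fun G => by positivity
    · filter_upwards [eventually_params hb hba,
        tendsto_cycleLength.eventually (eventually_ge_atTop 3)] with n ⟨_, h5, h6⟩ hm
      rw [graphExp_const_mul]
      set m := cycleLength n
      have : NeZero m := ⟨by omega⟩
      have hn0 : (0 : ℝ) < n := by exact_mod_cast h6
      have hvar := variance_cycle_le hm hb hba ha h5
      have htp : templateProb (a / n) (b / n) (cycleEdges m) = (d ^ m + f ^ m) / (n : ℝ) ^ m := by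
        rw [templateProb_cycleEdges hm, add_div (d ^ m), ← div_pow, ← div_pow, hd', hf']
        congr 2 <;> ring_nf
      rw [htp, mul_div_cancel₀ _ (by positivity)] at hvar
      have hco : ∀ G : SimpleGraph (Fin n), 2 * (m : ℝ) * (cycleCount G m : ℝ) -
          n.descFactorial m / (n : ℝ) ^ m * (d ^ m + f ^ m) = (copies (cycleEdges m) G : ℝ) -
          n.descFactorial m * ((d ^ m + f ^ m) / (n : ℝ) ^ m) := by
        intro G
        rw [← two_mul_mul_copyCount hm, cycleCount]
        push_cast
        ring
      simp only [hco]
      calc 64 / (f ^ 2) ^ m * _ ≤ 64 / (f ^ 2) ^ m *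
            (2 * m * (d ^ m + f ^ m) + a ^ (2 * m) * (m + 1) ^ m / n) := by gcongr
        _ ≤ 64 / (f ^ 2) ^ m * (2 * m * (d ^ m + d ^ m)) +
            64 / 1 * (a ^ (2 * m) * (m + 1) ^ m / n) := by
            rw [mul_add]
            gcongr
            exact one_le_pow₀ (one_le_pow₀ hf.le)
        _ = 256 * ((m : ℝ) * (d / f ^ 2) ^ m) + 64 * ((a ^ 2 * ((m : ℝ) + 1) ^ 1) ^ m / n) := by
            rw [div_pow, mul_pow (a ^ 2), pow_one, ← pow_mul]
            ring_nf

theorem one_sub_le_descFactorial_div {n m : ℕ} (hm : m ≤ n) (hn : 0 < n) :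
    1 - (m : ℝ) * m / n ≤ n.descFactorial m / (n : ℝ) ^ m := by
  have hn0 : (0 : ℝ) < n := by exact_mod_cast hn
  have h1 : ((n - m : ℕ) : ℝ) ^ m ≤ n.descFactorial m := by
    exact_mod_cast (Nat.pow_le_pow_left (by omega) m).trans (Nat.pow_sub_le_descFactorial n m)
  rw [Nat.cast_sub hm] at h1
  have h2 : 1 + (m : ℝ) * (-(m / n)) ≤ (1 + -((m : ℝ) / n)) ^ m := by
    apply one_add_mul_le_pow
    have : (m : ℝ) / n ≤ 1 := by
      rw [div_le_one hn0]; exact_mod_cast hm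
    linarith
  have h3 : (1 + -((m : ℝ) / n)) ^ m = ((n : ℝ) - m) ^ m / n ^ m := by
    rw [← div_pow]; congr 1; field_simp
    ring
  calc 1 - (m : ℝ) * m / n = 1 + (m : ℝ) * (-(m / n)) := by ring
    _ ≤ ((n : ℝ) - m) ^ m / n ^ m := by rw [← h3]; exact h2
    _ ≤ _ := by gcongr

/-- The radicand differs from f^m by three errors, each at most f^m/8: the fluctuation of the cycle
count, the gap between the falling factorial and n^m, and the difference between the m-th powers of
the average degree and of d. -/
theorem whp_radicand (hb : 0 ≤ b) (hba : b ≤ a) (hab : (a - b) ^ 2 > 2 * (a + b)) :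
    WHP a b fun n G => ((a - b) / 2) ^ cycleLength n / 2 ≤ radicand G ∧
      radicand G ≤ 2 * ((a - b) / 2) ^ cycleLength n := by
  refine (whp_dHat hb hba hab).mono_of_le hb hba (whp_cycle hb hba hab) ?_
  obtain ⟨hf, hfd, hdf, hd, ha⟩ := params_bounds hb hba hab
  set d := (a + b) / 2 with hd'
  set f := (a - b) / 2 with hf'
  have hsmall := (tendsto_pow_cycleLength_div (16 * d) (by positivity) 2).eventually
    (gt_mem_nhds (show (0 : ℝ) < 1 by norm_num))
  filter_upwards [hsmall, eventually_params hb hba,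
    tendsto_cycleLength.eventually (eventually_ge_atTop 3)] with n hn ⟨_, _, hn0⟩ hm G h1 h2
  unfold radicand
  set m := cycleLength n
  have hn0' : (0 : ℝ) < n := by exact_mod_cast hn0
  have hm1 : (1 : ℝ) ≤ m := by exact_mod_cast (by omega : 1 ≤ m)
  have hfm : 1 ≤ f ^ m := one_le_pow₀ hf.le
  have hfdm : f ^ m ≤ d ^ m := by gcongr
  -- The right side is eventually below n, so the falling factorial loses at most (m^2/n) · 2d^m ≤
  -- 1/8, and f^m ≥ 1.
  have hbase : 16 * ((m : ℝ) * m) * d ^ m ≤ (16 * d * ((m : ℝ) + 1) ^ 2) ^ m := by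
    rw [mul_pow, mul_pow]
    have e1 : (16 : ℝ) ^ 1 ≤ 16 ^ m := pow_le_pow_right₀ (by norm_num) (by omega)
    have e2 : (((m : ℝ) + 1) ^ 2) ^ 1 ≤ (((m : ℝ) + 1) ^ 2) ^ m :=
      pow_le_pow_right₀ (by nlinarith) (by omega)
    have e3 : (m : ℝ) * m ≤ (((m : ℝ) + 1) ^ 2) ^ m := by nlinarith
    calc 16 * ((m : ℝ) * m) * d ^ m = 16 ^ 1 * d ^ m * ((m : ℝ) * m) := by ring
      _ ≤ _ := by gcongr
  rw [div_lt_one hn0'] at hn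
  have hmn : m ≤ n := by
    have : (m : ℝ) ≤ n := by
      have : 1 ≤ d ^ m := one_le_pow₀ hd.le
      nlinarith
    exact_mod_cast this
  have h3 : |(n.descFactorial m : ℝ) / (n : ℝ) ^ m * (d ^ m + f ^ m) - (d ^ m + f ^ m)| ≤
      f ^ m / 8 := by
    have h4 := one_sub_le_descFactorial_div hmn hn0
    have h5 : (n.descFactorial m : ℝ) / (n : ℝ) ^ m ≤ 1 := by
      rw [div_le_one (by positivity)]
      exact_mod_cast Nat.descFactorial_le_pow n m
    have h6 : (m : ℝ) * m / n * (d ^ m + f ^ m) ≤ f ^ m / 8 := by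
      rw [div_mul_eq_mul_div, div_le_iff₀ hn0']
      calc (m : ℝ) * m * (d ^ m + f ^ m) ≤ m * m * (d ^ m + d ^ m) := by gcongr
        _ ≤ 1 / 8 * n := by linarith
        _ ≤ f ^ m / 8 * n := by gcongr
    have h7 : (1 - (n.descFactorial m : ℝ) / (n : ℝ) ^ m) * (d ^ m + f ^ m) ≤
        (m : ℝ) * m / n * (d ^ m + f ^ m) := by
      gcongr
      linarith
    have h8 : 0 ≤ (1 - (n.descFactorial m : ℝ) / (n : ℝ) ^ m) * (d ^ m + f ^ m) :=
      mul_nonneg (by linarith) (by positivity)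
    rw [abs_le]
    constructor <;> linarith
  have h4 : |dHat G ^ m - d ^ m| ≤ f ^ m / 8 := by
    have htol : degreeTolerance d m ≤ 1 := by
      unfold degreeTolerance
      rw [div_le_one (by positivity)]
      have : 1 ≤ (2 * d) ^ m := one_le_pow₀ (by linarith)
      nlinarith
    have h5 := abs_pow_sub_pow_le (dHat G) d m
    have h6 : max |dHat G| |d| ≤ 2 * d := by
      rw [abs_of_pos (by linarith : (0 : ℝ) < d)]
      apply max_le
      · have := abs_sub_abs_le_abs_sub (dHat G) d
        rw [abs_of_pos (by linarith : (0 : ℝ) < d)] at this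
        linarith
      · linarith
    have htol0 : 0 ≤ degreeTolerance d m := by unfold degreeTolerance; positivity
    -- The mean value bound |x^m - y^m| ≤ |x - y| m max^(m-1), with both numbers at most 2d,
    -- explains the shape of `degreeTolerance`.
    calc |dHat G ^ m - d ^ m| ≤ _ := h5
      _ ≤ degreeTolerance d m * m * (2 * d) ^ (m - 1) := by gcongr
      _ ≤ degreeTolerance d m * (m + 1) * (2 * d) ^ m := by
          gcongr
          · linarith
          · linarith
          · omega
      _ = 1 / 8 := by
          unfold degreeTolerance
          field_simp
      _ ≤ f ^ m / 8 := by linarith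
  have h2' := abs_lt.1 h2
  have h3' := abs_le.1 h3
  have h4' := abs_le.1 h4
  constructor <;> linarith

/-- Knowing the radicand up to a constant factor suffices, as c^(1/m) tends to 1 for every c > 0. -/
theorem whp_fHat (hb : 0 ≤ b) (hba : b ≤ a) (hab : (a - b) ^ 2 > 2 * (a + b)) {ε : ℝ} (hε : 0 < ε) :
    WHP a b fun _ G => |fHat G - (a - b) / 2| < ε := by
  have h := whp_radicand hb hba hab
  refine h.mono_of_le hb hba h ?_
  obtain ⟨hf, -⟩ := params_bounds hb hba hab
  set f := (a - b) / 2 with hf'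
  have hinv : Tendsto (fun n : ℕ => 1 / (cycleLength n : ℝ)) atTop (𝓝 0) :=
    tendsto_one_div_atTop_nhds_zero_nat.comp tendsto_cycleLength
  have hlim : ∀ c : ℝ, 0 < c → Tendsto (fun n : ℕ => c ^ (1 / (cycleLength n : ℝ)) * f) atTop
      (𝓝 f) := by
    intro c hc
    have h1 : Tendsto (fun n : ℕ => c ^ (1 / (cycleLength n : ℝ))) atTop (𝓝 (c ^ (0 : ℝ))) :=
      (Real.continuousAt_const_rpow hc.ne').tendsto.comp hinv
    rw [Real.rpow_zero] at h1
    simpa using h1.mul_const f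
  filter_upwards [(hlim (1 / 2) (by norm_num)).eventually (lt_mem_nhds (sub_lt_self f hε)),
    (hlim 2 (by norm_num)).eventually (gt_mem_nhds (lt_add_of_pos_right f hε)),
    tendsto_cycleLength.eventually (eventually_ge_atTop 3)] with n h1 h2 hm G hG _
  have hroot : ∀ c : ℝ, 0 < c → (c * f ^ cycleLength n) ^ (1 / (cycleLength n : ℝ)) =
      c ^ (1 / (cycleLength n : ℝ)) * f := by
    intro c hc
    rw [Real.mul_rpow hc.le (by positivity), one_div,
      Real.pow_rpow_inv_natCast (by positivity) (by omega)]
  unfold fHat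
  have h3 : (1 / 2 * f ^ cycleLength n) ^ (1 / (cycleLength n : ℝ)) ≤
      radicand G ^ (1 / (cycleLength n : ℝ)) := by
    apply Real.rpow_le_rpow (by positivity) (by linarith [hG.1]) (by positivity)
  have h4 : radicand G ^ (1 / (cycleLength n : ℝ)) ≤
      (2 * f ^ cycleLength n) ^ (1 / (cycleLength n : ℝ)) := by
    apply Real.rpow_le_rpow _ hG.2 (by positivity)
    refine le_trans ?_ hG.1
    positivity
  rw [hroot _ (by norm_num)] at h3 h4
  rw [abs_lt]
  constructor <;> linarith

theorem whp_dHat_sub_lt (hb : 0 ≤ b) (hba : b ≤ a) (hab : (a - b) ^ 2 > 2 * (a + b)) {ε : ℝ}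
    (hε : 0 < ε) : WHP a b fun _ G => |dHat G - (a + b) / 2| < ε := by
  have h := whp_dHat hb hba hab
  refine h.mono_of_le hb hba h ?_
  obtain ⟨-, -, -, hd, -⟩ := params_bounds hb hba hab
  have hinv : Tendsto (fun n : ℕ => 1 / (cycleLength n : ℝ)) atTop (𝓝 0) :=
    tendsto_one_div_atTop_nhds_zero_nat.comp tendsto_cycleLength
  filter_upwards [hinv.eventually (gt_mem_nhds hε),
    tendsto_cycleLength.eventually (eventually_ge_atTop 1)] with n hn hm G hG _
  refine hG.trans (lt_of_le_of_lt ?_ hn)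
  unfold degreeTolerance
  have hm' : (1 : ℝ) ≤ cycleLength n := by exact_mod_cast hm
  have : 1 ≤ (2 * ((a + b) / 2)) ^ cycleLength n := one_le_pow₀ (by linarith)
  apply one_div_le_one_div_of_le (by linarith)
  nlinarith

theorem isConsistent_add (hb : 0 ≤ b) (hba : b ≤ a) (hab : (a - b) ^ 2 > 2 * (a + b)) :
    IsConsistent a b (fun _ G => dHat G + fHat G) a := by
  intro ε hε
  have h := (whp_dHat_sub_lt hb hba hab (half_pos hε)).mono_of_le hb hba
    (whp_fHat hb hba hab (half_pos hε)) (Q'' := fun n G => ¬ ε ≤ |dHat G + fHat G - a|)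
    (Eventually.of_forall fun n G h1 h2 => ?_)
  · simpa only [WHP, not_not] using h
  · rw [not_le]
    rw [abs_lt] at *
    constructor <;> linarith [h1.1, h1.2, h2.1, h2.2]

theorem isConsistent_sub (hb : 0 ≤ b) (hba : b ≤ a) (hab : (a - b) ^ 2 > 2 * (a + b)) :
    IsConsistent a b (fun _ G => dHat G - fHat G) b := by
  intro ε hε
  have h := (whp_dHat_sub_lt hb hba hab (half_pos hε)).mono_of_le hb hba
    (whp_fHat hb hba hab (half_pos hε)) (Q'' := fun n G => ¬ ε ≤ |dHat G - fHat G - b|)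
    (Eventually.of_forall fun n G h1 h2 => ?_)
  · simpa only [WHP, not_not] using h
  · rw [not_le]
    rw [abs_lt] at *
    constructor <;> linarith [h1.1, h1.2, h2.1, h2.2]

end consistency

/-! ### Powers of `e` are not too close to integers -/

section exponentialGap

open Polynomial intervalIntegral

/-- The polynomial `X ^ p * (M - X) ^ p`. -/
noncomputable def nivenPoly (M p : ℕ) : ℤ[X] := X ^ p * (C (M : ℤ) - X) ^ p

theorem aeval_nivenPoly (M p : ℕ) (x : ℝ) : aeval x (nivenPoly M p) = x ^ p * (M - x) ^ p := by
  simp [nivenPoly]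

/-- Hermite's identity. The sum F of all derivatives of the polynomial P satisfies F = P + F', so
-exp(-x)F(x) is an antiderivative of exp(-x)P(x). -/
theorem integral_nivenPoly (M p : ℕ) :
    Real.exp M * ∫ x in (0 : ℝ)..M, Real.exp (-x) * (x ^ p * (M - x) ^ p) =
      Real.exp M * (sumIDeriv (nivenPoly M p)).eval 0 -
        (sumIDeriv (nivenPoly M p)).eval (M : ℤ) := by
  set F := (sumIDeriv (nivenPoly M p)).map (algebraMap ℤ ℝ) with hF
  have hF' : F = sumIDeriv ((nivenPoly M p).map (algebraMap ℤ ℝ)) := by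
    rw [hF, sumIDeriv_map]
  have hderiv : ∀ x : ℝ, HasDerivAt (fun x => -(Real.exp (-x) * F.eval x))
      (Real.exp (-x) * (x ^ p * (M - x) ^ p)) x := by
    intro x
    have h1 : HasDerivAt (fun x : ℝ => Real.exp (-x)) (-Real.exp (-x)) x := by
      simpa using (hasDerivAt_neg x).exp
    refine (h1.fun_mul (F.hasDerivAt x)).fun_neg.congr_deriv ?_
    have h3 : F = (nivenPoly M p).map (algebraMap ℤ ℝ) + derivative F := by
      conv_lhs => rw [hF', sumIDeriv_eq_self_add]
      rw [← hF']
    have h4 : F.eval x = x ^ p * (M - x) ^ p + (derivative F).eval x := by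
      conv_lhs => rw [h3]
      rw [eval_add, eval_map_algebraMap, aeval_nivenPoly]
    rw [h4]
    ring
  rw [integral_eq_sub_of_hasDerivAt (fun x _ => hderiv x)
    (Continuous.intervalIntegrable (by fun_prop) _ _)]
  have h0 : F.eval (0 : ℝ) = ((sumIDeriv (nivenPoly M p)).eval 0 : ℤ) := by
    have := eval_intCast_map (algebraMap ℤ ℝ) (sumIDeriv (nivenPoly M p)) 0
    simpa only [Int.cast_zero, eq_intCast] using this
  have hM : F.eval (M : ℝ) = ((sumIDeriv (nivenPoly M p)).eval (M : ℤ) : ℤ) := by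
    have := eval_intCast_map (algebraMap ℤ ℝ) (sumIDeriv (nivenPoly M p)) (M : ℤ)
    simpa only [Int.cast_natCast, eq_intCast] using this
  rw [h0, hM]
  simp only [neg_zero, Real.exp_zero, one_mul, sub_neg_eq_add]
  rw [mul_add, mul_neg, ← mul_assoc, ← Real.exp_add]
  simp
  ring

/-- P vanishes to order p at 0, so only derivatives of order at least p survive there, and these
carry a factor p!. The same happens at M. -/
theorem factorial_dvd_eval_zero (M p : ℕ) :
    (p.factorial : ℤ) ∣ (sumIDeriv (nivenPoly M p)).eval 0 := by
  obtain ⟨g, -, hg⟩ := aeval_sumIDeriv (A := ℤ) (nivenPoly M p) p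
  have := hg 0 (by simp [nivenPoly])
  rw [coe_aeval_eq_eval, nsmul_eq_mul] at this
  exact ⟨_, this⟩

theorem factorial_dvd_eval_self (M p : ℕ) :
    (p.factorial : ℤ) ∣ (sumIDeriv (nivenPoly M p)).eval (M : ℤ) := by
  obtain ⟨g, -, hg⟩ := aeval_sumIDeriv (A := ℤ) (nivenPoly M p) p
  have := hg (M : ℤ) (by
    simp only [nivenPoly, algebraMap_int_eq, Polynomial.map_mul, Polynomial.map_pow,
      Polynomial.map_sub, Polynomial.map_X, Polynomial.map_C, Int.coe_castRingHom, Int.cast_id]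
    rw [← mul_pow]
    exact pow_dvd_pow_of_dvd ⟨-X, by ring⟩ p)
  rw [coe_aeval_eq_eval, nsmul_eq_mul] at this
  exact ⟨_, this⟩

theorem abs_coeff_nivenPoly_le {M : ℕ} (hM : 1 ≤ M) (p j : ℕ) :
    |(nivenPoly M p).coeff j| ≤ (2 * M : ℤ) ^ p := by
  rw [nivenPoly, coeff_X_pow_mul']
  split_ifs with h
  · have h1 : (C (M : ℤ) - X) ^ p = (C ((-1) ^ p) : ℤ[X]) * (X + C (-(M : ℤ))) ^ p := by
      rw [C_pow, ← mul_pow]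
      congr 1
      simp only [C_neg, C_1]
      ring
    rw [h1, coeff_C_mul, coeff_X_add_C_pow, abs_mul, abs_mul, abs_pow, abs_pow]
    simp only [abs_neg, abs_one, one_pow, one_mul, Nat.abs_cast]
    rw [mul_comm, mul_pow]
    have h2 : ((p.choose (j - p) : ℕ) : ℤ) ≤ 2 ^ p := by
      exact_mod_cast Nat.choose_le_two_pow p (j - p)
    have h3 : (M : ℤ) ^ (p - (j - p)) ≤ (M : ℤ) ^ p :=
      pow_le_pow_right₀ (by exact_mod_cast hM) (by omega)
    gcongr
  · simp

theorem abs_eval_zero_le {M : ℕ} (hM : 1 ≤ M) (p : ℕ) :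
    |(sumIDeriv (nivenPoly M p)).eval 0| ≤ ((2 * p + 1).factorial : ℤ) * (2 * M) ^ p := by
  have hdeg : (nivenPoly M p).natDegree ≤ 2 * p := by
    unfold nivenPoly
    refine natDegree_mul_le.trans ?_
    have h1 : (X ^ p : ℤ[X]).natDegree ≤ p := by simp
    have h2 : ((C (M : ℤ) - X) ^ p).natDegree ≤ p := by
      refine natDegree_pow_le.trans ?_
      have : (C (M : ℤ) - X).natDegree ≤ 1 := by
        refine (natDegree_sub_le _ _).trans ?_
        simp
      nlinarith
    omega
  rw [sumIDeriv_apply_of_le hdeg, eval_finsetSum]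
  refine (Finset.abs_sum_le_sum_abs _ _).trans ?_
  have hterm : ∀ j ∈ Finset.range (2 * p + 1), |(derivative^[j] (nivenPoly M p)).eval 0| ≤
      ((2 * p).factorial : ℤ) * (2 * M) ^ p := by
    intro j hj
    rw [← coeff_zero_eq_eval_zero, coeff_iterate_derivative, zero_add, Nat.descFactorial_self,
      nsmul_eq_mul, abs_mul, Nat.abs_cast]
    have h1 : j.factorial ≤ (2 * p).factorial :=
      Nat.factorial_le (by have := Finset.mem_range.1 hj; omega)
    have h2 := abs_coeff_nivenPoly_le hM p j
    gcongr
  refine (Finset.sum_le_sum hterm).trans ?_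
  rw [Finset.sum_const, Finset.card_range, nsmul_eq_mul, Nat.factorial_succ]
  push_cast
  rw [mul_assoc]

theorem integral_niven_le {M : ℕ} (p : ℕ) :
    ∫ x in (0 : ℝ)..M, Real.exp (-x) * (x ^ p * (M - x) ^ p) ≤ M * (M : ℝ) ^ (2 * p) := by
  have h : ∀ x ∈ Set.Icc (0 : ℝ) M, Real.exp (-x) * (x ^ p * (M - x) ^ p) ≤ (M : ℝ) ^ (2 * p) := by
    intro x hx
    have h1 : Real.exp (-x) ≤ 1 := by simpa using hx.1
    have h2 : x ^ p ≤ (M : ℝ) ^ p := pow_le_pow_left₀ hx.1 hx.2 p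
    have h3 : (M - x) ^ p ≤ (M : ℝ) ^ p :=
      pow_le_pow_left₀ (by linarith [hx.2]) (by linarith [hx.1]) p
    have h4 : 0 ≤ (M - x) ^ p := pow_nonneg (by linarith [hx.2]) p
    have h5 : 0 ≤ x ^ p := pow_nonneg hx.1 p
    calc Real.exp (-x) * (x ^ p * (M - x) ^ p) ≤ 1 * ((M : ℝ) ^ p * (M : ℝ) ^ p) := by gcongr
      _ = _ := by rw [two_mul, pow_add, one_mul]
  have h2 := integral_mono_on (μ := MeasureTheory.volume) (a := (0 : ℝ)) (b := M) (by positivity)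
    (Continuous.intervalIntegrable (by fun_prop) _ _)
    (Continuous.intervalIntegrable (continuous_const (y := (M : ℝ) ^ (2 * p))) _ _) h
  simpa using h2

/-- On [1/4, 3/4] one has x(M-x) ≥ 1/16, and the factor exp(M) outweighs exp(-x) ≥ exp(-M). -/
theorem le_integral_niven {M : ℕ} (hM : 1 ≤ M) (p : ℕ) :
    (1 / 16 : ℝ) ^ p / 2 ≤
      Real.exp M * ∫ x in (0 : ℝ)..M, Real.exp (-x) * (x ^ p * (M - x) ^ p) := by
  have hM' : (1 : ℝ) ≤ M := by exact_mod_cast hM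
  have hcont : Continuous fun x : ℝ => Real.exp (-x) * (x ^ p * (M - x) ^ p) := by fun_prop
  have h1 : ∫ x in (1 / 4 : ℝ)..(3 / 4), Real.exp (-x) * (x ^ p * (M - x) ^ p) ≤
      ∫ x in (0 : ℝ)..M, Real.exp (-x) * (x ^ p * (M - x) ^ p) := by
    refine integral_mono_interval (by norm_num) (by norm_num) (by linarith) ?_
      (hcont.intervalIntegrable _ _)
    refine MeasureTheory.ae_restrict_of_forall_mem measurableSet_Ioc fun x hx => ?_
    have : 0 ≤ (M : ℝ) - x := by linarith [hx.2]
    have := hx.1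
    simp only [Pi.zero_apply]
    positivity
  have h : ∀ x ∈ Set.Icc (1 / 4 : ℝ) (3 / 4), Real.exp (-M) * (1 / 16 : ℝ) ^ p ≤
      Real.exp (-x) * (x ^ p * (M - x) ^ p) := by
    intro x hx
    rw [← mul_pow]
    have h3 : (1 / 16 : ℝ) ≤ x * (M - x) := by nlinarith [hx.1, hx.2]
    have h4 : Real.exp (-M) ≤ Real.exp (-x) := by
      apply Real.exp_le_exp.2; linarith [hx.2]
    gcongr
  have h2 := integral_mono_on (μ := MeasureTheory.volume) (a := (1 / 4 : ℝ)) (b := 3 / 4)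
    (by norm_num) (Continuous.intervalIntegrable
      (continuous_const (y := Real.exp (-M) * (1 / 16 : ℝ) ^ p)) _ _)
    (hcont.intervalIntegrable _ _) h
  rw [integral_const, smul_eq_mul] at h2
  calc (1 / 16 : ℝ) ^ p / 2
      = Real.exp M * ((3 / 4 - 1 / 4) * (Real.exp (-M) * (1 / 16 : ℝ) ^ p)) := by
        rw [Real.exp_neg]; field_simp; norm_num
    _ ≤ _ := by gcongr; exact h2.trans h1

/-- Let δ = exp(M) - n and let E be exp(M) times the integral. Dividing Hermite's identity by p!
gives E/p! = δu + K with integers u = F(0)/p! and K, while 0 < E/p! ≤ 1/2. If K = 0 then E/p! = δu;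
otherwise |δu| ≥ 1/2 ≥ E/p!. In both cases E ≤ δ|F(0)|, and a lower bound on E with an upper bound
on |F(0)| keeps δ away from 0. -/
theorem exp_sub_natCast_ge {M n p : ℕ} (hM : 1 ≤ M) (hn : (n : ℝ) < Real.exp M)
    (hp : Real.exp M * (M * (M : ℝ) ^ (2 * p)) / p.factorial ≤ 1 / 2) :
    (1 / 16 : ℝ) ^ p / 2 / ((2 * p + 1).factorial * (2 * M) ^ p) ≤ Real.exp M - n := by
  obtain ⟨u, hu⟩ := factorial_dvd_eval_zero M p
  obtain ⟨w, hw⟩ := factorial_dvd_eval_self M p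
  have hid := integral_nivenPoly M p
  have hlow := le_integral_niven hM p
  set E := Real.exp M * ∫ x in (0 : ℝ)..M, Real.exp (-x) * (x ^ p * (M - x) ^ p) with hE
  have hup : E / p.factorial ≤ 1 / 2 := by
    refine le_trans ?_ hp
    rw [hE]
    gcongr
    exact integral_niven_le p
  have hE0 : 0 < E := lt_of_lt_of_le (by positivity) hlow
  have hfac : (0 : ℝ) < p.factorial := by exact_mod_cast p.factorial_pos
  rw [hw] at hid
  have hF0 := abs_eval_zero_le hM p
  set F0 := (sumIDeriv (nivenPoly M p)).eval 0 with hF0'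
  have hF0R : |(F0 : ℝ)| ≤ (2 * p + 1).factorial * (2 * M) ^ p := by exact_mod_cast hF0
  set δ := Real.exp M - n with hδ
  have hδ0 : 0 < δ := by rw [hδ]; linarith
  have hu' : (F0 : ℝ) = p.factorial * u := by rw [hu]; push_cast; ring
  have key : E / p.factorial = δ * u + ((n * u - w : ℤ) : ℝ) := by
    rw [hid, hu', hδ]
    push_cast
    field_simp
    ring
  have hmain : E ≤ δ * |(F0 : ℝ)| := by
    have h1 : E / p.factorial ≤ |δ * u| := by
      by_cases hK : (n * u - w : ℤ) = 0
      · rw [hK, Int.cast_zero, add_zero] at key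
        rw [key]
        exact le_abs_self _
      · have h2 : (1 : ℝ) ≤ |((n * u - w : ℤ) : ℝ)| := by
          exact_mod_cast Int.one_le_abs hK
        have h3 : ((n * u - w : ℤ) : ℝ) = E / p.factorial - δ * u := by rw [key]; ring
        have h4 : |((n * u - w : ℤ) : ℝ)| ≤ |E / p.factorial| + |δ * u| := by
          rw [h3]; exact abs_sub _ _
        rw [abs_of_pos (div_pos hE0 hfac)] at h4
        linarith
    rw [div_le_iff₀ hfac, abs_mul, abs_of_pos hδ0] at h1
    rw [hu', abs_mul, abs_of_pos hfac]
    linarith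
  rw [div_le_iff₀ (by positivity)]
  calc (1 / 16 : ℝ) ^ p / 2 ≤ E := hlow
    _ ≤ δ * |(F0 : ℝ)| := hmain
    _ ≤ _ := by gcongr

end exponentialGap

/-! ### Deciding `e ^ M ≤ n` by a partial sum of the exponential series -/

/-- The numerator of the partial sum `∑ i ≤ T, M ^ i / i!` over the denominator `T!`. -/
def taylorNum (M : ℕ) : ℕ → ℕ
  | 0 => 1
  | T + 1 => taylorNum M T * (T + 1) + M ^ (T + 1)

theorem cast_taylorNum (M T : ℕ) :
    (taylorNum M T : ℝ) = T.factorial * ∑ i ∈ Finset.range (T + 1), (M : ℝ) ^ i / i.factorial := by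
  induction T with
  | zero => simp [taylorNum]
  | succ T ih =>
    rw [taylorNum, Finset.sum_range_succ, Nat.factorial_succ]
    push_cast
    rw [ih]
    have : (0 : ℝ) < T.factorial := by exact_mod_cast T.factorial_pos
    field_simp

/-- Weighting the tail by powers of c: c^T times the tail at M is at most the tail at cM, hence at
most exp(cM). -/
theorem exp_sub_sum_le {M : ℝ} (hM : 0 ≤ M) {c : ℝ} (hc : 1 ≤ c) (T : ℕ) :
    Real.exp M - ∑ i ∈ Finset.range T, M ^ i / i.factorial ≤ Real.exp (c * M) / c ^ T := by
  have hs : ∀ x : ℝ, Summable fun i : ℕ => x ^ i / i.factorial := Real.summable_pow_div_factorial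
  have he : ∀ x : ℝ, Real.exp x = ∑' i : ℕ, x ^ i / i.factorial := fun x => by
    rw [Real.exp_eq_exp_ℝ, NormedSpace.exp_eq_tsum_div]
  have h1 := (hs M).sum_add_tsum_nat_add T
  have h2 := (hs (c * M)).sum_add_tsum_nat_add T
  rw [← he] at h1 h2
  have h3 : 0 ≤ ∑ i ∈ Finset.range T, (c * M) ^ i / i.factorial :=
    Finset.sum_nonneg fun i _ => by positivity
  have h4 : c ^ T * ∑' i : ℕ, M ^ (i + T) / (i + T).factorial ≤
      ∑' i : ℕ, (c * M) ^ (i + T) / (i + T).factorial := by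
    rw [← tsum_mul_left]
    refine Summable.tsum_le_tsum (fun i => ?_)
      (((summable_nat_add_iff T).2 (hs M)).mul_left _) ((summable_nat_add_iff T).2 (hs (c * M)))
    rw [mul_pow, ← mul_div_assoc]
    gcongr
    omega
  have h5 : Real.exp M - ∑ i ∈ Finset.range T, M ^ i / i.factorial =
      ∑' i : ℕ, M ^ (i + T) / (i + T).factorial := by linarith
  rw [le_div_iff₀ (by positivity), h5, mul_comm]
  linarith

/-- With M = (m+1)^4 one has exp(M) > n, and the excess is at least exp(-O(M^4)). The series tail is
at most exp(eM - n - 1), which is smaller because n ≥ exp(m^4) exceeds every multiple of M^4 =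
(m+1)^16 in the long run. -/
theorem eventually_natCast_lt_taylorNum : ∀ᶠ n : ℕ in atTop,
    n * n.factorial < taylorNum ((cycleLength n + 1) ^ 4) n := by
  filter_upwards [tendsto_cycleLength.eventually (eventually_mul_pow_le_exp 1000 16),
    eventually_ge_atTop 1, tendsto_cycleLength.eventually (eventually_ge_atTop 1)] with n hn hn1 hm1
  set m := cycleLength n with hm
  set M := (m + 1) ^ 4 with hM
  have hM1 : 1 ≤ M := Nat.one_le_pow _ _ (by omega)
  have hM1' : (1 : ℝ) ≤ M := by exact_mod_cast hM1
  have hlt : (n : ℝ) < Real.exp M := by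
    have h := (le_cycleLength_iff hn1 (m + 1)).not.1 (by omega)
    push Not at h
    rw [hM]
    exact_mod_cast h
  -- As 9 ≥ e^2, the bound (9M^2)^p/p! ≤ exp(9M^2) = e^p gives M^(2p)/p! ≤ e^p/9^p ≤ e^(-p), and p ≥
  -- 2M + 1 then yields the hypothesis of the gap estimate.
  set p := 9 * M ^ 2 with hp
  have hpR : (p : ℝ) = 9 * (M : ℝ) ^ 2 := by rw [hp]; push_cast; ring
  have hexp2 : Real.exp 2 ≤ 9 := by
    have h1 := Real.exp_one_lt_d9
    have h2 : Real.exp 2 = Real.exp 1 * Real.exp 1 := by rw [← Real.exp_add]; norm_num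
    have h3 := Real.exp_pos 1
    nlinarith
  have hle : ∀ x : ℝ, x ≤ Real.exp x := fun x => by linarith [Real.add_one_le_exp x]
  have hhalf : Real.exp M * (M * (M : ℝ) ^ (2 * p)) / p.factorial ≤ 1 / 2 := by
    have h1 : ((9 : ℝ) * (M : ℝ) ^ 2) ^ p / p.factorial ≤ Real.exp (9 * (M : ℝ) ^ 2) :=
      Real.pow_div_factorial_le_exp _ (by positivity) p
    have h2 : Real.exp (2 * p) ≤ 9 ^ p := by
      rw [mul_comm, Real.exp_nat_mul]; gcongr
    have h3 : (M : ℝ) ^ (2 * p) / p.factorial ≤ Real.exp (-p) := by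
      rw [pow_mul]
      have h4 : ((M : ℝ) ^ 2) ^ p / p.factorial =
          ((9 : ℝ) * (M : ℝ) ^ 2) ^ p / p.factorial / 9 ^ p := by
        rw [mul_pow]; field_simp
      rw [h4, div_le_iff₀ (by positivity)]
      calc _ ≤ Real.exp (9 * (M : ℝ) ^ 2) := h1
        _ = Real.exp (-p) * Real.exp (2 * p) := by rw [← Real.exp_add, hpR]; ring_nf
        _ ≤ _ := by gcongr
    calc Real.exp M * (M * (M : ℝ) ^ (2 * p)) / p.factorial =
          Real.exp M * M * ((M : ℝ) ^ (2 * p) / p.factorial) := by ring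
      _ ≤ Real.exp M * Real.exp M * Real.exp (-p) := by gcongr; exact hle _
      _ = Real.exp (2 * M - p) := by rw [← Real.exp_add, ← Real.exp_add]; ring_nf
      _ ≤ Real.exp (-1) := by
          apply Real.exp_le_exp.2
          rw [hpR]
          nlinarith
      _ ≤ 1 / 2 := by
          rw [Real.exp_neg, inv_eq_one_div]
          apply one_div_le_one_div_of_le (by norm_num)
          linarith [Real.add_one_le_exp 1]
  have hgap := exp_sub_natCast_ge hM1 hlt hhalf
  have htail := exp_sub_sum_le (M := (M : ℝ)) (by positivity) (c := Real.exp 1)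
    (Real.one_le_exp (by norm_num)) (n + 1)
  have hN : (16 : ℝ) ^ p * 2 * ((2 * p + 1).factorial * (2 * M) ^ p) ≤
      Real.exp (16 * p + 2 + ((2 * p + 1) * (2 * p + 1) + 2 * M * p)) := by
    rw [Real.exp_add, Real.exp_add, Real.exp_add]
    have e1 : (16 : ℝ) ^ p ≤ Real.exp (16 * p) := by
      rw [mul_comm (16 : ℝ), Real.exp_nat_mul]; gcongr; exact hle _
    have e2 : ((2 * p + 1).factorial : ℝ) ≤ Real.exp ((2 * p + 1) * (2 * p + 1)) := by
      have : ((2 * p + 1).factorial : ℝ) ≤ ((2 * p + 1 : ℕ) : ℝ) ^ (2 * p + 1) := by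
        exact_mod_cast Nat.factorial_le_pow _
      refine this.trans ?_
      have h3 : ((2 : ℝ) * p + 1) * (2 * p + 1) = ((2 * p + 1 : ℕ) : ℝ) * (2 * p + 1) := by
        push_cast; ring
      rw [h3, Real.exp_nat_mul]
      gcongr
      push_cast
      exact hle _
    have e3 : ((2 : ℝ) * M) ^ p ≤ Real.exp (2 * M * p) := by
      rw [mul_comm ((2 : ℝ) * M) p, Real.exp_nat_mul]
      gcongr
      exact hle _
    gcongr
    exact hle 2
  have hnexp : 1000 * ((m : ℝ) + 1) ^ 16 ≤ n := by
    refine hn.trans (le_trans ?_ (exp_cycleLength_le hn1))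
    apply Real.exp_le_exp.2
    have : (1 : ℝ) ≤ m := by exact_mod_cast hm1
    exact le_self_pow₀ this (by norm_num)
  have hMm : ((m : ℝ) + 1) ^ 16 = (M : ℝ) ^ 4 := by
    rw [hM]; push_cast; ring
  rw [hMm] at hnexp
  -- The leading exponent is 4p^2 = 324M^4; with the lower terms it stays below the 1000M^4
  -- guaranteed by n.
  have hlast : Real.exp (Real.exp 1 * M) / Real.exp 1 ^ (n + 1) <
      (1 / 16 : ℝ) ^ p / 2 / ((2 * p + 1).factorial * (2 * M) ^ p) := by
    have h1 : (1 / 16 : ℝ) ^ p / 2 / ((2 * p + 1).factorial * (2 * M) ^ p) =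
        1 / ((16 : ℝ) ^ p * 2 * ((2 * p + 1).factorial * (2 * M) ^ p)) := by
      rw [one_div_pow]; field_simp
    rw [h1]
    refine lt_of_lt_of_le ?_ (one_div_le_one_div_of_le (by positivity) hN)
    rw [← Real.exp_nat_mul, mul_one, ← Real.exp_sub, one_div, ← Real.exp_neg]
    apply Real.exp_lt_exp.2
    push_cast
    have h2 := Real.exp_one_lt_d9
    have h3 : Real.exp 1 * M ≤ 3 * M := by gcongr; linarith
    rw [hpR]
    have p2 : (M : ℝ) ^ 2 ≤ (M : ℝ) ^ 4 := pow_le_pow_right₀ hM1' (by norm_num)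
    have p3 : (M : ℝ) ^ 3 ≤ (M : ℝ) ^ 4 := pow_le_pow_right₀ hM1' (by norm_num)
    have p1 : (M : ℝ) ≤ (M : ℝ) ^ 4 := le_self_pow₀ hM1' (by norm_num)
    have p0 : (1 : ℝ) ≤ (M : ℝ) ^ 4 := one_le_pow₀ hM1'
    nlinarith
  have hfin : (n : ℝ) < ∑ i ∈ Finset.range (n + 1), (M : ℝ) ^ i / i.factorial := by linarith
  have hfac : (0 : ℝ) < n.factorial := by exact_mod_cast n.factorial_pos
  have : ((n * n.factorial : ℕ) : ℝ) < taylorNum M n := by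
    rw [cast_taylorNum]
    push_cast
    nlinarith
  exact_mod_cast this

theorem taylorNum_le_of_le_cycleLength {n j : ℕ} (hn : 1 ≤ n) (hj : j ≤ cycleLength n) :
    taylorNum (j ^ 4) n ≤ n * n.factorial := by
  have h1 := (le_cycleLength_iff hn j).1 hj
  have h2 := Real.sum_le_exp_of_nonneg (x := (j : ℝ) ^ 4) (by positivity) (n + 1)
  have h3 : (taylorNum (j ^ 4) n : ℝ) ≤ ((n * n.factorial : ℕ) : ℝ) := by
    rw [cast_taylorNum]
    push_cast
    rw [mul_comm]
    gcongr
    exact h2.trans h1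
  exact_mod_cast h3

/-! ### A program logic for the random access machine -/

namespace RAM

@[simp] theorem State.reg_setReg (s : State) (i v j : ℕ) :
    (s.setReg i v).reg j = if j = i then v else s.reg j := by
  simp [State.setReg, Function.update_apply]

@[simp] theorem State.mem_setReg (s : State) (i v : ℕ) : (s.setReg i v).mem = s.mem := rfl

@[simp] theorem State.reg_setMem (s : State) (i v : ℕ) : (s.setMem i v).reg = s.reg := rfl

@[simp] theorem State.mem_setMem (s : State) (i v j : ℕ) :
    (s.setMem i v).mem j = if j = i then v else s.mem j := by
  simp [State.setMem, Function.update_apply]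

/-- The registers that a program may overwrite. -/
def Prog.writes : Prog → List ℕ
  | .skip => []
  | .const i _ => [i]
  | .op _ i _ _ => [i]
  | .load i _ => [i]
  | .store _ _ => []
  | .seq P Q => P.writes ++ Q.writes
  | .ifLt _ _ P Q => P.writes ++ Q.writes
  | .whileLt _ _ P => P.writes

/-- The program has no `store` instruction. -/
def Prog.storeFree : Prog → Bool
  | .skip => true
  | .const _ _ => true
  | .op _ _ _ _ => true
  | .load _ _ => true
  | .store _ _ => false
  | .seq P Q => P.storeFree && Q.storeFree
  | .ifLt _ _ P Q => P.storeFree && Q.storeFree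
  | .whileLt _ _ P => P.storeFree

theorem Exec.reg_eq {P : Prog} {s s' : State} {t : ℕ} (h : Exec P s s' t) {r : ℕ}
    (hr : r ∉ P.writes) : s'.reg r = s.reg r := by
  induction h with
  | skip | store | whileFalse => rfl
  | const | op | load =>
    simp only [Prog.writes, List.mem_singleton] at hr
    simp [hr]
  | seq _ _ ih₁ ih₂ =>
    simp only [Prog.writes, List.mem_append, not_or] at hr
    rw [ih₂ hr.2, ih₁ hr.1]
  | ifTrue _ _ ih =>
    simp only [Prog.writes, List.mem_append, not_or] at hr
    exact ih hr.1
  | ifFalse _ _ ih =>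
    simp only [Prog.writes, List.mem_append, not_or] at hr
    exact ih hr.2
  | whileTrue _ _ _ ih₁ ih₂ => rw [ih₂ hr, ih₁ hr]

theorem Exec.mem_eq {P : Prog} {s s' : State} {t : ℕ} (h : Exec P s s' t)
    (hP : P.storeFree = true) : s'.mem = s.mem := by
  induction h with
  | skip | whileFalse | const | op | load => rfl
  | store => simp [Prog.storeFree] at hP
  | seq _ _ ih₁ ih₂ =>
    simp only [Prog.storeFree, Bool.and_eq_true] at hP
    rw [ih₂ hP.2, ih₁ hP.1]
  | ifTrue _ _ ih =>
    simp only [Prog.storeFree, Bool.and_eq_true] at hP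
    exact ih hP.1
  | ifFalse _ _ ih =>
    simp only [Prog.storeFree, Bool.and_eq_true] at hP
    exact ih hP.2
  | whileTrue _ _ _ ih₁ ih₂ => rw [ih₂ hP, ih₁ hP]

/-- All numbers in the state have at most `B` bits. -/
def Bdd (B : ℕ) (s : State) : Prop := (∀ i, s.reg i < 2 ^ B) ∧ ∀ i, s.mem i < 2 ^ B

/-- Started in the state `s`, if its numbers have at most `B` bits, the program halts after a number
of steps and in a state related by `Q`, and all numbers on the way have at most `B` bits. -/
def wp (B : ℕ) (P : Prog) (s : State) (Q : State → ℕ → Prop) : Prop :=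
  Bdd B s → ∃ s' t k, Exec P s s' t ∧ Bdd B s' ∧ t ≤ k * (3 * B + 1) ∧ Q s' k

theorem wp_mono {B : ℕ} {P : Prog} {s : State} {Q Q' : State → ℕ → Prop} (h : wp B P s Q)
    (hQ : ∀ s' k, Q s' k → Q' s' k) : wp B P s Q' := by
  intro hs
  obtain ⟨s', t, k, h₁, h₂, h₃, h₄⟩ := h hs
  exact ⟨s', t, k, h₁, h₂, h₃, hQ _ _ h₄⟩

/-- Frame rule: registers that a subprogram does not name as targets persist, so specifications need
to mention only results. -/
theorem wp_frame {B : ℕ} {P : Prog} {s : State} {Q Q' : State → ℕ → Prop} (h : wp B P s Q)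
    (hQ : ∀ s' k, Q s' k → (∀ r, r ∉ P.writes → s'.reg r = s.reg r) →
      (P.storeFree = true → s'.mem = s.mem) → Q' s' k) : wp B P s Q' := by
  intro hs
  obtain ⟨s', t, k, h₁, h₂, h₃, h₄⟩ := h hs
  exact ⟨s', t, k, h₁, h₂, h₃, hQ _ _ h₄ (fun r hr => h₁.reg_eq hr) h₁.mem_eq⟩

theorem Bdd.setReg {B : ℕ} {s : State} (hs : Bdd B s) {i v : ℕ} (hv : v < 2 ^ B) :
    Bdd B (s.setReg i v) := by
  refine ⟨fun j => ?_, hs.2⟩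
  rw [State.reg_setReg]
  split_ifs
  · exact hv
  · exact hs.1 j

theorem Bdd.setMem {B : ℕ} {s : State} (hs : Bdd B s) {i v : ℕ} (hv : v < 2 ^ B) :
    Bdd B (s.setMem i v) := by
  refine ⟨hs.1, fun j => ?_⟩
  rw [State.mem_setMem]
  split_ifs
  · exact hv
  · exact hs.2 j

/-- The condition under which the result of an operation on numbers of at most `B` bits has at most
`B` bits. -/
def Op.Fits (B : ℕ) : Op → ℕ → ℕ → Prop
  | .add, x, y => x + y < 2 ^ B
  | .mul, x, y => x * y < 2 ^ B
  | .sub, _, _ => True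
  | .div, _, _ => True

theorem Op.eval_lt {B : ℕ} {o : Op} {x y : ℕ} (hx : x < 2 ^ B) (h : o.Fits B x y) :
    o.eval x y < 2 ^ B := by
  cases o with
  | add => exact h
  | mul => exact h
  | sub => exact (Nat.sub_le _ _).trans_lt hx
  | div => exact (Nat.div_le_self _ _).trans_lt hx

/-- A sufficient condition for `wp`, by recursion on the program down to its loops. -/
def vc (B : ℕ) : Prog → State → (State → ℕ → Prop) → Prop
  | .skip, s, Q => Q s 1
  | .const i c, s, Q => c < 2 ^ B ∧ Q (s.setReg i c) 1
  | .op o i j l, s, Q =>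
    o.Fits B (s.reg j) (s.reg l) ∧ Q (s.setReg i (o.eval (s.reg j) (s.reg l))) 1
  | .load i j, s, Q => Q (s.setReg i (s.mem (s.reg j))) 1
  | .store i j, s, Q => Q (s.setMem (s.reg i) (s.reg j)) 1
  | .seq P R, s, Q => vc B P s fun s₁ k₁ => vc B R s₁ fun s₂ k₂ => Q s₂ (k₁ + k₂)
  | .ifLt i j P R, s, Q =>
    if s.reg i < s.reg j then vc B P s fun s' k => Q s' (1 + k)
    else vc B R s fun s' k => Q s' (1 + k)
  | .whileLt i j P, s, Q => wp B (.whileLt i j P) s Q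

theorem wp_seq {B : ℕ} {P R : Prog} {s : State} {Q : State → ℕ → Prop}
    (h : wp B P s fun s₁ k₁ => wp B R s₁ fun s₂ k₂ => Q s₂ (k₁ + k₂)) : wp B (.seq P R) s Q := by
  intro hs
  obtain ⟨s₁, t₁, k₁, e₁, b₁, c₁, h₁⟩ := h hs
  obtain ⟨s₂, t₂, k₂, e₂, b₂, c₂, h₂⟩ := h₁ b₁
  exact ⟨s₂, _, _, .seq e₁ e₂, b₂, by rw [add_mul]; omega, h₂⟩

/-- An elementary step handles at most three numbers of at most B bits, hence the price 3B + 1 per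
step. Loops remain as `wp` conditions, to be met by invariants. -/
theorem wp_of_vc {B : ℕ} {P : Prog} {s : State} {Q : State → ℕ → Prop} (h : vc B P s Q) :
    wp B P s Q := by
  induction P generalizing s Q with
  | skip =>
    intro hs
    exact ⟨s, _, 1, .skip s, hs, by omega, h⟩
  | const i c =>
    intro hs
    have := Nat.size_le.2 h.1
    exact ⟨_, _, 1, .const s i c, hs.setReg h.1, by omega, h.2⟩
  | op o i j l =>
    intro hs
    have h₁ := Op.eval_lt (hs.1 j) h.1
    have := Nat.size_le.2 h₁
    have := Nat.size_le.2 (hs.1 j)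
    have := Nat.size_le.2 (hs.1 l)
    exact ⟨_, _, 1, .op s o i j l, hs.setReg h₁, by omega, h.2⟩
  | load i j =>
    intro hs
    have := Nat.size_le.2 (hs.1 j)
    have := Nat.size_le.2 (hs.2 (s.reg j))
    exact ⟨_, _, 1, .load s i j, hs.setReg (hs.2 _), by omega, h⟩
  | store i j =>
    intro hs
    have := Nat.size_le.2 (hs.1 j)
    have := Nat.size_le.2 (hs.1 i)
    exact ⟨_, _, 1, .store s i j, hs.setMem (hs.1 _), by omega, h⟩
  | seq P R ihP ihR => exact wp_seq (wp_mono (ihP h) fun s' k h' => ihR h')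
  | ifLt i j P R ihP ihR =>
    intro hs
    have := Nat.size_le.2 (hs.1 j)
    have := Nat.size_le.2 (hs.1 i)
    simp only [vc] at h
    split_ifs at h with hlt
    · obtain ⟨s', t, k, e, b, c, h'⟩ := ihP h hs
      exact ⟨s', _, 1 + k, .ifTrue hlt e, b, by rw [add_mul]; omega, h'⟩
    · obtain ⟨s', t, k, e, b, c, h'⟩ := ihR h hs
      exact ⟨s', _, 1 + k, .ifFalse hlt e, b, by rw [add_mul]; omega, h'⟩
  | whileLt i j P _ => exact h

/-- The rule for counting loops: `while reg i < reg j do (P; reg i := reg i + 1)`. -/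
theorem wp_for {B i j o c : ℕ} {P : Prog} {s₀ : State} (Inv : ℕ → State → Prop)
    (hi : i ∉ P.writes) (hj : j ∉ P.writes) (ho : o ∉ P.writes) (hij : j ≠ i) (hio : o ≠ i)
    (hone : s₀.reg o = 1) (hzero : s₀.reg i = 0) (h₀ : Inv 0 s₀)
    (step : ∀ x < s₀.reg j, ∀ s, (∀ r, r ∉ P.writes → r ≠ i → s.reg r = s₀.reg r) →
      (P.storeFree = true → s.mem = s₀.mem) → s.reg i = x → Inv x s →
      wp B P s fun s' k => k ≤ c ∧ Inv (x + 1) (s'.setReg i (x + 1))) :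
    wp B (.whileLt i j (.seq P (.op .add i i o))) s₀ fun s' k =>
      Inv (s₀.reg j) s' ∧ (∀ r, r ∉ P.writes → r ≠ i → s'.reg r = s₀.reg r) ∧
        (P.storeFree = true → s'.mem = s₀.mem) ∧ k ≤ s₀.reg j * (c + 2) + 1 := by
  -- Induction on the number d of rounds that remain. A round costs the body, the test and the
  -- increment; the 1 at the end is the failing test.
  suffices H : ∀ d x s, x + d = s₀.reg j → (∀ r, r ∉ P.writes → r ≠ i → s.reg r = s₀.reg r) →
      (P.storeFree = true → s.mem = s₀.mem) → s.reg i = x → Inv x s →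
      wp B (.whileLt i j (.seq P (.op .add i i o))) s fun s' k =>
        Inv (s₀.reg j) s' ∧ (∀ r, r ∉ P.writes → r ≠ i → s'.reg r = s₀.reg r) ∧
          (P.storeFree = true → s'.mem = s₀.mem) ∧ k ≤ d * (c + 2) + 1 from
    H _ 0 s₀ (zero_add _) (fun _ _ _ => rfl) (fun _ => rfl) hzero h₀
  intro d
  induction d with
  | zero =>
    intro x s hx hfr hmem hsi hinv hs
    have hsj := hfr j hj hij
    have := Nat.size_le.2 (hs.1 j)
    have := Nat.size_le.2 (hs.1 i)
    refine ⟨s, _, 1, .whileFalse (by omega), hs, by omega, ?_, hfr, hmem, by omega⟩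
    rwa [← hx, add_zero]
  | succ d ih =>
    intro x s hx hfr hmem hsi hinv hs
    have hsj := hfr j hj hij
    have hlt : s.reg i < s.reg j := by omega
    have hsizej := Nat.size_le.2 (hs.1 j)
    have hsizei := Nat.size_le.2 (hs.1 i)
    obtain ⟨s₁, t₁, k₁, e₁, b₁, c₁, hk₁, hinv₁⟩ := step x (by omega) s hfr hmem hsi hinv hs
    have e₁i := e₁.reg_eq hi
    have e₁o : s₁.reg o = 1 := by rw [e₁.reg_eq ho, hfr o ho hio, hone]
    have hval : Op.add.eval (s₁.reg i) (s₁.reg o) = x + 1 := by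
      rw [e₁i, e₁o, hsi]; rfl
    have hval' : x + 1 < 2 ^ B := lt_of_le_of_lt (by omega) (hs.1 j)
    have e₂ := Exec.op s₁ .add i i o
    rw [hval] at e₂
    obtain ⟨s₃, t₃, k₃, e₃, b₃, c₃, h₃⟩ := ih (x + 1) (s₁.setReg i (x + 1)) (by omega)
      (fun r hr hri => by
        rw [State.reg_setReg, if_neg hri, e₁.reg_eq hr, hfr r hr hri])
      (fun hP => by rw [State.mem_setReg, e₁.mem_eq hP, hmem hP])
      (by simp) hinv₁ (b₁.setReg hval')
    have q₁ := Nat.size_le.2 (b₁.1 i)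
    have q₂ := Nat.size_le.2 (b₁.1 o)
    have q₃ := Nat.size_le.2 hval'
    refine ⟨s₃, _, k₁ + k₃ + 2, .whileTrue hlt (.seq e₁ e₂) e₃, b₃, ?_, h₃.1, h₃.2.1, h₃.2.2.1, ?_⟩
    · have : (k₁ + k₃ + 2) * (3 * B + 1) =
        k₁ * (3 * B + 1) + k₃ * (3 * B + 1) + (6 * B + 2) := by ring
      omega
    · have := h₃.2.2.2
      have : (d + 1) * (c + 2) = d * (c + 2) + c + 2 := by ring
      omega

end RAM

/-! ### Computing the cycle length -/

namespace RAM

infixr:60 ";;" => Prog.seq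

/-- One step of the summation of the exponential series: register `11` holds the numerator of the
partial sum, register `12` the power, register `13` the factorial. -/
def taylorBody : Prog :=
  .op .add 15 14 4 ;; .op .mul 11 11 15 ;; .op .mul 12 12 10 ;; .op .add 11 11 12 ;;
  .op .mul 13 13 15

theorem taylorNum_le (M T : ℕ) : taylorNum M T ≤ (M + T + 1) ^ T := by
  induction T with
  | zero => simp [taylorNum]
  | succ T ih =>
    have h1 : (M + T + 1) ^ T ≤ (M + (T + 1) + 1) ^ T := Nat.pow_le_pow_left (by omega) T
    have h2 : M ^ T ≤ (M + (T + 1) + 1) ^ T := Nat.pow_le_pow_left (by omega) T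
    rw [taylorNum, pow_succ, pow_succ]
    calc taylorNum M T * (T + 1) + M ^ T * M
        ≤ (M + (T + 1) + 1) ^ T * (T + 1) + (M + (T + 1) + 1) ^ T * M := by
          gcongr
          exact ih.trans h1
      _ ≤ (M + (T + 1) + 1) ^ T * (M + (T + 1) + 1) := by
          rw [← mul_add]
          exact Nat.mul_le_mul_left _ (by omega)

theorem wp_taylor {B n M : ℕ} {s : State} (h0 : s.reg 0 = n) (h4 : s.reg 4 = 1)
    (h10 : s.reg 10 = M) (h11 : s.reg 11 = 1) (h12 : s.reg 12 = 1) (h13 : s.reg 13 = 1)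
    (h14 : s.reg 14 = 0) (hB : (M + n + 1) ^ n < 2 ^ B) :
    wp B (.whileLt 14 0 (taylorBody ;; .op .add 14 14 4)) s fun s' k =>
      (s'.reg 11 = taylorNum M n ∧ s'.reg 13 = n.factorial) ∧ k ≤ n * 7 + 1 := by
  refine wp_mono (wp_for (c := 5) (fun x s => s.reg 11 = taylorNum M x ∧ s.reg 12 = M ^ x ∧
    s.reg 13 = x.factorial) (by decide) (by decide) (by decide) (by decide) (by decide) h4 h14
    ⟨h11, by simpa using h12, by simpa using h13⟩ ?_) ?_
  · intro x hx s' hfr _ hsi ⟨i11, i12, i13⟩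
    have g4 : s'.reg 4 = 1 := by rw [hfr 4 (by decide) (by decide), h4]
    have g10 : s'.reg 10 = M := by rw [hfr 10 (by decide) (by decide), h10]
    rw [h0] at hx
    have hbase : (M + (x + 1) + 1) ^ (x + 1) ≤ (M + n + 1) ^ n :=
      (Nat.pow_le_pow_left (by omega) _).trans (Nat.pow_le_pow_right (by omega) hx)
    have b1 : taylorNum M (x + 1) < 2 ^ B := ((taylorNum_le M (x + 1)).trans hbase).trans_lt hB
    have b2 : M ^ (x + 1) < 2 ^ B :=
      ((Nat.pow_le_pow_left (by omega) _).trans hbase).trans_lt hB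
    have b3 : (x + 1).factorial < 2 ^ B :=
      ((Nat.factorial_le_pow _).trans ((Nat.pow_le_pow_left (by omega) _).trans hbase)).trans_lt hB
    have b4 : x + 1 < 2 ^ B := lt_of_le_of_lt (Nat.self_le_factorial _) b3
    have e1 : taylorNum M (x + 1) = taylorNum M x * (x + 1) + M ^ x * M := by
      rw [taylorNum, pow_succ]
    have e2 : (x + 1).factorial = x.factorial * (x + 1) := by
      rw [Nat.factorial_succ, mul_comm]
    rw [pow_succ] at b2
    have b5 : taylorNum M x * (x + 1) < 2 ^ B := by omega
    apply wp_of_vc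
    simp [taylorBody, vc, Op.Fits, Op.eval, g4, g10, hsi, i11, i12, i13, b2, b3, b4, b5, ← e1, b1,
      ← e2, pow_succ]
  · rintro s' k ⟨⟨h1, h2, h3⟩, h4, h5, h6⟩
    rw [h0] at h1 h3 h6
    exact ⟨⟨h1, h3⟩, h6⟩

/-- Replace the number `m` in register `6` by `m + 1` if the partial sum of the exponential series
at `(m + 1) ^ 4` is at most `n`. -/
def searchBody : Prog :=
  .op .add 9 6 4 ;; .op .mul 10 9 9 ;; .op .mul 10 10 10 ;; .const 11 1 ;; .const 12 1 ;;
  .const 13 1 ;; .const 14 0 ;; .whileLt 14 0 (taylorBody ;; .op .add 14 14 4) ;;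
  -- Throughout, register `4` holds 1 and register `5` holds 0, so that adding register `5` copies.
  -- The partial sum is compared with n after multiplication by n!.
  .op .mul 16 0 13 ;; .ifLt 16 11 .skip (.op .add 6 9 5)

/-- Compute the cycle length in register `6`. -/
def searchProg : Prog :=
  .const 6 0 ;; .const 17 0 ;; .whileLt 17 0 (searchBody ;; .op .add 17 17 4)

/-- The content of register `6` after `y` steps of the search. -/
def searchLen (n : ℕ) : ℕ → ℕ
  | 0 => 0
  | y + 1 => if n * n.factorial < taylorNum ((searchLen n y + 1) ^ 4) n then searchLen n y
    else searchLen n y + 1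

theorem searchLen_le (n y : ℕ) : searchLen n y ≤ y := by
  induction y with
  | zero => simp [searchLen]
  | succ y ih => rw [searchLen]; split_ifs <;> omega

/-- The test passes up to L and fails at L + 1, so the counter climbs to L and stays there. Nothing
is needed about the test beyond L + 1. -/
theorem searchLen_eq_min {n L : ℕ} (h₁ : ∀ j ≤ L, taylorNum (j ^ 4) n ≤ n * n.factorial)
    (h₂ : n * n.factorial < taylorNum ((L + 1) ^ 4) n) (y : ℕ) : searchLen n y = min y L := by
  induction y with
  | zero => simp [searchLen]
  | succ y ih =>
    rw [searchLen, ih]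
    rcases lt_or_ge y L with hy | hy
    · rw [min_eq_left hy.le, min_eq_left (by omega : y + 1 ≤ L), if_neg]
      exact not_lt.2 (h₁ _ (by omega))
    · rw [min_eq_right hy, min_eq_right (by omega : L ≤ y + 1), if_pos h₂]

theorem eventually_searchLen_eq : ∀ᶠ n : ℕ in atTop, searchLen n n = cycleLength n := by
  filter_upwards [eventually_natCast_lt_taylorNum, eventually_ge_atTop 1] with n hn hn1
  rw [searchLen_eq_min (fun j hj => taylorNum_le_of_le_cycleLength hn1 hj) hn, min_eq_right]
  have h1 := exp_cycleLength_le hn1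
  have h2 : (cycleLength n : ℝ) ≤ n := by
    have h3 : ((cycleLength n : ℕ) : ℝ) ≤ (cycleLength n : ℝ) ^ 4 := by
      exact_mod_cast Nat.le_self_pow (by norm_num) (cycleLength n)
    linarith [Real.add_one_le_exp ((cycleLength n : ℝ) ^ 4)]
  exact_mod_cast h2

theorem wp_search {B n : ℕ} {s : State} (h0 : s.reg 0 = n) (h4 : s.reg 4 = 1) (h5 : s.reg 5 = 0)
    (hB : ((n + 1) ^ 4 + n + 1) ^ (n + 1) < 2 ^ B) :
    wp B searchProg s fun s' k => s'.reg 6 = searchLen n n ∧ k ≤ n * (n * 7 + 13) + 3 := by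
  have hB1 : 1 < 2 ^ B := by
    refine lt_of_le_of_lt ?_ hB
    exact Nat.one_le_pow _ _ (by omega)
  have hB0 : 0 < 2 ^ B := by omega
  apply wp_of_vc
  simp only [searchProg, vc, hB0, true_and]
  refine wp_mono (wp_for (c := n * 7 + 11) (fun y s => s.reg 6 = searchLen n y) (by decide)
    (by decide) (by decide) (by decide) (by decide) (by simp [h4]) (by simp)
    (by simp [searchLen]) ?_) ?_
  · intro y hy s' hfr _ _ i6
    have g0 : s'.reg 0 = n := by rw [hfr 0 (by decide) (by decide)]; simp [h0]
    have g4 : s'.reg 4 = 1 := by rw [hfr 4 (by decide) (by decide)]; simp [h4]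
    have g5 : s'.reg 5 = 0 := by rw [hfr 5 (by decide) (by decide)]; simp [h5]
    have hy' : y < n := by simpa [h0] using hy
    set m := searchLen n y with hm
    have hmy : m ≤ y := searchLen_le n y
    have hM : (m + 1) ^ 4 ≤ (n + 1) ^ 4 := Nat.pow_le_pow_left (by omega) 4
    have hV : (n + 1) ^ 4 + n + 1 < 2 ^ B :=
      lt_of_le_of_lt (Nat.le_self_pow (by omega) _) hB
    have e4 : (m + 1) * (m + 1) * ((m + 1) * (m + 1)) = (m + 1) ^ 4 := by ring
    have b2 : (m + 1) * (m + 1) < 2 ^ B := by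
      have : (m + 1) * (m + 1) ≤ (m + 1) ^ 4 := by
        rw [← e4]; exact Nat.le_mul_of_pos_right _ (by positivity)
      omega
    have b3 : n * n.factorial < 2 ^ B := by
      refine lt_of_le_of_lt ?_ hB
      rw [pow_succ, mul_comm]
      gcongr
      · exact (Nat.factorial_le_pow n).trans (Nat.pow_le_pow_left (by omega) n)
      · omega
    apply wp_of_vc
    simp only [searchBody, vc, Op.Fits, Op.eval, State.reg_setReg, g4, i6, hB0, hB1, true_and]
    simp only [Nat.reduceEqDiff, if_true, if_false, e4]
    refine ⟨by omega, b2, by omega, ?_⟩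
    refine wp_frame (wp_taylor (n := n) (M := (m + 1) ^ 4) (by simpa using g0) (by simpa using g4)
      (by simp) (by simp) (by simp) (by simp) (by simp) ?_) ?_
    · refine lt_of_le_of_lt ?_ hB
      exact (Nat.pow_le_pow_left (by omega) _).trans (Nat.pow_le_pow_right (by omega) (by omega))
    · rintro s'' k ⟨⟨h11, h13⟩, hk⟩ hfr' -
      have f0 : s''.reg 0 = n := by rw [hfr' 0 (by decide)]; simp [g0]
      have f5 : s''.reg 5 = 0 := by rw [hfr' 5 (by decide)]; simp [g5]
      have f6 : s''.reg 6 = m := by rw [hfr' 6 (by decide)]; simp [i6]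
      have f9 : s''.reg 9 = m + 1 := by rw [hfr' 9 (by decide)]; simp
      refine ⟨by rw [f0, h13]; exact b3, ?_⟩
      have hs : searchLen n (y + 1) =
          if n * n.factorial < taylorNum ((m + 1) ^ 4) n then m else m + 1 := rfl
      simp only [f0, h11, h13, hs]
      split_ifs with hlt
      · simp [f6]
        omega
      · simp [f9, f5]
        omega
  · rintro s' k ⟨h1, -, -, h6⟩
    simp [h0] at h1 h6
    refine ⟨h1, ?_⟩
    have : n * (n * 7 + 11 + 2) = n * (n * 7 + 13) := by ring
    omega

/-! ### Counting the edges -/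

/-- Add up the first `n ^ 2` array cells. -/
def edgeProg : Prog :=
  .op .mul 20 0 0 ;; .const 21 0 ;; .const 22 0 ;;
  .whileLt 22 20 ((.load 23 22 ;; .op .add 21 21 23) ;; .op .add 22 22 4)

theorem wp_edge {B n : ℕ} {s : State} (h0 : s.reg 0 = n) (h4 : s.reg 4 = 1)
    (hmem : ∀ i, s.mem i ≤ 1) (hB : n * n < 2 ^ B) :
    wp B edgeProg s fun s' k => (s'.reg 20 = n * n ∧
      s'.reg 21 = ∑ i ∈ Finset.range (n * n), s.mem i) ∧ k ≤ n * n * 4 + 4 := by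
  have hB0 : 0 < 2 ^ B := by positivity
  apply wp_of_vc
  simp only [edgeProg, vc, Op.Fits, Op.eval, h0, hB, hB0, true_and]
  refine wp_mono (wp_for (c := 2) (fun x s' => s'.reg 21 = ∑ i ∈ Finset.range x, s.mem i)
    (by decide) (by decide) (by decide) (by decide) (by decide) (by simp [h4]) (by simp)
    (by simp) ?_) ?_
  · intro x hx s' hfr hm hsi h21
    have hx' : x < n * n := by simpa using hx
    have hmem' : s'.mem = s.mem := by rw [hm (by decide)]; rfl
    have hsum : ∑ i ∈ Finset.range x, s.mem i + s.mem x < 2 ^ B := by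
      rw [← Finset.sum_range_succ]
      refine lt_of_le_of_lt ((Finset.sum_le_sum fun i _ => hmem i).trans ?_) hB
      simpa using hx'
    apply wp_of_vc
    simp [vc, Op.Fits, Op.eval, hsi, h21, hmem', hsum, Finset.sum_range_succ]
  · rintro s' k ⟨h1, h2, -, h3⟩
    simp at h1 h3
    refine ⟨⟨?_, h1⟩, by omega⟩
    rw [h2 20 (by decide) (by decide)]
    simp

/-! ### Powers -/

/-- Compute `2 ^ k`, `n ^ m`, the `m`-th power of register `21`, and `2 ^ (k m)`. -/
def powProg : Prog :=
  .const 41 1 ;; .const 42 0 ;; .whileLt 42 1 (.op .add 41 41 41 ;; .op .add 42 42 4) ;;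
  .const 43 1 ;; .const 44 1 ;; .const 45 1 ;; .const 46 0 ;;
  .whileLt 46 6 ((.op .mul 43 43 0 ;; .op .mul 44 44 21 ;; .op .mul 45 45 41) ;; .op .add 46 46 4)

theorem wp_pow {B n m k E : ℕ} {s : State} (h0 : s.reg 0 = n) (h1 : s.reg 1 = k)
    (h4 : s.reg 4 = 1) (h6 : s.reg 6 = m) (h21 : s.reg 21 = E) (hk : 2 ^ k < 2 ^ B)
    (hn : (n + 1) ^ m < 2 ^ B) (hE : (E + 1) ^ m < 2 ^ B) (hkm : (2 ^ k) ^ m < 2 ^ B) :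
    wp B powProg s fun s' t => (s'.reg 41 = 2 ^ k ∧ s'.reg 43 = n ^ m ∧ s'.reg 44 = E ^ m ∧
      s'.reg 45 = (2 ^ k) ^ m) ∧ t ≤ k * 3 + m * 5 + 8 := by
  have hB0 : 0 < 2 ^ B := by positivity
  have hB1 : 1 < 2 ^ B := lt_of_le_of_lt Nat.one_le_two_pow hk
  apply wp_of_vc
  simp only [powProg, vc, hB0, hB1, true_and]
  refine wp_mono (wp_for (c := 1) (fun x s' => s'.reg 41 = 2 ^ x)
    (by decide) (by decide) (by decide) (by decide) (by decide) (by simp [h4]) (by simp)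
    (by simp) ?_) ?_
  · intro x hx s' hfr _ hsi h41
    have hx' : x < k := by simpa [h1] using hx
    have e : 2 ^ x + 2 ^ x = 2 ^ (x + 1) := by rw [pow_succ]; ring
    have hlt : 2 ^ (x + 1) < 2 ^ B :=
      lt_of_le_of_lt (Nat.pow_le_pow_right (by norm_num) hx') hk
    apply wp_of_vc
    simp [vc, Op.Fits, Op.eval, h41, e, hlt]
  · rintro s₁ k₁ ⟨g41, hfr, -, hk₁⟩
    simp only [State.reg_setReg, if_false, h1, OfNat.one_ne_ofNat] at g41 hk₁
    have f : ∀ r, r ≠ 41 → r ≠ 42 → s₁.reg r = s.reg r := by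
      intro r hr hr'
      rw [hfr r (by simpa [Prog.writes] using hr) hr']
      simp [hr, hr']
    have f0 := f 0 (by decide) (by decide)
    have f4 := f 4 (by decide) (by decide)
    have f6 := f 6 (by decide) (by decide)
    have f21 := f 21 (by decide) (by decide)
    rw [h0] at f0
    rw [h4] at f4
    rw [h6] at f6
    rw [h21] at f21
    refine wp_mono (wp_for (c := 3) (fun x s' => s'.reg 43 = n ^ x ∧ s'.reg 44 = E ^ x ∧
      s'.reg 45 = (2 ^ k) ^ x) (by decide) (by decide) (by decide) (by decide) (by decide)
      (by simp [f4]) (by simp) (by simp) ?_) ?_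
    · rintro x hx s' hfr' - hsi ⟨g43, g44, g45⟩
      have hx' : x < m := by simpa [f6] using hx
      have q0 : s'.reg 0 = n := by rw [hfr' 0 (by decide) (by decide)]; simp [f0]
      have q21 : s'.reg 21 = E := by rw [hfr' 21 (by decide) (by decide)]; simp [f21]
      have q41 : s'.reg 41 = 2 ^ k := by rw [hfr' 41 (by decide) (by decide)]; simp [g41]
      have b1 : n ^ x * n < 2 ^ B := by
        rw [← pow_succ]
        exact lt_of_le_of_lt ((Nat.pow_le_pow_left (by omega) _).trans
          (Nat.pow_le_pow_right (by omega) hx')) hn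
      have b2 : E ^ x * E < 2 ^ B := by
        rw [← pow_succ]
        exact lt_of_le_of_lt ((Nat.pow_le_pow_left (by omega) _).trans
          (Nat.pow_le_pow_right (by omega) hx')) hE
      have b3 : (2 ^ k) ^ x * 2 ^ k < 2 ^ B := by
        rw [← pow_succ]
        exact lt_of_le_of_lt (Nat.pow_le_pow_right (by positivity) hx') hkm
      apply wp_of_vc
      simp [vc, Op.Fits, Op.eval, q0, q21, q41, g43, g44, g45, b1, b2, b3, pow_succ]
    · rintro s₂ k₂ ⟨⟨g43, g44, g45⟩, hfr₂, -, hk₂⟩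
      simp only [State.reg_setReg, Nat.reduceEqDiff, if_false, f6] at g43 g44 g45 hk₂
      refine ⟨⟨?_, g43, g44, g45⟩, by omega⟩
      rw [hfr₂ 41 (by decide) (by decide)]
      simp [g41]

/-! ### Extracting the root -/

/-- One bisection step. -/
def bisectBody : Prog :=
  .op .add 53 49 4 ;; .ifLt 53 50
    (.op .add 54 49 50 ;; .op .div 54 54 40 ;; .op .add 55 43 5 ;; .const 56 0 ;;
      .whileLt 56 6 (.op .mul 55 55 54 ;; .op .add 56 56 4) ;;
      .ifLt 48 55 (.op .add 50 54 5) (.op .add 49 54 5))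
    .skip

/-- From the number of labelled cycles in register `28` and the powers, approximate the root and
move the results to their registers. -/
def rootProg : Prog :=
  -- Truncated subtraction turns a negative radicand into 0. The bisection starts from 0 and A · 2^k
  -- + 1, where A is the radicand times n^m, and lasts 2n^2 + k rounds.
  .op .mul 47 28 43 ;; .op .sub 47 47 44 ;; .op .mul 48 47 45 ;; .const 49 0 ;;
  .op .mul 50 47 41 ;; .op .add 50 50 4 ;; .op .add 51 20 20 ;; .op .add 51 51 1 ;;
  .const 40 2 ;; .const 52 0 ;; .whileLt 52 51 (bisectBody ;; .op .add 52 52 4) ;;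
  .op .add 2 49 5 ;; .op .add 3 41 5 ;; .op .add 1 0 5 ;; .op .add 0 21 5

/-- `lo` and `hi` enclose the `m`-th root of `X / D` after `x` steps of bisection, which started
with `0` and `H + 1`. -/
structure Encloses (D X m H x lo hi : ℕ) : Prop where
  lt : lo < hi
  le : hi ≤ H + 1
  width : (hi - lo - 1) * 2 ^ x ≤ H
  bounds : 1 ≤ m → 1 ≤ D → D * lo ^ m ≤ X ∧ X < D * hi ^ m

/-- The excess width hi - lo - 1, unlike the width itself, is at least halved in both halves despite
the rounding of the midpoint. -/
theorem Encloses.mid {D X m H x lo hi : ℕ} (h : Encloses D X m H x lo hi) (hlt : lo + 1 < hi) :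
    if X < D * ((lo + hi) / 2) ^ m then Encloses D X m H (x + 1) lo ((lo + hi) / 2)
    else Encloses D X m H (x + 1) ((lo + hi) / 2) hi := by
  obtain ⟨h1, h2, h3, h4⟩ := h
  have key : ∀ w, 2 * w ≤ hi - lo - 1 → w * 2 ^ (x + 1) ≤ H := by
    intro w hw
    calc w * 2 ^ (x + 1) = 2 * w * 2 ^ x := by rw [pow_succ]; ring
      _ ≤ (hi - lo - 1) * 2 ^ x := Nat.mul_le_mul_right _ hw
      _ ≤ H := h3
  split_ifs with hX
  · exact ⟨by omega, by omega, key _ (by omega), fun hm hD => ⟨(h4 hm hD).1, hX⟩⟩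
  · exact ⟨by omega, by omega, key _ (by omega), fun hm hD => ⟨not_lt.1 hX, (h4 hm hD).2⟩⟩

theorem Encloses.result {D X m H x lo hi : ℕ} (h : Encloses D X m H x lo hi) (hlt : ¬ lo + 1 < hi) :
    Encloses D X m H (x + 1) lo hi := by
  obtain ⟨h1, h2, h3, h4⟩ := h
  refine ⟨h1, h2, ?_, h4⟩
  have : hi - lo - 1 = 0 := by omega
  simp [this]

theorem wp_bisect {B D X m H x lo hi : ℕ} {s : State} (h4 : s.reg 4 = 1) (h5 : s.reg 5 = 0)
    (h6 : s.reg 6 = m) (h40 : s.reg 40 = 2) (h43 : s.reg 43 = D) (h48 : s.reg 48 = X)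
    (h49 : s.reg 49 = lo) (h50 : s.reg 50 = hi) (henc : Encloses D X m H x lo hi)
    (hB : 2 * (H + 1) < 2 ^ B) (hB' : D * (H + 1) ^ m < 2 ^ B) :
    wp B bisectBody s fun s' k => k ≤ m * 3 + 9 ∧
      Encloses D X m H (x + 1) (s'.reg 49) (s'.reg 50) := by
  have hB0 : 0 < 2 ^ B := by positivity
  have hlt := henc.lt
  have hle := henc.le
  apply wp_of_vc
  simp only [bisectBody, vc, Op.Fits, Op.eval, State.reg_setReg, Nat.reduceEqDiff, if_true,
    if_false, h49, h50, h4, h40, h43, h5, hB0, true_and]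
  refine ⟨by omega, ?_⟩
  split_ifs with hgap
  · have hmid : (lo + hi) / 2 ≤ H + 1 := by omega
    have hpow : ∀ y ≤ m, D * ((lo + hi) / 2) ^ y < 2 ^ B := by
      intro y hy
      refine lt_of_le_of_lt (Nat.mul_le_mul_left D ?_) hB'
      exact (Nat.pow_le_pow_left hmid y).trans (Nat.pow_le_pow_right (by omega) hy)
    refine ⟨by omega, by simpa using hpow 0 (by omega), ?_⟩
    refine wp_mono (wp_for (c := 1) (fun y s' => s'.reg 55 = D * ((lo + hi) / 2) ^ y)
      (by decide) (by decide) (by decide) (by decide) (by decide) (by simp [h4]) (by simp)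
      (by simp) ?_) ?_
    · intro y hy s' hfr _ hsi g55
      have hy' : y < m := by simpa [h6] using hy
      have q54 : s'.reg 54 = (lo + hi) / 2 := by rw [hfr 54 (by decide) (by decide)]; simp
      have b := hpow (y + 1) hy'
      rw [pow_succ] at b
      apply wp_of_vc
      simp [vc, Op.Fits, Op.eval, g55, q54, b, pow_succ, mul_assoc]
    · rintro s₁ k₁ ⟨g55, hfr, -, hk₁⟩
      simp only [State.reg_setReg, Nat.reduceEqDiff, if_false, h6] at g55 hk₁
      have q54 : s₁.reg 54 = (lo + hi) / 2 := by rw [hfr 54 (by decide) (by decide)]; simp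
      have q48 : s₁.reg 48 = X := by rw [hfr 48 (by decide) (by decide)]; simp [h48]
      have q49 : s₁.reg 49 = lo := by rw [hfr 49 (by decide) (by decide)]; simp [h49]
      have q50 : s₁.reg 50 = hi := by rw [hfr 50 (by decide) (by decide)]; simp [h50]
      have q5 : s₁.reg 5 = 0 := by rw [hfr 5 (by decide) (by decide)]; simp [h5]
      have hm := henc.mid hgap
      rw [q48, g55, q54, q5]
      split_ifs with hX
      · rw [if_pos hX] at hm
        refine ⟨by omega, by omega, ?_⟩
        simpa [q49] using hm
      · rw [if_neg hX] at hm
        refine ⟨by omega, by omega, ?_⟩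
        simpa [q50] using hm
  · refine ⟨by omega, ?_⟩
    simpa [h49, h50] using henc.result hgap

theorem wp_root {B n m k E c : ℕ} {s : State} (h0 : s.reg 0 = n) (h1 : s.reg 1 = k)
    (h4 : s.reg 4 = 1) (h5 : s.reg 5 = 0) (h6 : s.reg 6 = m) (h20 : s.reg 20 = n * n)
    (h21 : s.reg 21 = E) (h28 : s.reg 28 = c) (h41 : s.reg 41 = 2 ^ k) (h43 : s.reg 43 = n ^ m)
    (h44 : s.reg 44 = E ^ m) (h45 : s.reg 45 = (2 ^ k) ^ m) (hW : n * n + n * n + k < 2 ^ B)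
    (hn : n < 2 ^ B) (hE : E < 2 ^ B)
    (hB : (n + 1) ^ m * (2 * (c * n ^ m * 2 ^ k + 2 ^ k + 1)) ^ (m + 1) < 2 ^ B) :
    wp B rootProg s fun s' t =>
      (s'.reg 0 = E ∧ s'.reg 1 = n ∧ s'.reg 3 = 2 ^ k ∧
        (1 ≤ m → 1 ≤ n → (c * n ^ m - E ^ m) * 2 ^ k < 2 ^ (n * n + n * n + k) →
          n ^ m * s'.reg 2 ^ m ≤ (c * n ^ m - E ^ m) * (2 ^ k) ^ m ∧
          (c * n ^ m - E ^ m) * (2 ^ k) ^ m < n ^ m * (s'.reg 2 + 1) ^ m)) ∧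
      t ≤ (n * n + n * n + k) * (m * 3 + 11) + 20 := by
  set A := c * n ^ m - E ^ m with hA
  set V := c * n ^ m * 2 ^ k + 2 ^ k + 1 with hV
  have hk1 : 1 ≤ 2 ^ k := Nat.one_le_two_pow
  have hAc : A ≤ c * n ^ m := Nat.sub_le _ _
  have hcV : c * n ^ m ≤ V := by
    have : c * n ^ m ≤ c * n ^ m * 2 ^ k := Nat.le_mul_of_pos_right _ hk1
    omega
  have hAkV : A * 2 ^ k + 1 ≤ V := by
    have : A * 2 ^ k ≤ c * n ^ m * 2 ^ k := Nat.mul_le_mul_right _ hAc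
    omega
  have hV1 : 1 ≤ V := by omega
  have hn1 : 1 ≤ (n + 1) ^ m := Nat.one_le_pow _ _ (by omega)
  have hVB : (2 * V) ^ (m + 1) < 2 ^ B :=
    lt_of_le_of_lt (Nat.le_mul_of_pos_left _ hn1) hB
  have h2V : 2 * V < 2 ^ B := lt_of_le_of_lt (Nat.le_self_pow (by omega) _) hVB
  have hVm : V ^ (m + 1) < 2 ^ B :=
    lt_of_le_of_lt (Nat.pow_le_pow_left (by omega) _) hVB
  have hX : A * (2 ^ k) ^ m < 2 ^ B := by
    refine lt_of_le_of_lt ?_ hVm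
    rw [pow_succ, mul_comm]
    exact Nat.mul_le_mul (Nat.pow_le_pow_left (by omega) _) (by omega)
  have hD : n ^ m * (A * 2 ^ k + 1) ^ m < 2 ^ B := by
    refine lt_of_le_of_lt ?_ hB
    refine Nat.mul_le_mul (Nat.pow_le_pow_left (by omega) _) ?_
    exact (Nat.pow_le_pow_left (by omega) _).trans (Nat.pow_le_pow_right (by omega) (by omega))
  have hB0 : 0 < 2 ^ B := by positivity
  apply wp_of_vc
  simp only [rootProg, vc, Op.Fits, Op.eval, State.reg_setReg, Nat.reduceEqDiff, if_true,
    if_false, OfNat.one_ne_ofNat, h1, h4, h20, h28, h41, h43, h44, h45, hB0, true_and, ← hA]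
  refine ⟨by omega, hX, by omega, by omega, by omega, hW, by omega, ?_⟩
  refine wp_mono (wp_for (c := m * 3 + 9) (fun x s' =>
    Encloses (n ^ m) (A * (2 ^ k) ^ m) m (A * 2 ^ k) x (s'.reg 49) (s'.reg 50))
    (by decide) (by decide) (by decide) (by decide) (by decide) (by simp [h4]) (by simp) ?_ ?_) ?_
  · refine ⟨by simp, by simp, by simp, fun hm hD => ?_⟩
    simp only [State.reg_setReg, Nat.reduceEqDiff, if_true, if_false]
    refine ⟨by rw [zero_pow (by omega)]; simp, ?_⟩
    refine lt_of_lt_of_le ?_ (Nat.le_mul_of_pos_left _ hD)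
    rcases Nat.eq_zero_or_pos A with hA0 | hA0
    · rw [hA0]
      simp
    · calc A * (2 ^ k) ^ m ≤ A ^ m * (2 ^ k) ^ m :=
            Nat.mul_le_mul_right _ (Nat.le_self_pow (by omega) _)
        _ = (A * 2 ^ k) ^ m := by rw [mul_pow]
        _ < (A * 2 ^ k + 1) ^ m := Nat.pow_lt_pow_left (by omega) (by omega)
  · intro x hx s' hfr _ hsi henc
    refine wp_mono (wp_bisect (s := s') (D := n ^ m) (X := A * (2 ^ k) ^ m) (H := A * 2 ^ k)
      (x := x) ?_ ?_ ?_ ?_ ?_ ?_ rfl rfl henc (by omega) hD) ?_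
    · rw [hfr 4 (by decide) (by decide)]; simp [h4]
    · rw [hfr 5 (by decide) (by decide)]; simp [h5]
    · rw [hfr 6 (by decide) (by decide)]; simp [h6]
    · rw [hfr 40 (by decide) (by decide)]; simp
    · rw [hfr 43 (by decide) (by decide)]; simp [h43]
    · rw [hfr 48 (by decide) (by decide)]; simp
    · rintro s'' t ⟨ht, henc'⟩
      exact ⟨ht, by simpa using henc'⟩
  · rintro s' t ⟨henc, hfr, -, ht⟩
    simp only [State.reg_setReg, Nat.reduceEqDiff, if_true, if_false, Nat.reduceAdd,
      add_assoc (m * 3)] at henc ht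
    have q0 : s'.reg 0 = n := by rw [hfr 0 (by decide) (by decide)]; simp [h0]
    have q5 : s'.reg 5 = 0 := by rw [hfr 5 (by decide) (by decide)]; simp [h5]
    have q21 : s'.reg 21 = E := by rw [hfr 21 (by decide) (by decide)]; simp [h21]
    have q41 : s'.reg 41 = 2 ^ k := by rw [hfr 41 (by decide) (by decide)]; simp [h41]
    have hlo := henc.lt
    have hhi := henc.le
    simp only [q0, q5, q21, q41, add_zero]
    refine ⟨by omega, by omega, hn, hE, ⟨trivial, trivial, trivial, ?_⟩, by omega⟩
    intro hm hn0 hw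
    have hwidth := henc.width
    -- An excess of at least 1 times 2^(number of rounds) would exceed the initial A · 2^k, so the
    -- enclosure has shrunk to consecutive integers.
    have hz : s'.reg 50 = s'.reg 49 + 1 := by
      by_contra hne
      have h1 : 1 ≤ s'.reg 50 - s'.reg 49 - 1 := by omega
      have h2 := Nat.mul_le_mul_right (2 ^ (n * n + n * n + k)) h1
      omega
    have hb := henc.bounds hm (Nat.one_le_pow _ _ hn0)
    rwa [hz] at hb

/-! ### Counting the cycles by a depth first search -/

/-- A self-avoiding walk, given by its ends, the set of its vertices as a bit mask, and the number
of its vertices. -/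
structure Node where
  first : ℕ
  last : ℕ
  mask : ℕ
  len : ℕ

/-- The array holds the given stack, top first, from the address `base` on. -/
def StackAt (mem : ℕ → ℕ) (base : ℕ) : List Node → Prop
  | [] => True
  | w :: st => mem (base + 4 * st.length) = w.first ∧ mem (base + 4 * st.length + 1) = w.last ∧
      mem (base + 4 * st.length + 2) = w.mask ∧ mem (base + 4 * st.length + 3) = w.len ∧
      StackAt mem base st

theorem StackAt.congr {mem mem' : ℕ → ℕ} {base : ℕ} {st : List Node}
    (h : ∀ i < base + 4 * st.length, mem' i = mem i) (hst : StackAt mem base st) :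
    StackAt mem' base st := by
  induction st with
  | nil => trivial
  | cons w st ih =>
    simp only [List.length_cons] at h
    obtain ⟨h1, h2, h3, h4, h5⟩ := hst
    refine ⟨?_, ?_, ?_, ?_, ih (fun i hi => h i (by omega)) h5⟩
    · rw [h _ (by omega), h1]
    · rw [h _ (by omega), h2]
    · rw [h _ (by omega), h3]
    · rw [h _ (by omega), h4]

/-- Push a node on the stack. -/
def push (a b c d : ℕ) : Prog :=
  .store 24 a ;; .op .add 24 24 4 ;; .store 24 b ;; .op .add 24 24 4 ;;
  .store 24 c ;; .op .add 24 24 4 ;; .store 24 d ;; .op .add 24 24 4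

theorem vc_push {B base a b c d : ℕ} {s : State} {st : List Node} {Q : State → ℕ → Prop}
    (w : Node)
    (h24 : s.reg 24 = base + 4 * st.length) (h4 : s.reg 4 = 1) (hst : StackAt s.mem base st)
    (ha : s.reg a = w.first) (hb : s.reg b = w.last) (hc : s.reg c = w.mask) (hd : s.reg d = w.len)
    (hb' : b ≠ 24) (hc' : c ≠ 24) (hd' : d ≠ 24) (hB : base + 4 * (st.length + 1) < 2 ^ B)
    (hQ : ∀ s', s'.reg 24 = base + 4 * (w :: st).length → (∀ r ≠ 24, s'.reg r = s.reg r) →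
      StackAt s'.mem base (w :: st) → (∀ i < base, s'.mem i = s.mem i) → Q s' 8) :
    vc B (push a b c d) s Q := by
  simp only [push, vc, Op.Fits, Op.eval, State.reg_setReg, State.reg_setMem, Nat.reduceEqDiff,
    if_true, if_false, hb', hc', hd', h24, h4, ha, hb, hc, hd]
  refine ⟨by omega, by omega, by omega, by omega, hQ _ ?_ ?_ ?_ ?_⟩
  · simp only [State.reg_setReg, if_true, List.length_cons]; omega
  · intro r hr
    simp [hr]
  · simp only [StackAt, State.mem_setReg, State.mem_setMem]
    refine ⟨?_, ?_, ?_, ?_, hst.congr ?_⟩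
    · split_ifs <;> first | rfl | omega
    · split_ifs <;> first | rfl | omega
    · split_ifs <;> first | rfl | omega
    · simp
    · intro i hi
      simp only [State.mem_setReg, State.mem_setMem]
      split_ifs <;> first | rfl | omega
  · intro i hi
    simp only [State.mem_setReg, State.mem_setMem]
    split_ifs <;> first | rfl | omega

/-- The nodes that consist of one vertex less than `v`. -/
def roots : ℕ → List Node
  | 0 => []
  | v + 1 => ⟨v, v, 2 ^ v, 1⟩ :: roots v

theorem length_roots (v : ℕ) : (roots v).length = v := by
  induction v with
  | zero => rfl
  | succ v ih => simp [roots, ih]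

theorem sum_map_roots (g : Node → ℕ) (v : ℕ) :
    ((roots v).map g).sum = ∑ u ∈ Finset.range v, g ⟨u, u, 2 ^ u, 1⟩ := by
  induction v with
  | zero => rfl
  | succ v ih => rw [roots, List.map_cons, List.sum_cons, ih, Finset.sum_range_succ, add_comm]

/-- Push all nodes that consist of one vertex. -/
def rootsProg : Prog :=
  .op .add 24 20 5 ;; .const 25 1 ;; .const 26 0 ;;
  .whileLt 26 0 ((push 26 26 25 4 ;; .op .add 25 25 25) ;; .op .add 26 26 4)

theorem wp_roots {B n : ℕ} {s : State} (h0 : s.reg 0 = n) (h4 : s.reg 4 = 1) (h5 : s.reg 5 = 0)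
    (h20 : s.reg 20 = n * n) (hB : n * n + 4 * (n + 1) < 2 ^ B) (hB' : 2 ^ n < 2 ^ B) :
    wp B rootsProg s fun s' k => (s'.reg 24 = n * n + 4 * (roots n).length ∧
      StackAt s'.mem (n * n) (roots n) ∧ ∀ i < n * n, s'.mem i = s.mem i) ∧ k ≤ n * 11 + 4 := by
  have hB0 : 0 < 2 ^ B := by positivity
  apply wp_of_vc
  simp only [rootsProg, vc, Op.Fits, Op.eval, h20, h5, add_zero, hB0, true_and]
  refine ⟨by omega, by omega, ?_⟩
  refine wp_mono (wp_for (c := 9) (fun v s' => (s'.reg 24 = n * n + 4 * (roots v).length ∧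
    StackAt s'.mem (n * n) (roots v) ∧ ∀ i < n * n, s'.mem i = s.mem i) ∧ s'.reg 25 = 2 ^ v)
    (by decide) (by decide) (by decide) (by decide) (by decide) (by simp [h4]) (by simp)
    (by simp [roots, StackAt]) ?_) ?_
  · rintro v hv s' hfr - hsi ⟨⟨g24, gst, gmem⟩, g25⟩
    have hv' : v < n := by simpa [h0] using hv
    have q4 : s'.reg 4 = 1 := by rw [hfr 4 (by decide) (by decide)]; simp [h4]
    have e : 2 ^ v + 2 ^ v = 2 ^ (v + 1) := by rw [pow_succ]; ring
    have hlt : 2 ^ (v + 1) < 2 ^ B :=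
      lt_of_le_of_lt (Nat.pow_le_pow_right (by norm_num) hv') hB'
    apply wp_of_vc
    simp only [vc]
    refine vc_push (B := B) ⟨v, v, 2 ^ v, 1⟩ g24 q4 gst hsi hsi g25 q4 (by decide) (by decide)
      (by decide) (by rw [length_roots]; omega) fun s'' f24 hfr' fst fmem => ?_
    have f25 : s''.reg 25 = 2 ^ v := by rw [hfr' 25 (by decide), g25]
    simp only [Op.Fits, Op.eval, f25, e, hlt, true_and, State.reg_setReg, State.mem_setReg,
      Nat.reduceEqDiff, if_true, if_false, and_true]
    exact ⟨by omega, f24, fst, fun i hi => by rw [fmem i hi, gmem i hi]⟩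
  · rintro s' k ⟨⟨h1, -⟩, -, -, hk⟩
    simp only [State.reg_setReg, OfNat.zero_ne_ofNat, if_false, h0] at h1 hk
    exact ⟨h1, by omega⟩

/-- The extensions of the node `w` by a neighbour of its last vertex that is less than `v` and does
not lie on the walk. -/
def kids (adj : ℕ → ℕ → ℕ) (w : Node) : ℕ → List Node
  | 0 => []
  | v + 1 => if w.mask.testBit v = false ∧ 0 < adj w.last v then
      ⟨w.first, v, w.mask + 2 ^ v, w.len + 1⟩ :: kids adj w v else kids adj w v

theorem length_kids_le (adj : ℕ → ℕ → ℕ) (w : Node) (v : ℕ) : (kids adj w v).length ≤ v := by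
  induction v with
  | zero => simp [kids]
  | succ v ih =>
    rw [kids]
    split_ifs
    · simpa using ih
    · omega

theorem sum_map_kids (adj : ℕ → ℕ → ℕ) (w : Node) (g : Node → ℕ) (v : ℕ) :
    ((kids adj w v).map g).sum = ∑ u ∈ Finset.range v,
      if w.mask.testBit u = false ∧ 0 < adj w.last u then
        g ⟨w.first, u, w.mask + 2 ^ u, w.len + 1⟩ else 0 := by
  induction v with
  | zero => rfl
  | succ v ih =>
    rw [kids, Finset.sum_range_succ, ← ih]
    split_ifs
    · rw [List.map_cons, List.sum_cons, add_comm]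
    · rw [add_zero]

/-- The bounds on the nodes on the stack. -/
structure Node.Valid (n : ℕ) (w : Node) : Prop where
  first : w.first < n
  last : w.last < n
  -- This crude bound passes to extensions without any appeal to the bits being distinct.
  mask : w.mask ≤ w.len * 2 ^ n

theorem valid_roots {n : ℕ} : ∀ v ≤ n, ∀ w ∈ roots v, w.Valid n := by
  intro v
  induction v with
  | zero => simp [roots]
  | succ v ih =>
    intro hv w hw
    rcases List.mem_cons.1 hw with rfl | hw
    · refine ⟨hv, hv, ?_⟩
      rw [one_mul]
      exact Nat.pow_le_pow_right (by norm_num) (by omega)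
    · exact ih (by omega) w hw

theorem valid_kids {n : ℕ} {adj : ℕ → ℕ → ℕ} {w : Node} (hw : w.Valid n) :
    ∀ v ≤ n, ∀ w' ∈ kids adj w v, w'.Valid n := by
  intro v
  induction v with
  | zero => simp [kids]
  | succ v ih =>
    intro hv w' hw'
    rw [kids] at hw'
    split_ifs at hw'
    · rcases List.mem_cons.1 hw' with rfl | hw'
      · refine ⟨hw.first, hv, ?_⟩
        rw [add_mul, one_mul]
        exact add_le_add hw.mask (Nat.pow_le_pow_right (by norm_num) (by omega))
      · exact ih (by omega) w' hw'
    · exact ih (by omega) w' hw'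

/-- Push the extension of the current node by the vertex in register `36`, if there is one. -/
def expandBody : Prog :=
  .op .add 37 34 36 ;; .load 37 37 ;; .op .div 38 31 35 ;; .op .div 39 38 40 ;;
  .op .add 39 39 39 ;;
  -- With q the mask divided by 2^v, the inequality 2⌊q/2⌋ < q says that q is odd, that is, that v
  -- already lies on the walk.
  .ifLt 39 38 .skip (.ifLt 5 37 (.op .add 57 31 35 ;; push 33 36 57 30) .skip) ;;
  .op .add 35 35 35

theorem wp_expand {B n m : ℕ} {s : State} {st : List Node} {w : Node} {adj : ℕ → ℕ → ℕ}
    (h0 : s.reg 0 = n) (h4 : s.reg 4 = 1) (h5 : s.reg 5 = 0) (h40 : s.reg 40 = 2)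
    (h24 : s.reg 24 = n * n + 4 * st.length) (hst : StackAt s.mem (n * n) st)
    (h30 : s.reg 30 = w.len + 1) (h31 : s.reg 31 = w.mask) (h33 : s.reg 33 = w.first)
    (h34 : s.reg 34 = w.last * n) (h35 : s.reg 35 = 1) (h36 : s.reg 36 = 0)
    (hw : w.Valid n) (hlen : w.len < m)
    (hadj : ∀ u < n, ∀ v < n, s.mem (u * n + v) = adj u v)
    (hB : n * n + 4 * (st.length + n) < 2 ^ B) (hB' : (m + 1) * 2 ^ n < 2 ^ B) :
    wp B (.whileLt 36 0 (expandBody ;; .op .add 36 36 4)) s fun s' k =>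
      (s'.reg 24 = n * n + 4 * (kids adj w n ++ st).length ∧
        StackAt s'.mem (n * n) (kids adj w n ++ st) ∧ ∀ i < n * n, s'.mem i = s.mem i) ∧
      k ≤ n * 22 + 1 := by
  refine wp_mono (wp_for (c := 20) (fun v s' =>
    (s'.reg 24 = n * n + 4 * (kids adj w v ++ st).length ∧
      StackAt s'.mem (n * n) (kids adj w v ++ st) ∧ ∀ i < n * n, s'.mem i = s.mem i) ∧
    s'.reg 35 = 2 ^ v)
    (by decide) (by decide) (by decide) (by decide) (by decide) h4 h36
    (by simp [kids, h24, hst, h35]) ?_) ?_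
  · rintro v hv s' hfr - hsi ⟨⟨g24, gst, gmem⟩, g35⟩
    have hv' : v < n := by simpa [h0] using hv
    have q4 : s'.reg 4 = 1 := by rw [hfr 4 (by decide) (by decide), h4]
    have q5 : s'.reg 5 = 0 := by rw [hfr 5 (by decide) (by decide), h5]
    have q30 : s'.reg 30 = w.len + 1 := by rw [hfr 30 (by decide) (by decide), h30]
    have q31 : s'.reg 31 = w.mask := by rw [hfr 31 (by decide) (by decide), h31]
    have q33 : s'.reg 33 = w.first := by rw [hfr 33 (by decide) (by decide), h33]
    have q34 : s'.reg 34 = w.last * n := by rw [hfr 34 (by decide) (by decide), h34]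
    have q40 : s'.reg 40 = 2 := by rw [hfr 40 (by decide) (by decide), h40]
    have hlast := hw.last
    have hidx : w.last * n + v < n * n := by
      calc w.last * n + v < w.last * n + n := by omega
        _ = (w.last + 1) * n := by ring
        _ ≤ n * n := Nat.mul_le_mul_right _ hlast
    have hcell : s'.mem (w.last * n + v) = adj w.last v := by
      rw [gmem _ hidx, hadj _ hlast _ hv']
    have hpow : 2 ^ (v + 1) ≤ 2 ^ n := Nat.pow_le_pow_right (by norm_num) hv'
    have e : 2 ^ v + 2 ^ v = 2 ^ (v + 1) := by rw [pow_succ]; ring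
    have hm2 : 2 ^ n ≤ (m + 1) * 2 ^ n := Nat.le_mul_of_pos_left _ (by omega)
    have hlt : 2 ^ (v + 1) < 2 ^ B := by omega
    have hmask : w.mask + 2 ^ v < 2 ^ B := by
      have h1 : (w.len + 1) * 2 ^ n ≤ (m + 1) * 2 ^ n := Nat.mul_le_mul_right _ (by omega)
      have h2 := hw.mask
      rw [add_mul, one_mul] at h1
      omega
    have hbit : (w.mask / 2 ^ v / 2 + w.mask / 2 ^ v / 2 < w.mask / 2 ^ v) ↔
        w.mask.testBit v = true := by
      rw [Nat.testBit_eq_decide_div_mod_eq, decide_eq_true_eq]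
      omega
    have hq : w.mask / 2 ^ v ≤ w.mask := Nat.div_le_self _ _
    have hkl := length_kids_le adj w v
    apply wp_of_vc
    simp only [expandBody, vc, Op.Fits, Op.eval, State.reg_setReg, State.mem_setReg,
      Nat.reduceEqDiff, if_true, if_false, true_and, Nat.succ_ne_self,
      q34, hsi, q31, g35, q40, q5, hcell, hbit]
    refine ⟨by omega, by omega, ?_⟩
    by_cases hb : w.mask.testBit v = true
    · rw [if_pos hb]
      have hk : kids adj w (v + 1) = kids adj w v := by
        rw [kids, if_neg]; simp [hb]
      simp only [e, hlt, true_and, hk, and_true]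
      exact ⟨by omega, g24, gst, gmem⟩
    · rw [if_neg hb]
      by_cases ha : 0 < adj w.last v
      · rw [if_pos ha]
        have hk : kids adj w (v + 1) = ⟨w.first, v, w.mask + 2 ^ v, w.len + 1⟩ :: kids adj w v := by
          rw [kids, if_pos]; exact ⟨by simpa using hb, ha⟩
        refine ⟨hmask, ?_⟩
        refine vc_push ⟨w.first, v, w.mask + 2 ^ v, w.len + 1⟩ (st := kids adj w v ++ st)
          (by simpa using g24) (by simpa using q4) (by simpa using gst) (by simpa using q33)
          (by simpa using hsi) (by simp) (by simpa using q30) (by decide) (by decide)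
          (by decide) (by rw [List.length_append]; omega) fun s'' f24 hfr' fst fmem => ?_
        have f35 : s''.reg 35 = 2 ^ v := by rw [hfr' 35 (by decide)]; simpa using g35
        simp only [f35, e, hlt, true_and, hk, and_true, List.cons_append]
        exact ⟨by omega, f24, fst, fun i hi => by rw [fmem i hi]; simpa using gmem i hi⟩
      · rw [if_neg ha]
        have hk : kids adj w (v + 1) = kids adj w v := by
          rw [kids, if_neg]; simp [ha]
        simp only [e, hlt, true_and, hk, and_true]
        exact ⟨by omega, g24, gst, gmem⟩
  · rintro s' k ⟨⟨h1, -⟩, -, -, hk⟩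
    rw [h0] at h1 hk
    exact ⟨h1, by omega⟩

/-- The sum of the weights `h` of the last vertices over all extensions by `r` vertices of a walk
that ends in `l` and whose vertices are the bits of `μ`. -/
def walkSum (n : ℕ) (adj : ℕ → ℕ → ℕ) (h : ℕ → ℕ) : ℕ → ℕ → ℕ → ℕ
  | 0, l, _ => h l
  | r + 1, l, μ => ∑ v ∈ Finset.range n, if μ.testBit v = false ∧ 0 < adj l v then
      walkSum n adj h r v (μ + 2 ^ v) else 0

/-- The number of self-avoiding extensions by at most `r` vertices. -/
def walkSize (n : ℕ) (adj : ℕ → ℕ → ℕ) : ℕ → ℕ → ℕ → ℕ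
  | 0, _, _ => 1
  | r + 1, l, μ => 1 + ∑ v ∈ Finset.range n, if μ.testBit v = false ∧ 0 < adj l v then
      walkSize n adj r v (μ + 2 ^ v) else 0

/-- Pop a node, and either push its extensions or add to the count of the cycles. -/
def dfsBody : Prog :=
  .ifLt 20 24
    (.op .sub 24 24 4 ;; .load 30 24 ;; .op .sub 24 24 4 ;; .load 31 24 ;;
      .op .sub 24 24 4 ;; .load 32 24 ;; .op .sub 24 24 4 ;; .load 33 24 ;; .op .mul 34 32 0 ;;
      .ifLt 30 6
        (.const 35 1 ;; .op .add 30 30 4 ;; .const 36 0 ;;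
          .whileLt 36 0 (expandBody ;; .op .add 36 36 4))
        (.op .add 34 34 33 ;; .load 37 34 ;; .op .add 28 28 37))
    .skip

/-- Count the cycles, processing at most `n * n` nodes. -/
def dfsProg : Prog :=
  .const 40 2 ;; rootsProg ;; .const 28 0 ;; .const 29 0 ;;
  .whileLt 29 20 (dfsBody ;; .op .add 29 29 4)

/-- The stack of the search after processing `x` nodes. -/
structure Search (n m : ℕ) (adj : ℕ → ℕ → ℕ) (total size : ℕ) (s₀ : State) (x : ℕ) (s : State)
    (st : List Node) : Prop where
  pointer : s.reg 24 = n * n + 4 * st.length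
  stack : StackAt s.mem (n * n) st
  input : ∀ i < n * n, s.mem i = s₀.mem i
  valid : ∀ w ∈ st, w.Valid n
  length : st.length ≤ n + x * n
  count : s.reg 28 ≤ x
  -- Conserved quantity: the cycles counted so far plus those still to be found below the nodes on
  -- the stack.
  total : s.reg 28 +
    (st.map fun w => walkSum n adj (adj · w.first) (m - w.len) w.last w.mask).sum = total
  -- The nodes processed plus those still to come are also conserved, until the stack is empty and
  -- the loop idles through the rest of its budget.
  size : st = [] ∨ x + (st.map fun w => walkSize n adj (m - w.len) w.last w.mask).sum = size

/-- Replacing a node by its extensions is one unfolding of `walkSum` and `walkSize`; a full-length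
walk contributes the entry of the adjacency matrix that closes it. -/
theorem wp_dfsBody {B n m x total size : ℕ} {s s₀ : State} {adj : ℕ → ℕ → ℕ}
    (h0 : s.reg 0 = n) (h4 : s.reg 4 = 1) (h5 : s.reg 5 = 0) (h6 : s.reg 6 = m)
    (h20 : s.reg 20 = n * n) (h40 : s.reg 40 = 2) (hx : x < n * n)
    (hadj : ∀ u < n, ∀ v < n, s₀.mem (u * n + v) = adj u v) (hone : ∀ u v, adj u v ≤ 1)
    (hB : n * n + 4 * (n + n * n * n) < 2 ^ B) (hB' : (m + 1) * 2 ^ n < 2 ^ B)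
    (hB2 : 2 * (n * n) < 2 ^ B)
    (h : ∃ st, Search n m adj total size s₀ x s st) :
    wp B dfsBody s fun s' k => k ≤ n * 22 + 20 ∧
      ∃ st, Search n m adj total size s₀ (x + 1) s' st := by
  obtain ⟨st, hst⟩ := h
  have hp := hst.pointer
  have hlen := hst.length
  have hmul : (x + 1) * n ≤ n * n * n := Nat.mul_le_mul_right _ hx
  rw [add_mul, one_mul] at hmul
  apply wp_of_vc
  cases st with
  | nil =>
    simp only [dfsBody, vc, h20, hp, List.length_nil, mul_zero, add_zero, lt_irrefl, if_false]
    exact ⟨by omega, [], hp, trivial, hst.input, hst.valid, by simp, hst.count.trans (by omega),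
      hst.total, Or.inl rfl⟩
  | cons w st =>
    obtain ⟨e1, e2, e3, e4, hst'⟩ := hst.stack
    have hw := hst.valid w (by simp)
    have hfirst := hw.first
    have hlast := hw.last
    have hsize := hst.size.resolve_left (by simp)
    have htot := hst.total
    have hcount := hst.count
    simp only [List.length_cons] at hp hlen
    simp only [List.map_cons, List.sum_cons] at hsize htot
    have hp' : s.reg 24 = n * n + 4 * st.length + 4 := by omega
    have hmul' : w.last * n + n ≤ n * n := by
      calc w.last * n + n = (w.last + 1) * n := by ring
        _ ≤ n * n := Nat.mul_le_mul_right _ hlast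
    have hlt : n * n < n * n + 4 * st.length + 4 := by omega
    simp only [dfsBody, vc, Op.Fits, Op.eval, State.reg_setReg, State.mem_setReg, Nat.reduceEqDiff,
      if_true, if_false, true_and, h20, hp', h4, h0, h6, hlt, Nat.add_one_sub_one,
      e1, e2, e3, e4, OfNat.zero_ne_ofNat]
    refine ⟨by omega, ?_⟩
    split_ifs with hl
    · have hm : m + 1 ≤ (m + 1) * 2 ^ n := Nat.le_mul_of_pos_right _ (by positivity)
      obtain ⟨r, hr⟩ : ∃ r, m - w.len = r + 1 := ⟨m - w.len - 1, by omega⟩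
      have hr' : m - (w.len + 1) = r := by omega
      refine ⟨by omega, by omega, by omega, ?_⟩
      refine wp_frame (wp_expand (n := n) (m := m) (st := st) (w := w) (adj := adj)
        (by simpa using h0) (by simpa using h4) (by simpa using h5) (by simpa using h40) (by simp)
        (by simpa using hst') (by simp) (by simp) (by simp) (by simp) (by simp) (by simp) hw hl
        ?_ (by omega) hB') ?_
      · intro u hu v hv
        have : u * n + v < n * n := by
          calc u * n + v < u * n + n := by omega
            _ = (u + 1) * n := by ring
            _ ≤ n * n := Nat.mul_le_mul_right _ hu
        rw [← hadj u hu v hv, ← hst.input _ this]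
        rfl
      · rintro s' k ⟨⟨g24, gst, gmem⟩, hk⟩ hfr -
        have g28 : s'.reg 28 = s.reg 28 := by rw [hfr 28 (by decide)]; simp
        refine ⟨by omega, kids adj w n ++ st, g24, gst, ?_, ?_, ?_, ?_, ?_, Or.inr ?_⟩
        · intro i hi
          rw [gmem i hi, ← hst.input i hi]
          rfl
        · intro w' hw'
          rcases List.mem_append.1 hw' with h' | h'
          · exact valid_kids hw n le_rfl w' h'
          · exact hst.valid w' (by simp [h'])
        · rw [List.length_append, add_mul, one_mul]
          have := length_kids_le adj w n
          omega
        · omega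
        · simp only [← htot, g28, List.map_append, List.sum_append, sum_map_kids, hr, hr', walkSum]
        · simp only [← hsize, List.map_append, List.sum_append, sum_map_kids, hr, hr', walkSize]
          ring
    · have hr : m - w.len = 0 := by omega
      have hcell : s.mem (w.last * n + w.first) = adj w.last w.first := by
        rw [hst.input _ (by omega), hadj _ hlast _ hfirst]
      have hle := hone w.last w.first
      rw [hr, walkSum] at htot
      rw [hr, walkSize] at hsize
      rw [hcell]
      refine ⟨by omega, by omega, by omega, st, ?_, ?_, ?_, ?_, ?_, ?_, ?_, Or.inr ?_⟩
      · simp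
      · exact hst'
      · exact hst.input
      · exact fun w' h' => hst.valid w' (by simp [h'])
      · rw [add_mul]; omega
      · simp; omega
      · simp; omega
      · omega

/-- The time bound is unconditional because the loop has n^2 rounds. If the search tree has at most
n^2 nodes, a node left on the stack would push the conserved size above n^2; hence the stack is
empty and the count complete. -/
theorem wp_dfs {B n m : ℕ} {s : State} {adj : ℕ → ℕ → ℕ}
    (h0 : s.reg 0 = n) (h4 : s.reg 4 = 1) (h5 : s.reg 5 = 0) (h6 : s.reg 6 = m)
    (h20 : s.reg 20 = n * n)
    (hadj : ∀ u < n, ∀ v < n, s.mem (u * n + v) = adj u v) (hone : ∀ u v, adj u v ≤ 1)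
    (hB : n * n + 4 * (n + n * n * n) + 4 < 2 ^ B) (hB' : (m + 1) * 2 ^ n < 2 ^ B) :
    wp B dfsProg s fun s' k => (s'.reg 28 ≤ n * n ∧
      (∑ v ∈ Finset.range n, walkSize n adj (m - 1) v (2 ^ v) ≤ n * n →
        s'.reg 28 = ∑ v ∈ Finset.range n, walkSum n adj (adj · v) (m - 1) v (2 ^ v))) ∧
      k ≤ n * n * (n * 22 + 20 + 2) + n * 11 + 8 := by
  have hm2 : 2 ^ n ≤ (m + 1) * 2 ^ n := Nat.le_mul_of_pos_left _ (by omega)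
  have hn3 : n ≤ n * n * n := by
    rcases Nat.eq_zero_or_pos n with rfl | hn
    · simp
    · rw [mul_assoc]; exact Nat.le_mul_of_pos_right _ (by positivity)
  have hn2 : n * n ≤ n * n * n := by
    rcases Nat.eq_zero_or_pos n with rfl | hn
    · simp
    · exact Nat.le_mul_of_pos_right _ hn
  have hB0 : 0 < 2 ^ B := by positivity
  refine wp_seq (wp_of_vc ?_)
  simp only [vc]
  refine ⟨by omega, wp_seq (wp_frame (wp_roots (n := n) (by simpa using h0) (by simpa using h4)
    (by simpa using h5) (by simpa using h20) (by omega) (by omega)) ?_)⟩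
  rintro s₁ k₁ ⟨⟨g24, gst, gmem⟩, hk₁⟩ hfr -
  have q0 : s₁.reg 0 = n := by rw [hfr 0 (by decide)]; simpa using h0
  have q4 : s₁.reg 4 = 1 := by rw [hfr 4 (by decide)]; simpa using h4
  have q5 : s₁.reg 5 = 0 := by rw [hfr 5 (by decide)]; simpa using h5
  have q6 : s₁.reg 6 = m := by rw [hfr 6 (by decide)]; simpa using h6
  have q20 : s₁.reg 20 = n * n := by rw [hfr 20 (by decide)]; simpa using h20
  have q40 : s₁.reg 40 = 2 := by rw [hfr 40 (by decide)]; simp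
  apply wp_of_vc
  simp only [vc, hB0, true_and]
  refine wp_mono (wp_for (c := n * 22 + 20) (fun x s' => ∃ st, Search n m adj
    (∑ v ∈ Finset.range n, walkSum n adj (adj · v) (m - 1) v (2 ^ v))
    (∑ v ∈ Finset.range n, walkSize n adj (m - 1) v (2 ^ v)) s x s' st)
    (by decide) (by decide) (by decide) (by decide) (by decide) (by simpa using q4) (by simp)
    ⟨roots n, by simpa using g24, by simpa using gst, by simpa using gmem,
      valid_roots n le_rfl, by simp [length_roots], by simp,
      by simp [sum_map_roots], by simp [sum_map_roots]⟩ ?_) ?_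
  · rintro x hx s' hfr' - hsi hinv
    simp only [State.reg_setReg, Nat.reduceEqDiff, if_false, q20] at hx
    refine wp_mono (wp_dfsBody (B := B) (n := n) (m := m) (adj := adj) ?_ ?_ ?_ ?_ ?_ ?_ hx
      hadj hone (by omega) (by omega) (by omega) hinv) ?_
    · rw [hfr' 0 (by decide) (by decide)]; simpa using q0
    · rw [hfr' 4 (by decide) (by decide)]; simpa using q4
    · rw [hfr' 5 (by decide) (by decide)]; simpa using q5
    · rw [hfr' 6 (by decide) (by decide)]; simpa using q6
    · rw [hfr' 20 (by decide) (by decide)]; simpa using q20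
    · rw [hfr' 40 (by decide) (by decide)]; simpa using q40
    · rintro s'' k ⟨hk, st, hs⟩
      exact ⟨hk, st, by simpa using hs.pointer, hs.stack, hs.input, hs.valid, hs.length,
        by simpa using hs.count, by simpa using hs.total, hs.size⟩
  · rintro s' k ⟨⟨st, hs⟩, -, -, hk⟩
    simp only [State.reg_setReg, Nat.reduceEqDiff, if_false, q20] at hs hk
    refine ⟨⟨hs.count, fun hle => ?_⟩, by omega⟩
    have ht := hs.total
    cases st with
    | nil => simpa using ht
    | cons w st =>
      have := hs.size.resolve_left (by simp)
      have hpos : ∀ r l μ, 1 ≤ walkSize n adj r l μ := by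
        intro r l μ
        cases r <;> simp [walkSize]
      have := hpos (m - w.len) w.last w.mask
      simp only [List.map_cons, List.sum_cons] at *
      omega

end RAM

/-! ### The walks that the search enumerates -/

/-- No carry occurs when the bit was clear, so addition inserts a vertex into the mask. -/
theorem Nat.testBit_add_two_pow {x i : ℕ} (h : x.testBit i = false) (j : ℕ) :
    (x + 2 ^ i).testBit j = (x.testBit j || decide (j = i)) := by
  induction i generalizing x j with
  | zero =>
    simp only [Nat.testBit_zero, decide_eq_false_iff_not] at h
    cases j with
    | zero =>
      simp only [pow_zero, Nat.testBit_zero, decide_true, Bool.or_true, decide_eq_true_eq]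
      omega
    | succ j =>
      rw [Nat.testBit_succ, Nat.testBit_succ]
      have : (x + 1) / 2 = x / 2 := by omega
      simp [this]
  | succ i ih =>
    rw [Nat.testBit_succ] at h
    have e : (x + 2 ^ (i + 1)) / 2 = x / 2 + 2 ^ i := by rw [pow_succ]; omega
    cases j with
    | zero =>
      have : (x + 2 ^ (i + 1)) % 2 = x % 2 := by rw [pow_succ]; omega
      simp [Nat.testBit_zero, this]
    | succ j => rw [Nat.testBit_succ, Nat.testBit_succ, e, ih h]; simp

section walks

variable {n : ℕ} (G : SimpleGraph (Fin n))

open Classical in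
/-- The adjacency matrix of `G`, extended by zero. -/
noncomputable def adjNat (u v : ℕ) : ℕ :=
  if ∃ u' v' : Fin n, u' = u ∧ v' = v ∧ G.Adj u' v' then 1 else 0

open Classical in
theorem adjNat_coe (u v : Fin n) : adjNat G u v = if G.Adj u v then 1 else 0 := by
  unfold adjNat
  congr 1
  simp only [eq_iff_iff]
  constructor
  · rintro ⟨u', v', h1, h2, h⟩
    rwa [Fin.ext h1, Fin.ext h2] at h
  · exact fun h => ⟨u, v, rfl, rfl, h⟩

theorem adjNat_le_one (u v : ℕ) : adjNat G u v ≤ 1 := by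
  unfold adjNat
  split_ifs <;> simp

/-- The self-avoiding walks whose vertices, except for the first one, are not bits of `μ`. -/
def IsSelfAvoiding {r : ℕ} (μ : ℕ) (g : Fin (r + 1) → Fin n) : Prop :=
  (∀ i : Fin r, G.Adj (g i.castSucc) (g i.succ)) ∧ Function.Injective g ∧
    ∀ i : Fin r, μ.testBit (g i.succ) = false

/-- The mask contains the current vertex l, so later vertices that avoid the mask also avoid l. This
turns injectivity into a condition checked one step at a time. -/
theorem isSelfAvoiding_cons {r μ : ℕ} {l v : Fin n} (hl : μ.testBit l = true)
    (g : Fin r → Fin n) :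
    IsSelfAvoiding G μ (Fin.cons l (Fin.cons v g : Fin (r + 1) → Fin n) : Fin (r + 2) → Fin n) ↔
      (μ.testBit v = false ∧ G.Adj l v) ∧
        IsSelfAvoiding G (μ + 2 ^ (v : ℕ)) (Fin.cons v g : Fin (r + 1) → Fin n) := by
  unfold IsSelfAvoiding
  rw [Fin.forall_fin_succ, Fin.forall_fin_succ (P := fun i => μ.testBit _ = false)]
  simp only [Fin.cons_injective_iff, Fin.cons_succ, Fin.castSucc_zero, Fin.cons_zero,
    ← Fin.succ_castSucc, Set.mem_range, not_exists]
  constructor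
  · rintro ⟨⟨h1, h2⟩, ⟨h3, h4, h5⟩, h6, h7⟩
    refine ⟨⟨h6, h1⟩, h2, ⟨h4, h5⟩, fun i => ?_⟩
    rw [Nat.testBit_add_two_pow h6, h7 i]
    simpa [Fin.ext_iff] using h4 i
  · rintro ⟨⟨h6, h1⟩, h2, ⟨h4, h5⟩, h7⟩
    have h8 : ∀ i, μ.testBit (g i) = false := by
      intro i
      have := h7 i
      rw [Nat.testBit_add_two_pow h6] at this
      simp at this
      exact this.1
    refine ⟨⟨h1, h2⟩, ⟨fun i => ?_, h4, h5⟩, h6, h8⟩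
    refine Fin.cases ?_ (fun j => ?_) i
    · rw [Fin.cons_zero]; exact h1.ne'
    · rw [Fin.cons_succ]
      intro h
      have := h8 j
      rw [h, hl] at this
      cases this

open Classical in
theorem walkSum_eq (h : ℕ → ℕ) (r : ℕ) {l : Fin n} {μ : ℕ} (hl : μ.testBit l = true) :
    RAM.walkSum n (adjNat G) h r l μ = ∑ g : Fin r → Fin n,
      if IsSelfAvoiding G μ (Fin.cons l g : Fin (r + 1) → Fin n) then
        h ((Fin.cons l g : Fin (r + 1) → Fin n) (Fin.last r)) else 0 := by
  induction r generalizing l μ with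
  | zero =>
    rw [Fintype.sum_unique, if_pos]
    · rfl
    · exact ⟨fun i => i.elim0, fun i j _ => Fin.ext (by omega), fun i => i.elim0⟩
  | succ r ih =>
    rw [RAM.walkSum, Finset.sum_range, ← (Fin.consEquiv fun _ : Fin (r + 1) => Fin n).sum_comp,
      Fintype.sum_prod_type]
    refine Finset.sum_congr rfl fun v _ => ?_
    have hcons : ∀ g : Fin r → Fin n, (Fin.consEquiv fun _ : Fin (r + 1) => Fin n) (v, g) =
      (Fin.cons v g : Fin (r + 1) → Fin n) := fun g => rfl
    have hadj : 0 < adjNat G l v ↔ G.Adj l v := by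
      rw [adjNat_coe]
      split_ifs <;> simp [*]
    simp only [hcons, isSelfAvoiding_cons G hl, hadj]
    by_cases hv : μ.testBit v = false ∧ G.Adj l v
    · rw [if_pos hv, ih (by simp [Nat.testBit_add_two_pow hv.1])]
      refine Finset.sum_congr rfl fun g _ => ?_
      simp only [hv, true_and, and_true, ← Fin.succ_last, Fin.cons_succ]
    · rw [if_neg hv]
      simp only [hv, false_and, if_false, Finset.sum_const_zero]

theorem walkSize_eq (adj : ℕ → ℕ → ℕ) (r l μ : ℕ) :
    RAM.walkSize n adj r l μ =
      ∑ j ∈ Finset.range (r + 1), RAM.walkSum n adj (fun _ => 1) j l μ := by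
  induction r generalizing l μ with
  | zero => simp [RAM.walkSize, RAM.walkSum]
  | succ r ih =>
    rw [Finset.sum_range_succ', RAM.walkSize, RAM.walkSum, add_comm]
    simp only [RAM.walkSum]
    rw [Finset.sum_comm]
    congr 1
    refine Finset.sum_congr rfl fun v _ => ?_
    split_ifs
    · exact ih _ _
    · simp

-- The initial mask contains only the start, and avoiding the start is already part of injectivity.
-- The sum over starts and extensions thus becomes one over injections.
open Classical in
theorem sum_walkSum_eq (h : ℕ → ℕ → ℕ) (r : ℕ) :
    ∑ v ∈ Finset.range n, RAM.walkSum n (adjNat G) (h v) r v (2 ^ v) =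
      ∑ g : Fin (r + 1) ↪ Fin n, if ∀ i : Fin r, G.Adj (g i.castSucc) (g i.succ) then
        h (g 0) (g (Fin.last r)) else 0 := by
  rw [Finset.sum_range]
  have h1 : ∀ v : Fin n, RAM.walkSum n (adjNat G) (h v) r v (2 ^ (v : ℕ)) =
      ∑ g : Fin r → Fin n, if (∀ i : Fin r, G.Adj ((Fin.cons v g : Fin (r + 1) → Fin n) i.castSucc)
        ((Fin.cons v g : Fin (r + 1) → Fin n) i.succ)) ∧
        Function.Injective (Fin.cons v g : Fin (r + 1) → Fin n) then
          h v ((Fin.cons v g : Fin (r + 1) → Fin n) (Fin.last r)) else 0 := by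
    intro v
    rw [walkSum_eq G _ _ (by simp [Nat.testBit_two_pow_self])]
    refine Finset.sum_congr rfl fun g _ => ?_
    congr 1
    simp only [IsSelfAvoiding, eq_iff_iff]
    constructor
    · exact fun h => ⟨h.1, h.2.1⟩
    · refine fun h => ⟨h.1, h.2, fun i => ?_⟩
      rw [Nat.testBit_two_pow_of_ne]
      intro he
      have := h.2 (a₁ := 0) (a₂ := i.succ) (Fin.ext he)
      exact (Fin.succ_ne_zero i) this.symm
  simp only [h1]
  rw [← Fintype.sum_prod_type', ← (Fin.consEquiv fun _ : Fin (r + 1) => Fin n).symm.sum_comp]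
  simp only [Fin.consEquiv_symm_apply, Fin.cons_self_tail]
  rw [← (Equiv.subtypeInjectiveEquivEmbedding (Fin (r + 1)) (Fin n)).sum_comp]
  simp only [and_comm (b := Function.Injective _), ite_and (Function.Injective _)]
  rw [← Finset.sum_filter, Finset.sum_subtype _ (p := Function.Injective) (by simp)]
  rfl

/-- The edges of the path on `Fin (r + 1)`. -/
def pathEdges (r : ℕ) : Finset (Sym2 (Fin (r + 1))) :=
  Finset.univ.image fun i : Fin r => s(i.castSucc, i.succ)

theorem card_pathEdges (r : ℕ) : (pathEdges r).card = r := by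
  rw [pathEdges, Finset.card_image_of_injective, Finset.card_univ, Fintype.card_fin]
  intro i j hij
  simp only [Sym2.eq_iff, Fin.ext_iff, Fin.val_castSucc, Fin.val_succ] at hij
  exact Fin.ext (by omega)

theorem not_isDiag_of_mem_pathEdges {r : ℕ} {e : Sym2 (Fin (r + 1))} (he : e ∈ pathEdges r) :
    ¬ e.IsDiag := by
  obtain ⟨i, -, rfl⟩ := Finset.mem_image.1 he
  simp [Fin.ext_iff]

theorem sum_walkSum_one (r : ℕ) :
    ∑ v ∈ Finset.range n, RAM.walkSum n (adjNat G) (fun _ => 1) r v (2 ^ v) =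
      copies (pathEdges r) G := by
  classical
  rw [sum_walkSum_eq G (fun _ _ => 1), copies, Finset.card_filter]
  simp [pathEdges]

theorem sum_walkSize (r : ℕ) :
    ∑ v ∈ Finset.range n, RAM.walkSize n (adjNat G) r v (2 ^ v) =
      ∑ j ∈ Finset.range (r + 1), copies (pathEdges j) G := by
  simp only [walkSize_eq, ← sum_walkSum_one]
  exact Finset.sum_comm

/-- A labelled cycle is a self-avoiding walk on m vertices whose last vertex is adjacent to the
first, so the search yields 2m C_m without any division. -/
theorem sum_walkSum_adj {m : ℕ} [NeZero m] :
    ∑ v ∈ Finset.range n, RAM.walkSum n (adjNat G) (adjNat G · v) (m - 1) v (2 ^ v) =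
      copies (cycleEdges m) G := by
  classical
  obtain ⟨r, rfl⟩ : ∃ r, m = r + 1 := ⟨m - 1, (Nat.succ_pred_eq_of_ne_zero (NeZero.ne m)).symm⟩
  rw [Nat.add_sub_cancel, sum_walkSum_eq G (fun v l => adjNat G l v), copies, Finset.card_filter]
  refine Finset.sum_congr rfl fun g _ => ?_
  have : (∀ e ∈ cycleEdges (r + 1), Sym2.map g e ∈ G.edgeSet) ↔
      (∀ i : Fin r, G.Adj (g i.castSucc) (g i.succ)) ∧ G.Adj (g (Fin.last r)) (g 0) := by
    simp only [cycleEdges, Finset.forall_mem_image, Finset.mem_univ, forall_true_left, Sym2.map_mk,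
      SimpleGraph.mem_edgeSet]
    rw [Fin.forall_fin_succ']
    simp [Fin.coeSucc_eq_succ]
  simp only [this, adjNat_coe, ite_and]

end walks

/-- With high probability the search processes less than `n ^ 2` nodes. -/
theorem whp_walkSize {a b : ℝ} (hb : 0 ≤ b) (hba : b ≤ a) (ha : 1 ≤ a) :
    WHP a b fun n G => 3 ≤ cycleLength n →
      ∑ v ∈ Finset.range n, RAM.walkSize n (adjNat G) (cycleLength n - 1) v (2 ^ v) ≤ n * n := by
  have h := whp_of_tendsto_graphExp (a := a) (b := b) (F := fun n G =>
    ∑ j ∈ Finset.range (cycleLength n), (1 / (n : ℝ) ^ 2) * (copies (pathEdges j) G : ℝ)) hb hba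
    (fun n G => by positivity) ?_
  · refine h.mono_of_le hb hba h ?_
    filter_upwards [eventually_gt_atTop 0] with n hn G hG _ hm
    rw [sum_walkSize, Nat.sub_add_cancel (by omega)]
    rw [← Finset.mul_sum, one_div, inv_mul_lt_iff₀ (by positivity), mul_one] at hG
    rw [← sq]
    exact_mod_cast hG.le
  · have h0 := tendsto_pow_cycleLength_div a (by linarith) 1
    refine squeeze_zero' ?_ ?_ h0
    · filter_upwards [eventually_params hb hba] with n ⟨⟨h1, h2, h3, h4⟩, _⟩
      exact graphExp_nonneg h1 h2 h3 h4 fun G => by positivity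
    · filter_upwards [eventually_params hb hba] with n ⟨⟨h1, h2, h3, h4⟩, _, hn⟩
      rw [graphExp_sum]
      have hn' : (0 : ℝ) < n := by exact_mod_cast hn
      -- The expected number of labelled paths with j edges is at most n^(j+1) (a/n)^j = n a^j.
      have hterm : ∀ j ∈ Finset.range (cycleLength n), graphExp n (a / n) (b / n)
          (fun G => (1 / (n : ℝ) ^ 2) * (copies (pathEdges j) G : ℝ)) ≤ a ^ cycleLength n / n := by
        intro j hj
        rw [graphExp_const_mul]
        have h5 := graphExp_copies_le (n := n) h3 (by gcongr) h2 (pathEdges j)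
          fun e he => not_isDiag_of_mem_pathEdges he
        rw [card_pathEdges, Fintype.card_fin] at h5
        calc _ ≤ 1 / (n : ℝ) ^ 2 * ((n : ℝ) ^ (j + 1) * (a / n) ^ j) := by gcongr
          _ = a ^ j / n := by rw [div_pow]; field_simp; ring
          _ ≤ _ := by
            gcongr
            exact (Finset.mem_range.1 hj).le
      refine (Finset.sum_le_sum hterm).trans ?_
      rw [Finset.sum_const, Finset.card_range, nsmul_eq_mul, ← mul_div_assoc, pow_one, mul_pow,
        mul_comm]
      gcongr
      generalize cycleLength n = m
      rcases Nat.eq_zero_or_pos m with rfl | hm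
      · simp
      · exact_mod_cast (Nat.le_succ m).trans (Nat.le_self_pow hm.ne' _)

namespace RAM

/-! ### The input -/

section input

variable {n : ℕ} (G : SimpleGraph (Fin n)) (k : ℕ)

theorem input_mem_le_one (i : ℕ) : (input G k).mem i ≤ 1 := by
  classical
  simp only [input]
  split_ifs <;> simp

theorem input_mem_coe (u v : Fin n) : (input G k).mem (u * n + v) = adjNat G u v := by
  classical
  rw [adjNat_coe]
  simp only [input]
  congr 1
  rw [eq_iff_iff]
  refine ⟨?_, fun h => ⟨u, v, rfl, h⟩⟩
  rintro ⟨u', v', he, h⟩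
  have h1 : finProdFinEquiv (u, v) = finProdFinEquiv (u', v') := by
    apply Fin.ext
    simp only [finProdFinEquiv_apply_val]
    linarith
  obtain ⟨rfl, rfl⟩ := Prod.mk.inj (finProdFinEquiv.injective h1)
  exact h

theorem sum_input_mem : ∑ i ∈ Finset.range (n * n), (input G k).mem i = 2 * G.edgeSet.ncard := by
  classical
  rw [two_mul_ncard_edgeSet, Finset.card_filter, Finset.sum_range, ← finProdFinEquiv.sum_comp]
  refine Finset.sum_congr rfl fun z _ => ?_
  rw [finProdFinEquiv_apply_val, add_comm, mul_comm, input_mem_coe, adjNat_coe]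

end input

/-! ### The whole program -/

/-- The program that calculates the estimators. -/
def mainProg : Prog := .const 4 1 ;; searchProg ;; edgeProg ;; dfsProg ;; powProg ;; rootProg

/-- The number of bits that suffices for all numbers in a run. -/
def bitBound (n k : ℕ) : ℕ := 8 * (n + k + 2) ^ 3

/-! ### All numbers in a run fit into `bitBound n k` bits -/

section bounds

variable {n k : ℕ}

theorem lt_two_pow_bitBound {x e : ℕ} (hx : x ≤ 2 ^ e) (he : e < bitBound n k) :
    x < 2 ^ bitBound n k :=
  lt_of_le_of_lt hx (Nat.pow_lt_pow_right (by norm_num) he)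

theorem pow_le_two_pow {N x a b : ℕ} (hx : x ≤ 2 ^ a) (hb : b ≤ N) : x ^ b ≤ 2 ^ (a * N) := by
  calc x ^ b ≤ (2 ^ a) ^ b := Nat.pow_le_pow_left hx b
    _ = 2 ^ (a * b) := by rw [pow_mul]
    _ ≤ 2 ^ (a * N) := Nat.pow_le_pow_right (by norm_num) (Nat.mul_le_mul_left _ hb)

theorem search_lt : ((n + 1) ^ 4 + n + 1) ^ (n + 1) < 2 ^ bitBound n k := by
  obtain ⟨N, hN⟩ : ∃ N, N = n + k + 2 := ⟨_, rfl⟩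
  have hN2 : N ≤ 2 ^ N := Nat.lt_two_pow_self.le
  have h1 : (n + 1) ^ 4 + n + 1 ≤ 2 ^ (5 * N) := by
    calc (n + 1) ^ 4 + n + 1 ≤ N ^ 4 + N ^ 4 := by
          have : (n + 1) ^ 4 ≤ N ^ 4 := Nat.pow_le_pow_left (by omega) 4
          have : N ≤ N ^ 4 := Nat.le_self_pow (by norm_num) N
          omega
      _ = 2 * N ^ 4 := by ring
      _ ≤ N * N ^ 4 := Nat.mul_le_mul_right _ (by omega)
      _ = N ^ 5 := by ring
      _ ≤ (2 ^ N) ^ 5 := Nat.pow_le_pow_left hN2 5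
      _ = 2 ^ (5 * N) := by rw [← pow_mul, mul_comm]
  refine lt_two_pow_bitBound (pow_le_two_pow h1 (b := n + 1) (N := N) (by omega)) ?_
  rw [bitBound, ← hN]
  have hN' : 2 ≤ N := by omega
  nlinarith [Nat.mul_le_mul_left (N * N) hN', Nat.mul_le_mul hN' hN']

theorem stack_lt : n * n + 4 * (n + n * n * n) + 4 < 2 ^ bitBound n k := by
  have hlt : bitBound n k < 2 ^ bitBound n k := Nat.lt_two_pow_self
  refine lt_of_le_of_lt ?_ hlt
  have h3 : (n + 2) ^ 3 ≤ (n + k + 2) ^ 3 := Nat.pow_le_pow_left (by omega) 3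
  rw [bitBound]
  nlinarith

theorem sq_add_lt : n * n + n * n + k < 2 ^ bitBound n k := by
  have hlt : bitBound n k < 2 ^ bitBound n k := Nat.lt_two_pow_self
  refine lt_of_le_of_lt ?_ hlt
  have h3 : (n + k + 2) ^ 2 ≤ (n + k + 2) ^ 3 := Nat.pow_le_pow_right (by omega) (by omega)
  rw [bitBound]
  nlinarith

theorem mul_two_pow_lt {m : ℕ} (hm : m ≤ n) : (m + 1) * 2 ^ n < 2 ^ bitBound n k := by
  obtain ⟨N, hN⟩ : ∃ N, N = n + k + 2 := ⟨_, rfl⟩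
  have hN2 : N ≤ 2 ^ N := Nat.lt_two_pow_self.le
  refine lt_two_pow_bitBound (e := N + N) ?_ ?_
  · rw [pow_add]
    exact Nat.mul_le_mul (by omega) (Nat.pow_le_pow_right (by norm_num) (by omega))
  · have := Nat.le_self_pow (show 3 ≠ 0 by norm_num) N
    rw [bitBound, ← hN]
    omega

theorem two_pow_lt : 2 ^ k < 2 ^ bitBound n k := by
  refine Nat.pow_lt_pow_right (by norm_num) ?_
  have := Nat.le_self_pow (show 3 ≠ 0 by norm_num) (n + k + 2)
  rw [bitBound]
  omega

theorem pow_lt {m x : ℕ} (hm : m ≤ n) (hx : x ≤ 2 ^ (2 * (n + k + 2))) :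
    x ^ m < 2 ^ bitBound n k := by
  refine lt_two_pow_bitBound (pow_le_two_pow hx (N := n + k + 2) (by omega)) ?_
  have : (n + k + 2) ^ 2 ≤ (n + k + 2) ^ 3 := Nat.pow_le_pow_right (by omega) (by omega)
  rw [bitBound]
  nlinarith

theorem root_lt {m c : ℕ} (hm : m ≤ n) (hc : c ≤ n * n) :
    (n + 1) ^ m * (2 * (c * n ^ m * 2 ^ k + 2 ^ k + 1)) ^ (m + 1) < 2 ^ bitBound n k := by
  obtain ⟨N, hN⟩ : ∃ N, N = n + k + 2 := ⟨_, rfl⟩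
  have hN2 : N ≤ 2 ^ N := Nat.lt_two_pow_self.le
  have h1 : (n + 1) ^ m ≤ 2 ^ (N * N) := pow_le_two_pow (le_trans (by omega) hN2) (by omega)
  have h1' : n ^ m ≤ 2 ^ (N * N) := (Nat.pow_le_pow_left (by omega) m).trans h1
  have hk : 2 ^ k ≤ 2 ^ N := Nat.pow_le_pow_right (by norm_num) (by omega)
  have hc' : c ≤ 2 ^ N * 2 ^ N := hc.trans (Nat.mul_le_mul (by omega) (by omega))
  have h2 : c * n ^ m * 2 ^ k ≤ 2 ^ (N * N + 3 * N) := by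
    calc c * n ^ m * 2 ^ k ≤ 2 ^ N * 2 ^ N * 2 ^ (N * N) * 2 ^ N :=
          Nat.mul_le_mul (Nat.mul_le_mul hc' h1') hk
      _ = 2 ^ (N * N + 3 * N) := by rw [← pow_add, ← pow_add, ← pow_add]; congr 1; ring
  have h3 : 2 ^ N ≤ 2 ^ (N * N + 3 * N) := Nat.pow_le_pow_right (by norm_num) (by nlinarith)
  have h4 : 2 * (c * n ^ m * 2 ^ k + 2 ^ k + 1) ≤ 2 ^ (N * N + 3 * N + 3) := by
    rw [pow_add _ (N * N + 3 * N)]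
    have : 1 ≤ 2 ^ N := Nat.one_le_two_pow
    omega
  refine lt_two_pow_bitBound (e := N * N + (N * N + 3 * N + 3) * N) ?_ ?_
  · rw [pow_add 2 (N * N)]
    exact Nat.mul_le_mul h1 (pow_le_two_pow h4 (by omega))
  · have hN' : 2 ≤ N := by omega
    have q1 : 2 * (N * N) ≤ N * (N * N) := Nat.mul_le_mul_right _ hN'
    have q2 : 2 * N ≤ N * N := Nat.mul_le_mul_right _ hN'
    rw [bitBound, ← hN]
    have e1 : (N * N + 3 * N + 3) * N = N * (N * N) + 3 * (N * N) + 3 * N := by ring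
    have e2 : N ^ 3 = N * (N * N) := by ring
    rw [e1, e2]
    omega

end bounds

/-- The number of steps of a run is at most this. -/
def stepBound (n k m : ℕ) : ℕ :=
  n * (n * 7 + 13) + n * n * 4 + n * n * (n * 22 + 20 + 2) + n * 11 + k * 3 + m * 5 +
    (n * n + n * n + k) * (m * 3 + 11) + 44

/-- Termination and the step bound hold for every graph. Only the meaning of the count and of the
root depends on conditions, which later hold with high probability. -/
theorem wp_main {n : ℕ} (G : SimpleGraph (Fin n)) (k : ℕ) :
    wp (bitBound n k) mainProg (input G k) fun s t =>
      (∃ c ≤ n * n, (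
          ∑ v ∈ Finset.range n, walkSize n (adjNat G) (searchLen n n - 1) v (2 ^ v) ≤ n * n →
          c = ∑ v ∈ Finset.range n,
            walkSum n (adjNat G) (adjNat G · v) (searchLen n n - 1) v (2 ^ v)) ∧
        s.reg 0 = 2 * G.edgeSet.ncard ∧ s.reg 1 = n ∧ s.reg 3 = 2 ^ k ∧
        (1 ≤ searchLen n n → 1 ≤ n → (c * n ^ searchLen n n -
            (2 * G.edgeSet.ncard) ^ searchLen n n) * 2 ^ k < 2 ^ (n * n + n * n + k) →
          n ^ searchLen n n * s.reg 2 ^ searchLen n n ≤ (c * n ^ searchLen n n -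
            (2 * G.edgeSet.ncard) ^ searchLen n n) * (2 ^ k) ^ searchLen n n ∧
          (c * n ^ searchLen n n - (2 * G.edgeSet.ncard) ^ searchLen n n) *
            (2 ^ k) ^ searchLen n n < n ^ searchLen n n * (s.reg 2 + 1) ^ searchLen n n)) ∧
      t ≤ stepBound n k (searchLen n n) := by
  have hm := searchLen_le n n
  have hsum := sum_input_mem G k
  have hE : 2 * G.edgeSet.ncard ≤ n * n := by
    rw [← hsum]
    refine (Finset.sum_le_sum fun i _ => input_mem_le_one G k i).trans ?_
    simp
  have hN2 : n + k + 2 < 2 ^ (n + k + 2) := Nat.lt_two_pow_self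
  have hsq := sq_add_lt (n := n) (k := k)
  have hsq' : (n + k + 2) * (n + k + 2) ≤ 2 ^ (2 * (n + k + 2)) := by
    rw [two_mul, pow_add]
    exact Nat.mul_le_mul hN2.le hN2.le
  have hN1 : n + k + 2 ≤ (n + k + 2) * (n + k + 2) := Nat.le_mul_of_pos_left _ (by omega)
  have hlt : n + k + 2 < 2 ^ bitBound n k := by
    refine lt_two_pow_bitBound (e := n + k + 2) hN2.le ?_
    have := Nat.le_self_pow (show 3 ≠ 0 by norm_num) (n + k + 2)
    rw [bitBound]
    omega
  refine wp_seq (wp_of_vc ?_)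
  simp only [vc]
  refine ⟨by omega, wp_seq (wp_frame (wp_search (n := n) (by simp [input]) (by simp)
    (by simp [input]) search_lt) ?_)⟩
  rintro s₁ k₁ ⟨a6, hk₁⟩ hfr₁ hmem₁
  have a0 : s₁.reg 0 = n := by rw [hfr₁ 0 (by decide)]; simp [input]
  have a1 : s₁.reg 1 = k := by rw [hfr₁ 1 (by decide)]; simp [input]
  have a4 : s₁.reg 4 = 1 := by rw [hfr₁ 4 (by decide)]; simp
  have a5 : s₁.reg 5 = 0 := by rw [hfr₁ 5 (by decide)]; simp [input]
  have am : s₁.mem = (input G k).mem := by rw [hmem₁ (by decide)]; rfl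
  generalize searchLen n n = m at *
  refine wp_seq (wp_frame (wp_edge a0 a4 (by simpa [am] using input_mem_le_one G k)
    (by omega)) ?_)
  rintro s₂ k₂ ⟨⟨b20, b21⟩, hk₂⟩ hfr₂ hmem₂
  rw [am, hsum] at b21
  have b0 : s₂.reg 0 = n := by rw [hfr₂ 0 (by decide), a0]
  have b1 : s₂.reg 1 = k := by rw [hfr₂ 1 (by decide), a1]
  have b4 : s₂.reg 4 = 1 := by rw [hfr₂ 4 (by decide), a4]
  have b5 : s₂.reg 5 = 0 := by rw [hfr₂ 5 (by decide), a5]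
  have b6 : s₂.reg 6 = m := by rw [hfr₂ 6 (by decide), a6]
  have bm : s₂.mem = (input G k).mem := by rw [hmem₂ (by decide), am]
  refine wp_seq (wp_frame (wp_dfs (adj := adjNat G) b0 b4 b5 b6 b20
    (fun u hu v hv => by rw [bm]; exact input_mem_coe G k ⟨u, hu⟩ ⟨v, hv⟩) (adjNat_le_one G)
    stack_lt (mul_two_pow_lt hm)) ?_)
  rintro s₃ k₃ ⟨⟨c28, ctot⟩, hk₃⟩ hfr₃ -
  have c0 : s₃.reg 0 = n := by rw [hfr₃ 0 (by decide), b0]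
  have c1 : s₃.reg 1 = k := by rw [hfr₃ 1 (by decide), b1]
  have c4 : s₃.reg 4 = 1 := by rw [hfr₃ 4 (by decide), b4]
  have c5 : s₃.reg 5 = 0 := by rw [hfr₃ 5 (by decide), b5]
  have c6 : s₃.reg 6 = m := by rw [hfr₃ 6 (by decide), b6]
  have c20 : s₃.reg 20 = n * n := by rw [hfr₃ 20 (by decide), b20]
  have c21 : s₃.reg 21 = 2 * G.edgeSet.ncard := by rw [hfr₃ 21 (by decide), b21]
  refine wp_seq (wp_frame (wp_pow c0 c1 c4 c6 c21 two_pow_lt (pow_lt hm (by omega))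
    (pow_lt hm (by nlinarith)) (pow_lt hm (Nat.pow_le_pow_right (by norm_num) (by omega)))) ?_)
  rintro s₄ k₄ ⟨⟨d41, d43, d44, d45⟩, hk₄⟩ hfr₄ -
  refine wp_mono (wp_root (c := s₃.reg 28) (by rw [hfr₄ 0 (by decide), c0])
    (by rw [hfr₄ 1 (by decide), c1]) (by rw [hfr₄ 4 (by decide), c4])
    (by rw [hfr₄ 5 (by decide), c5]) (by rw [hfr₄ 6 (by decide), c6])
    (by rw [hfr₄ 20 (by decide), c20]) (by rw [hfr₄ 21 (by decide), c21]) (hfr₄ 28 (by decide))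
    d41 d43 d44 d45 hsq (by omega) (by omega) (root_lt hm c28)) ?_
  rintro s₅ k₅ ⟨⟨e0, e1, e3, eroot⟩, hk₅⟩
  refine ⟨⟨s₃.reg 28, c28, ctot, e0, e1, e3, eroot⟩, ?_⟩
  unfold stepBound
  omega

theorem stepBound_mul_le {n k m : ℕ} (hm : m ≤ n) :
    stepBound n k m * (3 * bitBound n k + 1) ≤ (n + k + 2) ^ 19 := by
  obtain ⟨N, hN⟩ : ∃ N, N = n + k + 2 := ⟨_, rfl⟩
  have hn : n ≤ N := by omega
  have hk : k ≤ N := by omega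
  have hmN : m ≤ N := by omega
  have hN2 : 2 ≤ N := by omega
  have hpow : ∀ a b : ℕ, a ≤ b → N ^ a ≤ N ^ b := fun a b h => Nat.pow_le_pow_right (by omega) h
  have htwo : ∀ a : ℕ, 2 ^ a ≤ N ^ a := fun a => Nat.pow_le_pow_left hN2 a
  have h1 : stepBound n k m ≤ N ^ 11 := by
    have q1 := hpow 1 3 (by norm_num)
    have q2 := hpow 2 3 (by norm_num)
    have q0 := hpow 0 3 (by norm_num)
    -- Since N ≥ 2, numerical constants are absorbed as powers of N: here 28 + 58 + 43 + 44 ≤ 2^8.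
    calc stepBound n k m ≤ N * (N * 7 + 13) + N * N * 4 + N * N * (N * 22 + 20 + 2) + N * 11 +
          N * 3 + N * 5 + (N * N + N * N + N) * (N * 3 + 11) + 44 := by
          unfold stepBound; gcongr
      _ = 28 * N ^ 3 + 58 * N ^ 2 + 43 * N ^ 1 + 44 * N ^ 0 := by ring
      _ ≤ 2 ^ 8 * N ^ 3 := by omega
      _ ≤ N ^ 8 * N ^ 3 := Nat.mul_le_mul_right _ (htwo 8)
      _ = N ^ 11 := by ring
  have h2 : 3 * bitBound n k + 1 ≤ N ^ 8 := by
    have q0 := hpow 0 3 (by norm_num)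
    calc 3 * bitBound n k + 1 = 24 * N ^ 3 + 1 * N ^ 0 := by rw [bitBound, ← hN]; ring
      _ ≤ 2 ^ 5 * N ^ 3 := by omega
      _ ≤ N ^ 5 * N ^ 3 := Nat.mul_le_mul_right _ (htwo 5)
      _ = N ^ 8 := by ring
  rw [← hN]
  calc _ ≤ N ^ 11 * N ^ 8 := Nat.mul_le_mul h1 h2
    _ = N ^ 19 := by ring

theorem bdd_input {n : ℕ} (G : SimpleGraph (Fin n)) (k : ℕ) : Bdd (bitBound n k) (input G k) := by
  have hlt : bitBound n k < 2 ^ bitBound n k := Nat.lt_two_pow_self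
  have hN : n + k + 2 ≤ bitBound n k := by
    have := Nat.le_self_pow (show 3 ≠ 0 by norm_num) (n + k + 2)
    rw [bitBound]
    omega
  constructor
  · intro i
    simp only [input]
    split_ifs <;> omega
  · intro i
    have := input_mem_le_one G k i
    omega

theorem polyTime_mainProg : PolyTime mainProg := by
  refine ⟨19, fun n G k => ?_⟩
  obtain ⟨s, t, j, he, -, ht, -, hj⟩ := wp_main G k (bdd_input G k)
  exact ⟨s, t, he, ht.trans ((Nat.mul_le_mul_right _ hj).trans
    (stepBound_mul_le (searchLen_le n n)))⟩

/-- Taking m-th roots in the two integer inequalities gives lo/2^k ≤ f < (lo+1)/2^k. -/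
theorem abs_root_sub_le {x f : ℝ} {n m lo k A : ℕ} (hn : 0 < n) (hm : m ≠ 0) (hf : 0 ≤ f)
    (hfx : f ^ m = x) (hx : x = A / (n : ℝ) ^ m)
    (h₁ : n ^ m * lo ^ m ≤ A * (2 ^ k) ^ m) (h₂ : A * (2 ^ k) ^ m < n ^ m * (lo + 1) ^ m) :
    |f - (lo : ℝ) / (2 ^ k : ℕ)| ≤ (1 / 2 : ℝ) ^ k := by
  have hn' : (0 : ℝ) < n := by exact_mod_cast hn
  have g₁ : ((lo : ℝ) / 2 ^ k) ^ m ≤ f ^ m := by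
    rw [hfx, hx, div_pow, div_le_div_iff₀ (by positivity) (by positivity)]
    have : (n : ℝ) ^ m * (lo : ℝ) ^ m ≤ A * (2 ^ k) ^ m := by exact_mod_cast h₁
    linarith
  have g₂ : f ^ m < (((lo : ℝ) + 1) / 2 ^ k) ^ m := by
    rw [hfx, hx, div_pow, div_lt_div_iff₀ (by positivity) (by positivity)]
    have : (A : ℝ) * (2 ^ k) ^ m < (n : ℝ) ^ m * ((lo : ℝ) + 1) ^ m := by exact_mod_cast h₂
    linarith
  have k₁ := le_of_pow_le_pow_left₀ hm hf g₁
  have k₂ := lt_of_pow_lt_pow_left₀ m (by positivity) g₂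
  rw [add_div] at k₂
  push_cast
  rw [abs_of_nonneg (by linarith), one_div_pow]
  linarith

theorem calculates_mainProg {n : ℕ} (G : SimpleGraph (Fin n)) (hn : 2 ≤ n)
    (hm : 3 ≤ cycleLength n) (hlen : searchLen n n = cycleLength n)
    (hsize : ∑ v ∈ Finset.range n, walkSize n (adjNat G) (cycleLength n - 1) v (2 ^ v) ≤ n * n)
    (hrad : 0 ≤ radicand G) : Calculates mainProg G (dHat G) (fHat G) := by
  intro k
  obtain ⟨s, t, -, he, -, -, ⟨c, hc, hcyc, h0, h1, h3, hroot⟩, -⟩ := wp_main G k (bdd_input G k)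
  have hmn := searchLen_le n n
  rw [hlen] at hcyc hroot hmn
  have hcyc := hcyc hsize
  have : NeZero (cycleLength n) := ⟨by omega⟩
  rw [sum_walkSum_adj, ← two_mul_mul_copyCount hm] at hcyc
  have hn' : (0 : ℝ) < n := by exact_mod_cast (show 0 < n by omega)
  have hrad' : radicand G = ((c : ℝ) * n ^ cycleLength n -
      (2 * G.edgeSet.ncard : ℕ) ^ cycleLength n) / (n : ℝ) ^ cycleLength n := by
    rw [radicand, dHat, cycleCount, hcyc, div_pow]
    push_cast
    field_simp
  -- A nonnegative radicand makes the truncated subtraction exact.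
  have hle : (2 * G.edgeSet.ncard) ^ cycleLength n ≤ c * n ^ cycleLength n := by
    rw [hrad', le_div_iff₀ (by positivity), zero_mul, sub_nonneg] at hrad
    exact_mod_cast hrad
  -- The budget of 2n^2 + k bisection rounds comes from here: the count is at most n^2 and m ≤ n, so
  -- A ≤ n^(n+2) < 2^(n(n+2)) ≤ 2^(2n^2) for n ≥ 2.
  have hlt : (c * n ^ cycleLength n - (2 * G.edgeSet.ncard) ^ cycleLength n) * 2 ^ k <
      2 ^ (n * n + n * n + k) := by
    rw [pow_add _ _ k]
    refine Nat.mul_lt_mul_of_pos_right ?_ (by positivity)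
    calc c * n ^ cycleLength n - (2 * G.edgeSet.ncard) ^ cycleLength n
        ≤ c * n ^ cycleLength n := Nat.sub_le _ _
      _ ≤ n * n * n ^ n := Nat.mul_le_mul hc (Nat.pow_le_pow_right (by omega) hmn)
      _ = n ^ (n + 2) := by ring
      _ < (2 ^ n) ^ (n + 2) := Nat.pow_lt_pow_left Nat.lt_two_pow_self (by omega)
      _ = 2 ^ (n * (n + 2)) := by rw [pow_mul]
      _ ≤ 2 ^ (n * n + n * n) := Nat.pow_le_pow_right (by norm_num) (by nlinarith)
  obtain ⟨r₁, r₂⟩ := hroot (by omega) (by omega) hlt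
  refine ⟨s, t, he, by omega, ?_, by rw [h3]; positivity, ?_⟩
  · rw [h0, h1, dHat]
    push_cast
    rfl
  · rw [h3]
    refine abs_root_sub_le (by omega) (by omega) (Real.rpow_nonneg hrad _) (x := radicand G) ?_ ?_
      r₁ r₂
    · rw [fHat, one_div, Real.rpow_inv_natCast_pow hrad (by omega)]
    · rw [hrad', Nat.cast_sub hle]
      push_cast
      rfl

end RAM

theorem mainTheorem12 :
    (∀ a b : ℝ, 0 ≤ b → b ≤ a → (a - b) ^ 2 > 2 * (a + b) →
      IsConsistent a b (fun _ G => dHat G + fHat G) a ∧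
      IsConsistent a b (fun _ G => dHat G - fHat G) b) ∧
    ∃ P : RAM.Prog, RAM.PolyTime P ∧
      ∀ a b : ℝ, 0 ≤ b → b ≤ a → (a - b) ^ 2 > 2 * (a + b) →
        Tendsto (fun n : ℕ => ssbmProb n 2 (a / n) (b / n)
          {z | RAM.Calculates P z.2 (dHat z.2) (fHat z.2)}) atTop (𝓝 1) := by
  refine ⟨fun a b hb hba hab => ⟨isConsistent_add hb hba hab, isConsistent_sub hb hba hab⟩,
    RAM.mainProg, RAM.polyTime_mainProg, fun a b hb hba hab => ?_⟩
  obtain ⟨hf, -, -, -, ha⟩ := params_bounds hb hba hab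
  have h : WHP a b fun n G => RAM.Calculates RAM.mainProg G (dHat G) (fHat G) := by
    -- Only two random events matter, a small search tree and a nonnegative radicand; the
    -- correctness of the computed cycle length is deterministic for large n.
    refine (whp_walkSize hb hba ha).mono_of_le hb hba (whp_radicand hb hba hab) ?_
    filter_upwards [eventually_ge_atTop 2, tendsto_cycleLength.eventually_ge_atTop 3,
      RAM.eventually_searchLen_eq] with n hn hm hlen G hsize hrad
    refine RAM.calculates_mainProg G hn hm hlen (hsize hm) (le_trans ?_ hrad.1)
    have : 0 < (a - b) / 2 := by linarith
    positivity
  exact h.tendsto_one
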